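/- Let $G$ be the random $d$-regular multigraph on $n$ nodes of the configuration model ($nd$ even): each node carries $d$ half-edges, and the $nd$ half-edges are paired by a uniformly random perfect matching. Let $p\ge 2$ be an integer and set $$\ell=\max\bigl(1,\lceil \log_p (n/(2d^2))\rceil\bigr),\qquad \lambda = p^{\ell} d^2/n .$$ For a node $t$ let $WP_0(t)$ be the set of neighbors of $t$ (other than $t$). For $1\le i\le \ell$, each node $u\in WP_{i-1}(t)$ independently selects a uniformly random set of $p$ of its neighbors outside $\{t\}\cup WP_0(t)\cup\dots\cup WP_{i-1}(t)$ (all of them, if there are fewer than $p$), and $WP_i(t)$ is the set of all selected nodes. The inner ring $IR(t)$ consists of the neighbors of nodes of $WP_\ell(t)$ that are not in $\{t\}\cup WP_0(t)\cup\dots\cup WP_\ell(t)$, and the outer ring $OR(t)$ consists of all remaining nodes. **Theorem.** Assume $2(\ln n+5)\le d\ll n$, $2\le p\le d$ and $p\ge (n/d^2)^{1/\ell}$, and fix a destination $t$. Then, as $n\to\infty$, with probability $1-o(1)$ the following hold simultaneously: 1. $|WP_i(t)|=(1\pm o(1))\,d p^i$ for all $0\le i\le \ell$ with $dp^i\ll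 n$ (every $i<\ell$ satisfies this automatically); 2. $|OR(t)|\le (e^{-\lambda}+o(1))\,n$; 3. every node of $OR(t)$ has an edge to a node of $IR(t)$. Precisely: for every $\varepsilon>0$ there are $\delta>0$ and $N$ such that for all $n\ge N$, all $d,p$ with $nd$ even, $2(\ln n+5)\le d\le \delta n$, $2\le p\le d$, $p\ge (n/d^2)^{1/\ell}$, and every node $t$, with probability at least $1-\varepsilon$ all of the following hold: $\bigl||WP_i(t)|-dp^i\bigr|\le \varepsilon\, dp^i$ for all $0\le i\le\ell$ with $dp^i\le\delta n$; $|OR(t)|\le(e^{-\lambda}+\varepsilon)n$; and every node of $OR(t)$ has an edge to a node of $IR(t)$. -/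

import Mathlib

namespace Spraypoint

/-- The pairings of the `n * d` half-edges `(v, j)` (node `v`, port `j`): the fixed-point-free
involutions of the set of half-edges. A uniformly random element of this set is the
configuration model of the random `d`-regular (multi)graph on `n` nodes. -/
def pairings (n d : ℕ) : Finset (Equiv.Perm (Fin n × Fin d)) :=
  Finset.univ.filter fun σ => ∀ x, σ (σ x) = x ∧ σ x ≠ x

/-- The set of nodes joined to `u` by an edge of the multigraph with pairing `σ`. -/
def nbrs {n d : ℕ} (σ : Equiv.Perm (Fin n × Fin d)) (u : Fin n) : Finset (Fin n) :=
  Finset.univ.filter fun v => ∃ i j : Fin d, σ (u, i) = (v, j)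

/-- The possible outcomes of the random waypoint selection. An outcome `s` records, for each
node `u` and each set `E` of eligible nodes that `u` might be confronted with, the set
`s u E` of `p` elements of `E` that `u` selects (all of `E` if `E` has fewer than `p` elements).
For a uniformly random outcome, the sets `s u E` are independent, and each is a uniformly
random subset of `E` of size `min p |E|`. -/
def selections (n p : ℕ) : Finset (Fin n → Finset (Fin n) → Finset (Fin n)) :=
  Fintype.piFinset fun _ => Fintype.piFinset fun E => E.powersetCard (min p E.card)

section Levels

variable {n d : ℕ} (σ : Equiv.Perm (Fin n × Fin d))
  (s : Fin n → Finset (Fin n) → Finset (Fin n)) (t : Fin n)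

/-- The pair `(WP_i(t), {t} ∪ WP_0(t) ∪ ... ∪ WP_i(t))`. Level `0` consists of the neighbors
of `t` (other than `t` itself, should `t` carry a loop). Level `i + 1` consists of the nodes
selected by the nodes of level `i`, each among its neighbors outside
`{t} ∪ WP_0(t) ∪ ... ∪ WP_i(t)`. -/
def levels : ℕ → Finset (Fin n) × Finset (Fin n)
  | 0 => ((nbrs σ t).erase t, insert t (nbrs σ t))
  | i + 1 =>
    let W := (levels i).1.biUnion fun u => s u (nbrs σ u \ (levels i).2)
    (W, W ∪ (levels i).2)

/-- The waypoint level `WP_i(t)`. -/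
def waypoints (i : ℕ) : Finset (Fin n) := (levels σ s t i).1

/-- The inner ring, when there are `l` waypoint levels above level `0`: the neighbors of
`WP_l(t)` outside `{t} ∪ WP_0(t) ∪ ... ∪ WP_l(t)`. -/
def innerRing (l : ℕ) : Finset (Fin n) :=
  ((waypoints σ s t l).biUnion fun u => nbrs σ u) \ (levels σ s t l).2

/-- The outer ring: all nodes other than `t`, the waypoints and the inner ring. -/
def outerRing (l : ℕ) : Finset (Fin n) :=
  Finset.univ \ ((levels σ s t l).2 ∪ innerRing σ s t l)

end Levels

/-- The number of waypoint levels, `max (1, ⌈log_p (n / (2 d²))⌉)` (the natural-number ceiling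
is `0` at negative arguments, which does not change the maximum). -/
noncomputable def numLevels (n d p : ℕ) : ℕ :=
  max 1 ⌈Real.logb p ((n : ℝ) / (2 * (d : ℝ) ^ 2))⌉₊

/-- `λ = p ^ ℓ d² / n`. -/
noncomputable def lam (n d p : ℕ) : ℝ :=
  (p : ℝ) ^ numLevels n d p * (d : ℝ) ^ 2 / n

open Classical in
/-- The probability of the event `A` under the uniform distribution on the finite set `S`. -/
noncomputable def uniformProb {α : Type*} (S : Finset α) (A : α → Prop) : ℝ :=
  ((S.filter A).card : ℝ) / (S.card : ℝ)

end Spraypoint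

namespace Spraypoint

section Pairing

variable {H : Type*} [Fintype H] [DecidableEq H]

/-- The fixed-point-free involutions of a finite type. -/
def pairingSet (H : Type*) [Fintype H] [DecidableEq H] : Finset (Equiv.Perm H) :=
  Finset.univ.filter fun σ => ∀ x, σ (σ x) = x ∧ σ x ≠ x

/-- The pairings that agree with `σ₀` on `A`. -/
def cylinder (A : Finset H) (σ₀ : Equiv.Perm H) : Finset (Equiv.Perm H) :=
  (pairingSet H).filter fun σ => ∀ x ∈ A, σ x = σ₀ x

lemma mem_pairingSet {σ : Equiv.Perm H} :
    σ ∈ pairingSet H ↔ ∀ x, σ (σ x) = x ∧ σ x ≠ x := by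
  simp [pairingSet]

lemma mem_cylinder {A : Finset H} {σ σ₀ : Equiv.Perm H} :
    σ ∈ cylinder A σ₀ ↔ σ ∈ pairingSet H ∧ ∀ x ∈ A, σ x = σ₀ x := by
  simp [cylinder]

lemma pairingSet_nonempty (h : Even (Fintype.card H)) : (pairingSet H).Nonempty := by
  obtain ⟨m, hm⟩ := h
  have e : H ≃ Fin m × Bool := Fintype.equivOfCardEq (by simp; omega)
  refine ⟨(e.trans (Equiv.prodCongr (Equiv.refl _) Equiv.boolNot)).trans e.symm, ?_⟩
  rw [mem_pairingSet]
  intro x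
  refine ⟨by simp [Equiv.symm_apply_eq, Prod.ext_iff], fun hx => ?_⟩
  have := congrArg e hx
  simp only [Equiv.trans_apply, Equiv.apply_symm_apply] at this
  have h2 := congrArg Prod.snd this
  simp at h2

lemma cylinder_apply_notMem {A : Finset H} {σ σ₀ : Equiv.Perm H} (hA : ∀ x ∈ A, σ₀ x ∈ A)
    (hσ : σ ∈ cylinder A σ₀) {x : H} (hx : x ∉ A) : σ x ∉ A := by
  intro h
  rw [mem_cylinder, mem_pairingSet] at hσ
  have := hσ.2 _ h
  rw [(hσ.1 x).1] at this
  exact hx (this ▸ hA _ h)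

lemma swap_conj_mem_cylinder {A : Finset H} {σ σ₀ : Equiv.Perm H} (hA : ∀ x ∈ A, σ₀ x ∈ A)
    {y y' : H} (hy : y ∉ A) (hy' : y' ∉ A) (hσ : σ ∈ cylinder A σ₀) :
    Equiv.swap y y' * σ * Equiv.swap y y' ∈ cylinder A σ₀ := by
  rw [mem_cylinder, mem_pairingSet] at hσ ⊢
  refine ⟨fun x => ⟨?_, fun h => ?_⟩, fun x hx => ?_⟩
  · simp [Equiv.Perm.mul_apply, (hσ.1 _).1]
  · apply (hσ.1 (Equiv.swap y y' x)).2
    simp only [Equiv.Perm.mul_apply] at h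
    rwa [← Equiv.eq_symm_apply, Equiv.symm_swap] at h
  · have h1 : Equiv.swap y y' x = x :=
      Equiv.swap_apply_of_ne_of_ne (fun h => hy (h ▸ hx)) (fun h => hy' (h ▸ hx))
    have h2 : Equiv.swap y y' (σ₀ x) = σ₀ x :=
      Equiv.swap_apply_of_ne_of_ne (fun h => hy (h ▸ hA x hx)) (fun h => hy' (h ▸ hA x hx))
    simp [Equiv.Perm.mul_apply, h1, hσ.2 x hx, h2]

lemma card_cylinder_filter_le {A : Finset H} {σ₀ : Equiv.Perm H} (hA : ∀ x ∈ A, σ₀ x ∈ A)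
    {x y y' : H} (hy : y ∉ A) (hy' : y' ∉ A) (hxy : x ≠ y) (hxy' : x ≠ y') :
    ((cylinder A σ₀).filter fun σ => σ x = y).card ≤
      ((cylinder A σ₀).filter fun σ => σ x = y').card := by
  refine Finset.card_le_card_of_injOn
    (fun σ => Equiv.swap y y' * σ * Equiv.swap y y') ?_ ?_
  · intro σ hσ
    rw [Finset.mem_coe, Finset.mem_filter] at hσ ⊢
    refine ⟨swap_conj_mem_cylinder hA hy hy' hσ.1, ?_⟩
    simp [Equiv.Perm.mul_apply, Equiv.swap_apply_of_ne_of_ne hxy hxy', hσ.2]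
  · intro σ _ τ _ h
    simpa using h

/-- Within a cylinder, the partner of a free point is uniform among the other free points. -/
lemma card_cylinder_filter_mul {A : Finset H} {σ₀ : Equiv.Perm H} (hA : ∀ x ∈ A, σ₀ x ∈ A)
    {x y : H} (hx : x ∉ A) (hy : y ∉ A) (hxy : y ≠ x) :
    (((cylinder A σ₀).filter fun σ => σ x = y).card : ℝ) * ((Aᶜ.card : ℝ) - 1) =
      (cylinder A σ₀).card := by
  have h1 : (cylinder A σ₀).card = ∑ y' ∈ Aᶜ.erase x,
      ((cylinder A σ₀).filter fun σ => σ x = y').card := by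
    apply Finset.card_eq_sum_card_fiberwise
    intro σ hσ
    have hσ' : σ ∈ cylinder A σ₀ := hσ
    have h2 := (mem_pairingSet.1 (mem_cylinder.1 hσ').1 x).2
    simp [h2, cylinder_apply_notMem hA hσ' hx]
  have h2 : ∀ y' ∈ Aᶜ.erase x, ((cylinder A σ₀).filter fun σ => σ x = y').card =
      ((cylinder A σ₀).filter fun σ => σ x = y).card := by
    intro y' hy'
    simp only [Finset.mem_erase, Finset.mem_compl] at hy'
    exact le_antisymm (card_cylinder_filter_le hA hy'.2 hy hy'.1.symm hxy.symm)
      (card_cylinder_filter_le hA hy hy'.2 hxy.symm hy'.1.symm)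
  rw [h1, Finset.sum_congr rfl h2, Finset.sum_const, smul_eq_mul,
    Finset.card_erase_of_mem (by simpa using hx)]
  have : 1 ≤ Aᶜ.card := Finset.card_pos.2 ⟨x, by simpa using hx⟩
  push_cast [this]
  ring

lemma cylinder_filter_eq {A : Finset H} {σ₀ σ₁ : Equiv.Perm H} {x y : H}
    (h : σ₁ ∈ (cylinder A σ₀).filter fun σ => σ x = y) :
    ((cylinder A σ₀).filter fun σ => σ x = y) = cylinder (insert x (insert y A)) σ₁ := by
  rw [Finset.mem_filter, mem_cylinder] at h
  obtain ⟨⟨h1, h2⟩, h3⟩ := h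
  ext σ
  rw [Finset.mem_filter, mem_cylinder, mem_cylinder]
  constructor
  · rintro ⟨⟨h4, h5⟩, h6⟩
    refine ⟨h4, fun z hz => ?_⟩
    simp only [Finset.mem_insert] at hz
    rcases hz with rfl | rfl | hz
    · rw [h6, h3]
    · rw [← h6, (mem_pairingSet.1 h4 x).1, h6, ← h3, (mem_pairingSet.1 h1 x).1]
    · rw [h5 z hz, h2 z hz]
  · rintro ⟨h4, h5⟩
    refine ⟨⟨h4, fun z hz => ?_⟩, ?_⟩
    · rw [h5 z (by simp [hz]), h2 z hz]
    · rw [h5 x (by simp), h3]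

lemma closed_insert {A : Finset H} {σ₀ σ₁ : Equiv.Perm H} {x y : H} (hA : ∀ x ∈ A, σ₀ x ∈ A)
    (h : σ₁ ∈ (cylinder A σ₀).filter fun σ => σ x = y) :
    ∀ z ∈ insert x (insert y A), σ₁ z ∈ insert x (insert y A) := by
  rw [Finset.mem_filter, mem_cylinder] at h
  obtain ⟨⟨h1, h2⟩, h3⟩ := h
  intro z hz
  simp only [Finset.mem_insert] at hz ⊢
  rcases hz with rfl | rfl | hz
  · right; left; exact h3
  · left; rw [← h3, (mem_pairingSet.1 h1 x).1]
  · right; right; rw [h2 z hz]; exact hA z hz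

lemma card_compl_insert_insert {A : Finset H} {x y : H} (hx : x ∉ A) (hy : y ∉ A) (hxy : y ≠ x) :
    (((insert x (insert y A))ᶜ : Finset H).card : ℝ) = (Aᶜ.card : ℝ) - 2 := by
  have h1 : (insert x (insert y A)).card = A.card + 2 := by
    rw [Finset.card_insert_of_notMem (by simp [hxy.symm, hx]), Finset.card_insert_of_notMem hy]
  have h2 := Finset.card_compl_add_card (insert x (insert y A))
  have h3 := Finset.card_compl_add_card A
  have : (insert x (insert y A))ᶜ.card + 2 = Aᶜ.card := by omega
  rw [← this]; push_cast; ring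

lemma sum_cylinder {A : Finset H} {σ₀ : Equiv.Perm H} (hA : ∀ x ∈ A, σ₀ x ∈ A)
    {x : H} (hx : x ∉ A) (f : Equiv.Perm H → ℝ) :
    ∑ σ ∈ cylinder A σ₀, f σ =
      ∑ y ∈ Aᶜ.erase x, ∑ σ ∈ (cylinder A σ₀).filter (fun σ => σ x = y), f σ := by
  refine (Finset.sum_fiberwise_of_maps_to (fun σ hσ => ?_) f).symm
  have h2 := (mem_pairingSet.1 (mem_cylinder.1 hσ).1 x).2
  simp [h2, cylinder_apply_notMem hA hσ hx]

lemma sum_cylinder_prod_le {g : H → ℝ} {M q : ℝ} (hg0 : ∀ y, 0 ≤ g y) (hgM : ∀ y, g y ≤ M)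
    (hq : 0 < q) (k : ℕ) : ∀ (A : Finset H) (σ₀ : Equiv.Perm H) (_ : ∀ x ∈ A, σ₀ x ∈ A)
    (X : Finset H) (_ : ∀ x ∈ X, x ∉ A) (_ : X.card = k)
    (_ : ∑ y ∈ Aᶜ, g y + k * M ^ 2 / q ≤ q * ((Aᶜ.card : ℝ) - 1 - 2 * k)),
    ∑ σ ∈ cylinder A σ₀, ∏ x ∈ X, g (σ x) ≤ q ^ k * (cylinder A σ₀).card := by
  induction k using Nat.strong_induction_on with
  | _ k ih =>
  intro A σ₀ hA X hXA hXk hcond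
  rcases X.eq_empty_or_nonempty with rfl | ⟨x, hxX⟩
  · simp at hXk; subst hXk; simp
  have hk : 1 ≤ k := hXk ▸ Finset.card_pos.2 ⟨x, hxX⟩
  have hxA := hXA x hxX
  have hM : 0 ≤ M := (hg0 x).trans (hgM x)
  have hM2 : 0 ≤ M ^ 2 / q := by positivity
  rw [sum_cylinder hA hxA]
  have hsum0 : 0 ≤ ∑ y ∈ Aᶜ, g y := Finset.sum_nonneg fun y _ => hg0 y
  have hk' : (1 : ℝ) ≤ k := by exact_mod_cast hk
  have hr : 0 < (Aᶜ.card : ℝ) - 1 := by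
    by_contra hneg
    push Not at hneg
    have : q * ((Aᶜ.card : ℝ) - 1 - 2 * k) < 0 := by
      apply mul_neg_of_pos_of_neg hq; linarith
    have : 0 ≤ k * M ^ 2 / q := by positivity
    linarith
  -- the contribution of each possible partner of `x`
  have key : ∀ y ∈ Aᶜ.erase x,
      ∑ σ ∈ (cylinder A σ₀).filter (fun σ => σ x = y), ∏ x ∈ X, g (σ x) ≤
        ((g y + if y ∈ X then M ^ 2 / q else 0) * q ^ (k - 1)) *
          ((cylinder A σ₀).card / ((Aᶜ.card : ℝ) - 1)) := by
    intro y hy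
    simp only [Finset.mem_erase, Finset.mem_compl] at hy
    have hcard := card_cylinder_filter_mul hA hxA hy.2 hy.1
    have hcard' : (((cylinder A σ₀).filter fun σ => σ x = y).card : ℝ) =
      (cylinder A σ₀).card / ((Aᶜ.card : ℝ) - 1) := by rw [← hcard]; field_simp
    rw [← hcard']
    rcases ((cylinder A σ₀).filter fun σ => σ x = y).eq_empty_or_nonempty with he | ⟨σ₁, hσ₁⟩
    · rw [he]; simp
    have heq := cylinder_filter_eq hσ₁
    have hcl := closed_insert hA hσ₁
    have hcc := card_compl_insert_insert hxA hy.2 hy.1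
    have hsub : ∑ z ∈ (insert x (insert y A))ᶜ, g z ≤ ∑ z ∈ Aᶜ, g z := by
      apply Finset.sum_le_sum_of_subset_of_nonneg
      · intro z; simp only [Finset.mem_compl, Finset.mem_insert]; tauto
      · intro z _ _; exact hg0 z
    by_cases hyX : y ∈ X
    · have hk2 : 2 ≤ k := by
        rw [← hXk]; exact Finset.one_lt_card.2 ⟨x, hxX, y, hyX, hy.1.symm⟩
      have hyX' : y ∈ X.erase x := Finset.mem_erase.2 ⟨hy.1, hyX⟩
      have hc2 : ((X.erase x).erase y).card = k - 2 := by
        rw [Finset.card_erase_of_mem hyX', Finset.card_erase_of_mem hxX, hXk]; omega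
      have hih := ih (k - 2) (by omega) (insert x (insert y A)) σ₁ hcl ((X.erase x).erase y)
        (by
          intro z hz
          simp only [Finset.mem_erase] at hz
          simp [hz.1, hz.2.1, hXA z hz.2.2]) hc2 (by
          rw [hcc]
          push_cast [hk2]
          have : ((k : ℝ) - 2) * M ^ 2 / q ≤ k * M ^ 2 / q := by gcongr; linarith
          nlinarith)
      rw [← heq] at hih
      have hprod : ∀ σ ∈ (cylinder A σ₀).filter (fun σ => σ x = y),
          ∏ x ∈ X, g (σ x) ≤ M ^ 2 * ∏ x ∈ (X.erase x).erase y, g (σ x) := by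
        intro σ _
        rw [← Finset.mul_prod_erase X _ hxX, ← Finset.mul_prod_erase (X.erase x) _ hyX',
          ← mul_assoc]
        apply mul_le_mul_of_nonneg_right _ (Finset.prod_nonneg fun _ _ => hg0 _)
        rw [sq]
        exact mul_le_mul (hgM _) (hgM _) (hg0 _) hM
      calc _ ≤ ∑ σ ∈ (cylinder A σ₀).filter (fun σ => σ x = y),
            M ^ 2 * ∏ x ∈ (X.erase x).erase y, g (σ x) := Finset.sum_le_sum hprod
        _ ≤ M ^ 2 * (q ^ (k - 2) * ((cylinder A σ₀).filter fun σ => σ x = y).card) := by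
            rw [← Finset.mul_sum]; gcongr
        _ = (M ^ 2 / q * q ^ (k - 1)) * ((cylinder A σ₀).filter fun σ => σ x = y).card := by
            have : q ^ (k - 1) = q ^ (k - 2) * q := by rw [← pow_succ]; congr 1; omega
            rw [this]; field_simp
        _ ≤ _ := by
            rw [if_pos hyX]; gcongr; linarith [hg0 y]
    · have hc2 : (X.erase x).card = k - 1 := by rw [Finset.card_erase_of_mem hxX, hXk]
      have hih := ih (k - 1) (by omega) (insert x (insert y A)) σ₁ hcl (X.erase x)
        (by
          intro z hz
          simp only [Finset.mem_erase] at hz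
          have : z ≠ y := fun h => hyX (h ▸ hz.2)
          simp [hz.1, this, hXA z hz.2]) hc2 (by
          rw [hcc]
          push_cast [hk]
          have : ((k : ℝ) - 1) * M ^ 2 / q ≤ k * M ^ 2 / q := by gcongr; linarith
          nlinarith)
      rw [← heq] at hih
      have hprod : ∀ σ ∈ (cylinder A σ₀).filter (fun σ => σ x = y),
          ∏ x ∈ X, g (σ x) = g y * ∏ x ∈ X.erase x, g (σ x) := by
        intro σ hσ
        rw [← Finset.mul_prod_erase X _ hxX, (Finset.mem_filter.1 hσ).2]
      rw [Finset.sum_congr rfl hprod, ← Finset.mul_sum, if_neg hyX, add_zero, mul_assoc]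
      gcongr
      exact hg0 y
  refine (Finset.sum_le_sum key).trans ?_
  rw [← Finset.sum_mul, ← Finset.sum_mul, Finset.sum_add_distrib]
  have h1 : ∑ y ∈ Aᶜ.erase x, g y ≤ ∑ y ∈ Aᶜ, g y :=
    Finset.sum_le_sum_of_subset_of_nonneg (Finset.erase_subset _ _) fun y _ _ => hg0 y
  have h2 : (∑ y ∈ Aᶜ.erase x, if y ∈ X then M ^ 2 / q else 0) ≤ k * M ^ 2 / q := by
    rw [← Finset.sum_filter, Finset.sum_const, nsmul_eq_mul, mul_div_assoc]
    gcongr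
    rw [← hXk]
    exact Finset.card_le_card fun z hz => (Finset.mem_filter.1 hz).2
  have h3 : ∑ y ∈ Aᶜ.erase x, g y + (∑ y ∈ Aᶜ.erase x, if y ∈ X then M ^ 2 / q else 0) ≤
      q * ((Aᶜ.card : ℝ) - 1) := by
    have : q * (2 * k) ≥ 0 := by positivity
    nlinarith
  have h4 : q ^ k = q * q ^ (k - 1) := by rw [← pow_succ']; congr 1; omega
  calc _ ≤ q * ((Aᶜ.card : ℝ) - 1) * q ^ (k - 1) *
        ((cylinder A σ₀).card / ((Aᶜ.card : ℝ) - 1)) := by gcongr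
    _ = _ := by rw [h4]; field_simp

lemma card_cylinder_apply_mem_le {A : Finset H} {σ₀ : Equiv.Perm H} (hA : ∀ x ∈ A, σ₀ x ∈ A)
    {x : H} (hx : x ∉ A) (T : Finset H) (hT : ∀ y ∈ T, y ∉ A) :
    (((cylinder A σ₀).filter fun σ => σ x ∈ T).card : ℝ) * ((Aᶜ.card : ℝ) - 1) ≤
      T.card * (cylinder A σ₀).card := by
  have h1 : ((cylinder A σ₀).filter fun σ => σ x ∈ T).card =
      ∑ y ∈ T, ((cylinder A σ₀).filter fun σ => σ x = y).card := by
    rw [Finset.card_eq_sum_card_fiberwise (f := fun σ => σ x) (t := T)]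
    · refine Finset.sum_congr rfl fun y hy => ?_
      rw [Finset.filter_filter]
      congr 1
      apply Finset.filter_congr
      intro σ _
      constructor
      · exact fun h => h.2
      · rintro rfl; exact ⟨hy, rfl⟩
    · intro σ hσ
      simpa using (Finset.mem_filter.1 hσ).2
  rw [h1]
  push_cast
  rw [Finset.sum_mul, ← nsmul_eq_mul, ← Finset.sum_const]
  refine Finset.sum_le_sum fun y hy => ?_
  by_cases hxy : y = x
  · have : ((cylinder A σ₀).filter fun σ => σ x = y) = ∅ := by
      apply Finset.filter_eq_empty_iff.2
      intro σ hσ h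
      exact (mem_pairingSet.1 (mem_cylinder.1 hσ).1 x).2 (h.trans hxy)
    rw [this]; simp
  · exact (card_cylinder_filter_mul hA hx (hT y hy) hxy).le

/-- Two free points rarely get partners in the same fibre of `f`. -/
lemma card_cylinder_collision_le {V : Type*} [DecidableEq V] {A : Finset H} {σ₀ : Equiv.Perm H}
    (hA : ∀ x ∈ A, σ₀ x ∈ A) {x x' : H} (hx : x ∉ A) (hx' : x' ∉ A) (hxx' : x' ≠ x)
    (f : H → V) (d : ℕ) (hf : ∀ v, (Finset.univ.filter fun y => f y = v).card ≤ d)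
    (hr : 3 < (Aᶜ.card : ℝ)) :
    (((cylinder A σ₀).filter fun σ => σ x ≠ x' ∧ f (σ x) = f (σ x')).card : ℝ) *
      ((Aᶜ.card : ℝ) - 3) ≤ d * (cylinder A σ₀).card := by
  have e1 : (((cylinder A σ₀).filter fun σ => σ x ≠ x' ∧ f (σ x) = f (σ x')).card : ℝ) =
      ∑ σ ∈ cylinder A σ₀, if σ x ≠ x' ∧ f (σ x) = f (σ x') then 1 else 0 := by
    rw [Finset.card_filter]; push_cast; rfl
  have e2 : ((cylinder A σ₀).card : ℝ) = ∑ σ ∈ cylinder A σ₀, 1 := by simp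
  rw [e1, e2, sum_cylinder hA hx, sum_cylinder hA hx, Finset.sum_mul, Finset.mul_sum]
  refine Finset.sum_le_sum fun y hy => ?_
  simp only [Finset.mem_erase, Finset.mem_compl] at hy
  rcases ((cylinder A σ₀).filter fun σ => σ x = y).eq_empty_or_nonempty with he | ⟨σ₁, hσ₁⟩
  · rw [he]; simp
  by_cases hyx' : y = x'
  · have : ∀ σ ∈ (cylinder A σ₀).filter (fun σ => σ x = y),
        (if σ x ≠ x' ∧ f (σ x) = f (σ x') then (1 : ℝ) else 0) = 0 := by
      intro σ hσ
      rw [if_neg]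
      rintro ⟨h, _⟩
      exact h ((Finset.mem_filter.1 hσ).2.trans hyx')
    rw [Finset.sum_congr rfl this]
    simp; positivity
  have heq := cylinder_filter_eq hσ₁
  have hcl := closed_insert hA hσ₁
  have hcc := card_compl_insert_insert hx hy.2 hy.1
  have h1 := card_cylinder_apply_mem_le hcl (x := x')
    (by simp [hxx', hx', Ne.symm hyx'])
    ((insert x (insert y A))ᶜ.filter fun z => f z = f y)
    (fun z hz => Finset.mem_compl.1 (Finset.mem_filter.1 hz).1)
  rw [hcc] at h1
  have h2 : (((insert x (insert y A))ᶜ.filter fun z => f z = f y).card : ℝ) ≤ d := by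
    exact_mod_cast (Finset.card_le_card (Finset.filter_subset_filter _
      (Finset.subset_univ _))).trans (hf (f y))
  rw [heq]
  have h3 : (∑ σ ∈ cylinder (insert x (insert y A)) σ₁,
      if σ x ≠ x' ∧ f (σ x) = f (σ x') then (1 : ℝ) else 0) ≤
      ((cylinder (insert x (insert y A)) σ₁).filter fun σ => σ x' ∈
        ((insert x (insert y A))ᶜ.filter fun z => f z = f y)).card := by
    rw [Finset.card_filter]
    push_cast
    refine Finset.sum_le_sum fun σ hσ => ?_
    have hσx : σ x = y := by
      rw [← heq] at hσ; exact (Finset.mem_filter.1 hσ).2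
    have hσx' : σ x' ∉ insert x (insert y A) :=
      cylinder_apply_notMem hcl hσ (by simp [hxx', hx', Ne.symm hyx'])
    split_ifs with h4 h5
    · exact le_rfl
    · exfalso
      apply h5
      rw [Finset.mem_filter, Finset.mem_compl]
      exact ⟨hσx', by rw [← h4.2, hσx]⟩
    · norm_num
    · exact le_rfl
  rw [show (Aᶜ.card : ℝ) - 2 - 1 = Aᶜ.card - 3 by ring] at h1
  refine (mul_le_mul_of_nonneg_right h3 (by linarith)).trans (h1.trans ?_)
  rw [Finset.sum_const, nsmul_eq_mul, mul_one]
  gcongr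

/-- Averaging over the classes of pairings that agree on a self-determining set of points. -/
lemma sum_pairingSet_le (S : Equiv.Perm H → Finset H)
    (hS : ∀ σ₀ ∈ pairingSet H, ∀ σ ∈ cylinder (S σ₀) σ₀, S σ = S σ₀)
    (f g : Equiv.Perm H → ℝ)
    (h : ∀ σ₀ ∈ pairingSet H, ∑ σ ∈ cylinder (S σ₀) σ₀, f σ ≤ ∑ σ ∈ cylinder (S σ₀) σ₀, g σ) :
    ∑ σ ∈ pairingSet H, f σ ≤ ∑ σ ∈ pairingSet H, g σ := by
  have hcyl : ∀ σ₀ ∈ pairingSet H, ∀ σ ∈ cylinder (S σ₀) σ₀,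
      cylinder (S σ) σ = cylinder (S σ₀) σ₀ := by
    intro σ₀ h₀ σ hσ
    rw [hS σ₀ h₀ σ hσ]
    ext τ
    rw [mem_cylinder] at hσ
    simp only [mem_cylinder]
    refine and_congr_right fun _ => forall₂_congr fun x hx => by rw [hσ.2 x hx]
  have hself : ∀ σ ∈ pairingSet H, σ ∈ cylinder (S σ) σ := fun σ hσ =>
    mem_cylinder.2 ⟨hσ, fun _ _ => rfl⟩
  have key : ∀ F : Equiv.Perm H → ℝ, ∑ σ ∈ pairingSet H, F σ =
      ∑ c ∈ (pairingSet H).image (fun σ => cylinder (S σ) σ), ∑ σ ∈ c, F σ := by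
    intro F
    rw [← Finset.sum_fiberwise_of_maps_to
      (g := fun σ => cylinder (S σ) σ) (fun σ hσ => Finset.mem_image_of_mem _ hσ)]
    refine Finset.sum_congr rfl fun c hc => ?_
    obtain ⟨σ₀, h₀, rfl⟩ := Finset.mem_image.1 hc
    refine Finset.sum_congr ?_ fun _ _ => rfl
    ext σ
    rw [Finset.mem_filter]
    constructor
    · rintro ⟨h1, h2⟩
      rw [← h2]; exact hself σ h1
    · intro hσ
      exact ⟨(mem_cylinder.1 hσ).1, hcyl σ₀ h₀ σ hσ⟩
  rw [key f, key g]
  refine Finset.sum_le_sum fun c hc => ?_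
  obtain ⟨σ₀, h₀, rfl⟩ := Finset.mem_image.1 hc
  exact h σ₀ h₀

end Pairing

section Graph

variable {n d : ℕ}

/-- The half-edges of the nodes in `S`. -/
def halfEdges (d : ℕ) {n : ℕ} (S : Finset (Fin n)) : Finset (Fin n × Fin d) :=
  S ×ˢ Finset.univ

/-- The half-edges of the nodes in `S` and their partners. -/
def revealed (S : Finset (Fin n)) (σ : Equiv.Perm (Fin n × Fin d)) : Finset (Fin n × Fin d) :=
  halfEdges d S ∪ (halfEdges d S).image σ

/-- The nodes whose half-edges determine the level `i`. -/
def explored (σ : Equiv.Perm (Fin n × Fin d)) (s : Fin n → Finset (Fin n) → Finset (Fin n))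
    (t : Fin n) : ℕ → Finset (Fin n)
  | 0 => {t}
  | i + 1 => (levels σ s t i).2

lemma pairings_eq : pairings n d = pairingSet (Fin n × Fin d) := by
  ext σ; simp [pairings, pairingSet]

@[simp] lemma mem_halfEdges {S : Finset (Fin n)} {x : Fin n × Fin d} :
    x ∈ halfEdges d S ↔ x.1 ∈ S := by
  simp [halfEdges]

lemma card_halfEdges (S : Finset (Fin n)) : (halfEdges d S).card = S.card * d := by
  simp [halfEdges]

lemma revealed_mono {S T : Finset (Fin n)} (h : S ⊆ T) (σ : Equiv.Perm (Fin n × Fin d)) :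
    revealed S σ ⊆ revealed T σ := by
  have : halfEdges d S ⊆ halfEdges d T := fun x hx => by
    rw [mem_halfEdges] at hx ⊢; exact h hx
  exact Finset.union_subset_union this (Finset.image_subset_image this)

lemma card_revealed_le (S : Finset (Fin n)) (σ : Equiv.Perm (Fin n × Fin d)) :
    (revealed S σ).card ≤ 2 * (S.card * d) := by
  refine (Finset.card_union_le _ _).trans ?_
  rw [← card_halfEdges S]
  have := Finset.card_image_le (s := halfEdges d S) (f := σ)
  omega

lemma le_card_compl_revealed (S : Finset (Fin n)) (σ : Equiv.Perm (Fin n × Fin d)) :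
    (n : ℝ) * d - 2 * (S.card * d) ≤ ((revealed S σ)ᶜ.card : ℝ) := by
  have h1 := Finset.card_compl_add_card (revealed S σ)
  have h2 := card_revealed_le S σ
  simp only [Fintype.card_prod, Fintype.card_fin] at h1
  have h3 : ((revealed S σ)ᶜ.card : ℝ) + (revealed S σ).card = n * d := by exact_mod_cast h1
  have h4 : ((revealed S σ).card : ℝ) ≤ 2 * (S.card * d) := by exact_mod_cast h2
  linarith

lemma card_compl_revealed_le (S : Finset (Fin n)) (σ : Equiv.Perm (Fin n × Fin d)) :
    ((revealed S σ)ᶜ.card : ℝ) ≤ n * d := by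
  have h1 := Finset.card_le_univ (revealed S σ)ᶜ
  simp only [Fintype.card_prod, Fintype.card_fin] at h1
  exact_mod_cast h1

lemma mem_revealed {σ : Equiv.Perm (Fin n × Fin d)} (hσ : σ ∈ pairingSet (Fin n × Fin d))
    {S : Finset (Fin n)} {x : Fin n × Fin d} :
    x ∈ revealed S σ ↔ x.1 ∈ S ∨ (σ x).1 ∈ S := by
  rw [mem_pairingSet] at hσ
  simp only [revealed, Finset.mem_union, Finset.mem_image, mem_halfEdges]
  refine or_congr_right ⟨?_, fun h => ⟨σ x, h, (hσ x).1⟩⟩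
  rintro ⟨y, hy, rfl⟩
  rwa [(hσ y).1]

lemma revealed_closed {σ : Equiv.Perm (Fin n × Fin d)} (hσ : σ ∈ pairingSet (Fin n × Fin d))
    (S : Finset (Fin n)) : ∀ x ∈ revealed S σ, σ x ∈ revealed S σ := by
  intro x hx
  rw [mem_revealed hσ] at hx ⊢
  rw [(mem_pairingSet.1 hσ x).1]
  exact hx.symm

lemma cylinder_revealed_apply {S : Finset (Fin n)} {σ₀ σ : Equiv.Perm (Fin n × Fin d)}
    (h : σ ∈ cylinder (revealed S σ₀) σ₀) {x : Fin n × Fin d} (hx : x.1 ∈ S) : σ x = σ₀ x :=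
  (mem_cylinder.1 h).2 x (Finset.mem_union_left _ (mem_halfEdges.2 hx))

lemma revealed_congr {S : Finset (Fin n)} {σ₀ σ : Equiv.Perm (Fin n × Fin d)}
    (h : σ ∈ cylinder (revealed S σ₀) σ₀) : revealed S σ = revealed S σ₀ := by
  unfold revealed
  congr 1
  apply Finset.image_congr
  intro x hx
  exact cylinder_revealed_apply h (mem_halfEdges.1 hx)

lemma mem_nbrs {σ : Equiv.Perm (Fin n × Fin d)} {u v : Fin n} :
    v ∈ nbrs σ u ↔ ∃ j, (σ (u, j)).1 = v := by
  simp only [nbrs, Finset.mem_filter, Finset.mem_univ, true_and]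
  constructor
  · rintro ⟨i, j, h⟩; exact ⟨i, by rw [h]⟩
  · rintro ⟨j, rfl⟩; exact ⟨j, (σ (u, j)).2, rfl⟩

lemma mem_nbrs_comm {σ : Equiv.Perm (Fin n × Fin d)} (hσ : σ ∈ pairingSet (Fin n × Fin d))
    {u v : Fin n} : v ∈ nbrs σ u ↔ u ∈ nbrs σ v := by
  have : ∀ u v : Fin n, v ∈ nbrs σ u → u ∈ nbrs σ v := by
    intro u v h
    obtain ⟨j, rfl⟩ := mem_nbrs.1 h
    exact mem_nbrs.2 ⟨(σ (u, j)).2, by rw [Prod.mk.eta, (mem_pairingSet.1 hσ _).1]⟩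
  exact ⟨this u v, this v u⟩

lemma nbrs_congr {σ σ₀ : Equiv.Perm (Fin n × Fin d)} {u : Fin n}
    (h : ∀ j, σ (u, j) = σ₀ (u, j)) : nbrs σ u = nbrs σ₀ u := by
  ext v; simp only [mem_nbrs, h]

lemma nbrs_eq_image (σ : Equiv.Perm (Fin n × Fin d)) (u : Fin n) :
    nbrs σ u = Finset.univ.image fun j => (σ (u, j)).1 := by
  ext v; simp [mem_nbrs]

lemma card_nbrs_le (σ : Equiv.Perm (Fin n × Fin d)) (u : Fin n) : (nbrs σ u).card ≤ d := by
  rw [nbrs_eq_image]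
  exact Finset.card_image_le.trans (by simp)

lemma mem_selections {p : ℕ} {s : Fin n → Finset (Fin n) → Finset (Fin n)} :
    s ∈ selections n p ↔ ∀ u E, s u E ⊆ E ∧ (s u E).card = min p E.card := by
  simp [selections, Fintype.mem_piFinset, Finset.mem_powersetCard]

lemma selections_nonempty (n p : ℕ) : (selections n p).Nonempty := by
  unfold selections
  simp only [Fintype.piFinset_nonempty]
  intro _ E
  exact Finset.powersetCard_nonempty.2 (min_le_right _ _)

section Levels

variable (σ : Equiv.Perm (Fin n × Fin d)) (s : Fin n → Finset (Fin n) → Finset (Fin n))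
  (t : Fin n)

lemma waypoints_succ (i : ℕ) : waypoints σ s t (i + 1) =
    (waypoints σ s t i).biUnion fun u => s u (nbrs σ u \ explored σ s t (i + 1)) := rfl

lemma explored_succ (i : ℕ) :
    explored σ s t (i + 1) = waypoints σ s t i ∪ explored σ s t i := by
  cases i with
  | zero =>
    ext v
    simp only [explored, waypoints, levels, Finset.mem_insert, Finset.mem_union,
      Finset.mem_erase, Finset.mem_singleton]
    tauto
  | succ i => rfl

lemma waypoints_subset_explored (i : ℕ) : waypoints σ s t i ⊆ explored σ s t (i + 1) := by
  rw [explored_succ]; exact Finset.subset_union_left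

lemma explored_subset_succ (i : ℕ) : explored σ s t i ⊆ explored σ s t (i + 1) := by
  rw [explored_succ]; exact Finset.subset_union_right

variable {σ s t}

lemma disjoint_waypoints_explored {p : ℕ} (hs : s ∈ selections n p) (i : ℕ) :
    Disjoint (waypoints σ s t i) (explored σ s t i) := by
  cases i with
  | zero => simp [waypoints, explored, levels]
  | succ i =>
    rw [waypoints_succ, Finset.disjoint_biUnion_left]
    intro u _
    exact Finset.disjoint_of_subset_left (mem_selections.1 hs _ _).1 Finset.sdiff_disjoint

lemma card_waypoints_le {p : ℕ} (hs : s ∈ selections n p) (i : ℕ) :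
    (waypoints σ s t i).card ≤ d * p ^ i := by
  induction i with
  | zero => simpa [waypoints, levels] using (Finset.card_erase_le).trans (card_nbrs_le σ t)
  | succ i ih =>
    rw [waypoints_succ]
    refine Finset.card_biUnion_le.trans ?_
    refine (Finset.sum_le_card_nsmul _ _ p fun u _ => ?_).trans ?_
    · rw [(mem_selections.1 hs _ _).2]; exact min_le_left _ _
    · rw [smul_eq_mul, pow_succ, ← mul_assoc]
      exact Nat.mul_le_mul_right _ ih

lemma card_explored_succ_le {p : ℕ} (hs : s ∈ selections n p) (hp : 2 ≤ p) (hd : 1 ≤ d) (i : ℕ) :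
    (explored σ s t (i + 1)).card ≤ 3 * (d * p ^ i) := by
  induction i with
  | zero =>
    rw [explored_succ]
    refine (Finset.card_union_le _ _).trans ?_
    have := card_waypoints_le (σ := σ) (t := t) hs 0
    simp [explored] at this ⊢
    omega
  | succ i ih =>
    rw [explored_succ]
    refine (Finset.card_union_le _ _).trans ?_
    have := card_waypoints_le (σ := σ) (t := t) hs (i + 1)
    rw [pow_succ] at *
    nlinarith [Nat.zero_le (d * p ^ i)]

lemma levels_congr {σ₀ : Equiv.Perm (Fin n × Fin d)}
    {s₀ : Fin n → Finset (Fin n) → Finset (Fin n)} (i : ℕ)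
    (hσ : ∀ x : Fin n × Fin d, x.1 ∈ explored σ₀ s₀ t i → σ x = σ₀ x)
    (hs : ∀ u ∈ explored σ₀ s₀ t i, s u = s₀ u) :
    levels σ s t i = levels σ₀ s₀ t i := by
  induction i with
  | zero =>
    have : nbrs σ t = nbrs σ₀ t := nbrs_congr fun j => hσ _ (by simp [explored])
    simp [levels, this]
  | succ i ih =>
    have h1 := ih (fun x hx => hσ x (explored_subset_succ _ _ _ _ hx))
      (fun u hu => hs u (explored_subset_succ _ _ _ _ hu))
    have h2 : ((levels σ₀ s₀ t i).1.biUnion fun u => s u (nbrs σ u \ (levels σ₀ s₀ t i).2)) =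
        (levels σ₀ s₀ t i).1.biUnion fun u => s₀ u (nbrs σ₀ u \ (levels σ₀ s₀ t i).2) := by
      apply Finset.biUnion_congr rfl
      intro u hu
      have hu' : u ∈ explored σ₀ s₀ t (i + 1) := waypoints_subset_explored _ _ _ _ hu
      rw [hs u hu', nbrs_congr fun j => hσ (u, j) hu']
    simp only [levels, h1, h2]

lemma explored_congr_of_levels {σ₀ : Equiv.Perm (Fin n × Fin d)}
    {s₀ : Fin n → Finset (Fin n) → Finset (Fin n)} {i : ℕ}
    (hσ : ∀ x : Fin n × Fin d, x.1 ∈ explored σ₀ s₀ t i → σ x = σ₀ x)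
    (hs : ∀ u ∈ explored σ₀ s₀ t i, s u = s₀ u) :
    explored σ s t i = explored σ₀ s₀ t i := by
  cases i with
  | zero => rfl
  | succ i =>
    simp only [explored]
    rw [levels_congr i (fun x hx => hσ x (explored_subset_succ _ _ _ _ hx))
      (fun u hu => hs u (explored_subset_succ _ _ _ _ hu))]

/-- The cylinder of the half-edges revealed by level `i` fixes the waypoints of that level. -/
lemma waypoints_congr_of_mem_cylinder {σ₀ : Equiv.Perm (Fin n × Fin d)} {i : ℕ}
    (h : σ ∈ cylinder (revealed (explored σ₀ s t i) σ₀) σ₀) :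
    waypoints σ s t i = waypoints σ₀ s t i ∧ explored σ s t i = explored σ₀ s t i ∧
      explored σ s t (i + 1) = explored σ₀ s t (i + 1) := by
  have h1 : ∀ x : Fin n × Fin d, x.1 ∈ explored σ₀ s t i → σ x = σ₀ x := fun x hx =>
    cylinder_revealed_apply h hx
  have h2 := levels_congr i h1 (fun u _ => rfl)
  exact ⟨congrArg Prod.fst h2, explored_congr_of_levels h1 (fun u _ => rfl),
    congrArg Prod.snd h2⟩

lemma revealed_explored_congr {σ₀ : Equiv.Perm (Fin n × Fin d)} {i : ℕ}
    (h : σ ∈ cylinder (revealed (explored σ₀ s t i) σ₀) σ₀) :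
    revealed (explored σ s t i) σ = revealed (explored σ₀ s t i) σ₀ := by
  rw [(waypoints_congr_of_mem_cylinder h).2.1]
  exact revealed_congr h

/-- Bounds that hold on each stage-`i` class hold on average. -/
lemma sum_le_of_forall_stage (s : Fin n → Finset (Fin n) → Finset (Fin n)) (t : Fin n) (i : ℕ)
    (f g : Equiv.Perm (Fin n × Fin d) → ℝ)
    (h : ∀ σ₀ ∈ pairingSet (Fin n × Fin d),
      ∑ σ ∈ cylinder (revealed (explored σ₀ s t i) σ₀) σ₀, f σ ≤
        ∑ σ ∈ cylinder (revealed (explored σ₀ s t i) σ₀) σ₀, g σ) :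
    ∑ σ ∈ pairingSet (Fin n × Fin d), f σ ≤ ∑ σ ∈ pairingSet (Fin n × Fin d), g σ :=
  sum_pairingSet_le (fun σ => revealed (explored σ s t i) σ)
    (fun _ _ _ hσ => revealed_explored_congr hσ) f g h

end Levels

section Selection

/-- The selections with the choice of `u` among `E` relabelled by `τ`. -/
def relabel (u : Fin n) (E : Finset (Fin n)) (τ : Equiv.Perm (Fin n))
    (s : Fin n → Finset (Fin n) → Finset (Fin n)) : Fin n → Finset (Fin n) → Finset (Fin n) :=
  fun u' E' => if u' = u ∧ E' = E then (s u E).image τ else s u' E'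

lemma relabel_of_ne {u u' : Fin n} (h : u' ≠ u) (E : Finset (Fin n)) (τ : Equiv.Perm (Fin n))
    (s : Fin n → Finset (Fin n) → Finset (Fin n)) : relabel u E τ s u' = s u' := by
  funext E'; simp [relabel, h]

lemma relabel_mem_selections {p : ℕ} {u : Fin n} {E : Finset (Fin n)} {v v' : Fin n}
    (hv : v ∈ E) (hv' : v' ∈ E) {s : Fin n → Finset (Fin n) → Finset (Fin n)}
    (hs : s ∈ selections n p) : relabel u E (Equiv.swap v v') s ∈ selections n p := by
  rw [mem_selections] at hs ⊢
  intro u' E'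
  unfold relabel
  split_ifs with h
  · rw [h.2]
    refine ⟨fun w hw => ?_, ?_⟩
    · obtain ⟨w', hw', rfl⟩ := Finset.mem_image.1 hw
      have := (hs u E).1 hw'
      rw [Equiv.swap_apply_def]
      split_ifs <;> assumption
    · rw [Finset.card_image_of_injective _ (Equiv.injective _), (hs u E).2]
  · exact hs u' E'

lemma relabel_relabel_swap (u : Fin n) (E : Finset (Fin n)) (v v' : Fin n)
    (s : Fin n → Finset (Fin n) → Finset (Fin n)) :
    relabel u E (Equiv.swap v v') (relabel u E (Equiv.swap v v') s) = s := by
  funext u' E'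
  by_cases h : u' = u ∧ E' = E
  · obtain ⟨rfl, rfl⟩ := h
    simp [relabel, Finset.image_image, Function.comp_def]
  · simp [relabel, h]

/-- A given eligible node is selected by `u` with probability at most `c`. -/
lemma card_selections_filter_le {p : ℕ} (u v : Fin n) {c : ℝ}
    (P : (Fin n → Finset (Fin n) → Finset (Fin n)) → Prop) [DecidablePred P]
    (Ef : (Fin n → Finset (Fin n) → Finset (Fin n)) → Finset (Fin n))
    (hP : ∀ s ∈ selections n p, ∀ s' ∈ selections n p, (∀ u', u' ≠ u → s' u' = s u') →
      P s → P s' ∧ Ef s' = Ef s)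
    (hc : ∀ s, P s → v ∈ Ef s → (min p (Ef s).card : ℕ) ≤ c * (Ef s).card) :
    (((selections n p).filter fun s => P s ∧ v ∈ s u (Ef s)).card : ℝ) ≤
      c * ((selections n p).filter fun s => P s ∧ v ∈ Ef s).card := by
  have h1 : ∀ (Q : (Fin n → Finset (Fin n) → Finset (Fin n)) → Prop) [DecidablePred Q],
      ((selections n p).filter Q).card =
      ∑ E : Finset (Fin n), ((selections n p).filter fun s => Q s ∧ Ef s = E).card := by
    intro Q _
    rw [Finset.card_eq_sum_card_fiberwise (f := Ef) (t := Finset.univ) (by simp)]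
    simp only [Finset.filter_filter]
  rw [h1, h1]
  push_cast
  rw [Finset.mul_sum]
  refine Finset.sum_le_sum fun E _ => ?_
  by_cases hv : v ∈ E
  swap
  · have : (selections n p).filter (fun s => (P s ∧ v ∈ s u (Ef s)) ∧ Ef s = E) = ∅ := by
      apply Finset.filter_eq_empty_iff.2
      rintro s hs ⟨⟨_, h2⟩, rfl⟩
      exact hv ((mem_selections.1 hs _ _).1 h2)
    have h' : (selections n p).filter (fun s => (P s ∧ v ∈ Ef s) ∧ Ef s = E) = ∅ := by
      apply Finset.filter_eq_empty_iff.2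
      rintro s hs ⟨⟨_, h2⟩, rfl⟩
      exact hv h2
    rw [this, h']; simp
  have hB : (selections n p).filter (fun s => (P s ∧ v ∈ Ef s) ∧ Ef s = E) =
      (selections n p).filter (fun s => P s ∧ Ef s = E) := by
    apply Finset.filter_congr
    intro s _
    constructor
    · rintro ⟨⟨h1, h2⟩, h3⟩; exact ⟨h1, h3⟩
    · rintro ⟨h1, h3⟩; exact ⟨⟨h1, h3 ▸ hv⟩, h3⟩
  have hA : ∀ w, (selections n p).filter (fun s => (P s ∧ w ∈ s u (Ef s)) ∧ Ef s = E) =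
      ((selections n p).filter (fun s => P s ∧ Ef s = E)).filter fun s => w ∈ s u E := by
    intro w
    rw [Finset.filter_filter]
    apply Finset.filter_congr
    intro s _
    constructor
    · rintro ⟨⟨h1, h2⟩, h3⟩; exact ⟨⟨h1, h3⟩, h3 ▸ h2⟩
    · rintro ⟨⟨h1, h3⟩, h2⟩; exact ⟨⟨h1, h3.symm ▸ h2⟩, h3⟩
  rw [hB, hA]
  set B := (selections n p).filter (fun s => P s ∧ Ef s = E) with hBdef
  have hle : ∀ w ∈ E, (B.filter fun s => v ∈ s u E).card ≤ (B.filter fun s => w ∈ s u E).card := by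
    intro w hw
    refine Finset.card_le_card_of_injOn (relabel u E (Equiv.swap v w)) ?_ ?_
    · intro s hs
      rw [Finset.mem_coe, Finset.mem_filter, hBdef, Finset.mem_filter] at hs ⊢
      obtain ⟨⟨h2, h3, h4⟩, h5⟩ := hs
      have h6 := hP s h2 (relabel u E (Equiv.swap v w) s) (relabel_mem_selections hv hw h2)
        (fun u' hu' => relabel_of_ne hu' _ _ _) h3
      refine ⟨⟨relabel_mem_selections hv hw h2, h6.1, h6.2.trans h4⟩, ?_⟩
      simp only [relabel, and_self, if_true, Finset.mem_image]
      exact ⟨v, h5, Equiv.swap_apply_left _ _⟩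
    · intro s _ s' _ h
      rw [← relabel_relabel_swap u E v w s, h, relabel_relabel_swap]
  have hsum : ∑ w ∈ E, (B.filter fun s => w ∈ s u E).card = min p E.card * B.card := by
    simp only [Finset.card_filter]
    rw [Finset.sum_comm, ← smul_eq_mul, smul_eq_mul, mul_comm, ← smul_eq_mul, ← Finset.sum_const]
    refine Finset.sum_congr rfl fun s hs => ?_
    have hs' := mem_selections.1 (Finset.mem_filter.1 hs).1 u E
    rw [← hs'.2, ← Finset.card_filter]
    congr 1
    ext w
    rw [Finset.mem_filter]
    exact ⟨fun h => h.2, fun h => ⟨hs'.1 h, h⟩⟩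
  have h2 : E.card * (B.filter fun s => v ∈ s u E).card ≤ min p E.card * B.card := by
    rw [← hsum, ← smul_eq_mul]
    exact Finset.card_nsmul_le_sum _ _ _ hle
  rcases B.eq_empty_or_nonempty with hBe | ⟨s, hs⟩
  · rw [hBe]; simp
  obtain ⟨_, h3, h4⟩ := Finset.mem_filter.1 hs
  have h5 := hc s h3 (h4.symm ▸ hv)
  rw [h4] at h5
  have hE : (0 : ℝ) < E.card := by exact_mod_cast Finset.card_pos.2 ⟨v, hv⟩
  have h6 : (E.card : ℝ) * (B.filter fun s => v ∈ s u E).card ≤ (min p E.card : ℕ) * B.card := by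
    exact_mod_cast h2
  have h7 : (E.card : ℝ) * (B.filter fun s => v ∈ s u E).card ≤ E.card * (c * B.card) :=
    h6.trans (by nlinarith [(Nat.cast_nonneg B.card : (0 : ℝ) ≤ B.card)])
  exact le_of_mul_le_mul_left h7 hE

end Selection

end Graph

section Hits

variable {n d : ℕ}

/-- The number of half-edges of `v` whose partners belong to nodes of `S`. -/
def hits (σ : Equiv.Perm (Fin n × Fin d)) (S : Finset (Fin n)) (v : Fin n) : ℕ :=
  (Finset.univ.filter fun j : Fin d => (σ (v, j)).1 ∈ S).card

/-- The half-edges of `v` that are not matched into `S`, when `v` is outside `S`. -/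
def freeHalfEdges (σ : Equiv.Perm (Fin n × Fin d)) (S : Finset (Fin n)) (v : Fin n) :
    Finset (Fin n × Fin d) :=
  halfEdges d {v} \ revealed S σ

lemma card_freeHalfEdges_le (σ : Equiv.Perm (Fin n × Fin d)) (S : Finset (Fin n)) (v : Fin n) :
    (freeHalfEdges σ S v).card ≤ d := by
  refine (Finset.card_le_card Finset.sdiff_subset).trans ?_
  rw [card_halfEdges]; simp

lemma hits_congr {S : Finset (Fin n)} {σ₀ σ : Equiv.Perm (Fin n × Fin d)}
    (hσ₀ : σ₀ ∈ pairingSet (Fin n × Fin d)) (h : σ ∈ cylinder (revealed S σ₀) σ₀) {v : Fin n}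
    (hv : v ∉ S) : hits σ S v = hits σ₀ S v := by
  have hσ := (mem_cylinder.1 h).1
  have hmem : ∀ j, (σ (v, j)).1 ∈ S ↔ (σ₀ (v, j)).1 ∈ S := by
    intro j
    have h1 := mem_revealed hσ (S := S) (x := (v, j))
    have h2 := mem_revealed hσ₀ (S := S) (x := (v, j))
    rw [revealed_congr h] at h1
    simp only [hv, false_or] at h1 h2
    exact h1.symm.trans h2
  unfold hits
  simp only [hmem]

lemma card_filter_halfEdges (v : Fin n) (Q : Fin n × Fin d → Prop) [DecidablePred Q] :
    ((halfEdges d {v}).filter Q).card = (Finset.univ.filter fun j : Fin d => Q (v, j)).card := by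
  symm
  apply Finset.card_bij (fun j _ => (v, j))
  · intro j hj; simpa using hj
  · intro j _ j' _ h; simpa using h
  · rintro ⟨w, j⟩ hw
    simp only [Finset.mem_filter, mem_halfEdges, Finset.mem_singleton] at hw
    obtain ⟨rfl, hw⟩ := hw
    exact ⟨j, by simpa using hw, rfl⟩

lemma card_freeHalfEdges {S : Finset (Fin n)} {σ : Equiv.Perm (Fin n × Fin d)}
    (hσ : σ ∈ pairingSet (Fin n × Fin d)) {v : Fin n} (hv : v ∉ S) :
    (freeHalfEdges σ S v).card + hits σ S v = d := by
  have h1 : freeHalfEdges σ S v = (halfEdges d {v}).filter fun x => ¬ (σ x).1 ∈ S := by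
    ext x
    simp only [freeHalfEdges, Finset.mem_sdiff, mem_halfEdges, Finset.mem_singleton,
      Finset.mem_filter, mem_revealed hσ]
    constructor
    · rintro ⟨rfl, h⟩; exact ⟨rfl, fun h' => h (Or.inr h')⟩
    · rintro ⟨rfl, h⟩; exact ⟨rfl, fun h' => h'.elim hv h⟩
  rw [h1, card_filter_halfEdges, hits, add_comm, Finset.card_filter_add_card_filter_not]
  simp

lemma hits_le_add {S S' : Finset (Fin n)} {σ₀ σ : Equiv.Perm (Fin n × Fin d)}
    (h : σ ∈ cylinder (revealed S σ₀) σ₀) {v : Fin n} (hv : v ∉ S) :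
    hits σ S' v ≤ hits σ S v + ((freeHalfEdges σ₀ S v).filter fun x => (σ x).1 ∈ S').card := by
  have hσ := (mem_cylinder.1 h).1
  have h1 : hits σ S v = ((halfEdges d {v}).filter fun x => (σ x).1 ∈ S).card := by
    rw [card_filter_halfEdges]; rfl
  have h2 : hits σ S' v = ((halfEdges d {v}).filter fun x => (σ x).1 ∈ S').card := by
    rw [card_filter_halfEdges]; rfl
  rw [h1, h2]
  refine (Finset.card_le_card ?_).trans (Finset.card_union_le _ _)
  intro x hx
  simp only [Finset.mem_filter, mem_halfEdges, Finset.mem_singleton, Finset.mem_union,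
    freeHalfEdges, Finset.mem_sdiff] at hx ⊢
  by_cases hxA : x ∈ revealed S σ₀
  · left
    rw [← revealed_congr h, mem_revealed hσ] at hxA
    exact ⟨hx.1, hxA.resolve_left (by rw [hx.1]; exact hv)⟩
  · exact Or.inr ⟨⟨hx.1, hxA⟩, hx.2⟩

/-- Exponential moments of the number of half-edges matched into a growing set. -/
lemma sum_pow_hits_le {S S' : Finset (Fin n)} {σ₀ : Equiv.Perm (Fin n × Fin d)}
    (hσ₀ : σ₀ ∈ pairingSet (Fin n × Fin d)) {v : Fin n} (hv : v ∉ S) {z c : ℝ} (hz : 1 ≤ z)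
    (hd : 1 ≤ d) (hc1 : 1 ≤ c) (hc : ((S' \ S).card : ℝ) ≤ c) (hS : 8 * (S.card : ℝ) ≤ n)
    (hθ : 16 * z ^ 2 * c ≤ n) :
    ∑ σ ∈ cylinder (revealed S σ₀) σ₀, z ^ hits σ S' v ≤
      Real.exp (d * (16 * z ^ 2 * c / n)) *
        ∑ σ ∈ cylinder (revealed S σ₀) σ₀, z ^ hits σ S v := by
  set A := revealed S σ₀ with hA
  set X := freeHalfEdges σ₀ S v with hX
  set g : Fin n × Fin d → ℝ := fun y => if y.1 ∈ S' then z else 1 with hg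
  set θ : ℝ := 16 * z ^ 2 * c / n with hθdef
  have hn : (0 : ℝ) < n := by nlinarith
  have hθ0 : 0 ≤ θ := by positivity
  have hθ1 : θ ≤ 1 := by rw [hθdef, div_le_one hn]; exact hθ
  have hd' : (1 : ℝ) ≤ d := by exact_mod_cast hd
  have hg1 : ∀ y, 1 ≤ g y := fun y => by simp only [hg]; split_ifs <;> linarith
  have hgz : ∀ y, g y ≤ z := fun y => by simp only [hg]; split_ifs <;> linarith
  have hXd : (X.card : ℝ) ≤ d := by exact_mod_cast card_freeHalfEdges_le σ₀ S v
  have hr := le_card_compl_revealed S σ₀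
  rw [← hA] at hr
  have hr' : 3 / 4 * (n * d : ℝ) ≤ Aᶜ.card := by nlinarith
  -- the total weight of the free half-edges
  have hgsum : ∑ y ∈ Aᶜ, g y ≤ Aᶜ.card + z * (c * d) := by
    have h1 : ∀ y ∈ Aᶜ, g y ≤ 1 + if y ∈ halfEdges d (S' \ S) then z else 0 := by
      intro y hy
      simp only [hg, mem_halfEdges, Finset.mem_sdiff]
      have hyS : y.1 ∉ S := fun h => (Finset.mem_compl.1 hy)
        ((mem_revealed hσ₀).2 (Or.inl h))
      by_cases h : y.1 ∈ S' <;> simp [h, hyS]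
    refine (Finset.sum_le_sum h1).trans ?_
    rw [Finset.sum_add_distrib, Finset.sum_const, nsmul_eq_mul, mul_one, ← Finset.sum_filter,
      Finset.sum_const, nsmul_eq_mul, mul_comm z]
    gcongr
    have h2 : ((Aᶜ.filter fun y => y ∈ halfEdges d (S' \ S)).card : ℝ) ≤
        (halfEdges d (S' \ S)).card := by
      exact_mod_cast Finset.card_le_card fun y hy => (Finset.mem_filter.1 hy).2
    refine h2.trans ?_
    rw [card_halfEdges]; push_cast; gcongr
  have hz2 : z ≤ z ^ 2 := by nlinarith
  have hmain := sum_cylinder_prod_le (g := g) (M := z) (q := 1 + θ)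
    (fun y => by linarith [hg1 y]) hgz (by linarith) X.card A σ₀ (revealed_closed hσ₀ S) X
    (fun x hx => (Finset.mem_sdiff.1 hx).2) rfl (by
      have h1 : (X.card : ℝ) * z ^ 2 / (1 + θ) ≤ d * z ^ 2 := by
        rw [div_le_iff₀ (by linarith)]
        have : (X.card : ℝ) * z ^ 2 ≤ d * z ^ 2 := by gcongr
        nlinarith [show 0 ≤ (d : ℝ) * z ^ 2 by positivity]
      have h2 : 12 * z ^ 2 * c * d ≤ θ * Aᶜ.card := by
        calc 12 * z ^ 2 * c * d = θ * (3 / 4 * (n * d)) := by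
              rw [hθdef]; field_simp; ring
          _ ≤ _ := by gcongr
      have h3 : z * (c * d) ≤ z ^ 2 * c * d := by
        rw [← mul_assoc]; gcongr
      have h4 : (d : ℝ) * z ^ 2 ≤ z ^ 2 * c * d := by
        nlinarith [show 0 ≤ (d : ℝ) * z ^ 2 by positivity]
      have h5 : (d : ℝ) ≤ z ^ 2 * c * d := by nlinarith
      have h6 : (1 + θ) * (1 + 2 * X.card) ≤ 2 * (3 * d) := by
        apply mul_le_mul <;> first | positivity | linarith
      nlinarith)
  have hstep : ∀ σ ∈ cylinder A σ₀, z ^ hits σ S' v ≤ z ^ hits σ₀ S v * ∏ x ∈ X, g (σ x) := by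
    intro σ hσ
    have h1 : ∏ x ∈ X, g (σ x) = z ^ (X.filter fun x => (σ x).1 ∈ S').card := by
      simp only [hg]
      rw [Finset.prod_ite]; simp
    rw [h1, ← pow_add, ← hits_congr hσ₀ hσ hv]
    exact pow_le_pow_right₀ hz (hits_le_add hσ hv)
  have hconst : ∑ σ ∈ cylinder A σ₀, z ^ hits σ S v = z ^ hits σ₀ S v * (cylinder A σ₀).card := by
    rw [Finset.sum_congr rfl fun σ hσ => by rw [hits_congr hσ₀ hσ hv], Finset.sum_const,
      nsmul_eq_mul, mul_comm]
  have hexp : (1 + θ) ^ X.card ≤ Real.exp (d * θ) := by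
    calc (1 + θ) ^ X.card ≤ (1 + θ) ^ d :=
          pow_le_pow_right₀ (by linarith) (card_freeHalfEdges_le σ₀ S v)
      _ ≤ (Real.exp θ) ^ d := by
          gcongr; linarith [Real.add_one_le_exp θ]
      _ = _ := by rw [← Real.exp_nat_mul]
  calc _ ≤ ∑ σ ∈ cylinder A σ₀, z ^ hits σ₀ S v * ∏ x ∈ X, g (σ x) := Finset.sum_le_sum hstep
    _ = z ^ hits σ₀ S v * ∑ σ ∈ cylinder A σ₀, ∏ x ∈ X, g (σ x) := by rw [Finset.mul_sum]
    _ ≤ z ^ hits σ₀ S v * (Real.exp (d * θ) * (cylinder A σ₀).card) := by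
        gcongr
        exact hmain.trans (by gcongr)
    _ = _ := by rw [hconst]; ring

lemma sum_pow_le_three_mul {p : ℕ} (hp : 2 ≤ p) (hd : 1 ≤ d) (i : ℕ) :
    1 + ∑ j ∈ Finset.range (i + 1), (d : ℝ) * p ^ j ≤ 3 * (d * p ^ i) := by
  have hp' : (2 : ℝ) ≤ p := by exact_mod_cast hp
  have hd' : (1 : ℝ) ≤ d := by exact_mod_cast hd
  induction i with
  | zero => simp; linarith
  | succ i ih =>
    rw [Finset.sum_range_succ, ← add_assoc]
    have : 0 ≤ (d : ℝ) * p ^ i := by positivity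
    rw [pow_succ]
    nlinarith

section Tail

variable {s : Fin n → Finset (Fin n) → Finset (Fin n)} {t : Fin n} {p : ℕ}

lemma explored_sdiff_le (hs : s ∈ selections n p) (σ : Equiv.Perm (Fin n × Fin d)) (i : ℕ) :
    ((explored σ s t (i + 1) \ explored σ s t i).card : ℝ) ≤ d * p ^ i := by
  rw [explored_succ, Finset.union_sdiff_right]
  have h1 : (waypoints σ s t i \ explored σ s t i).card ≤ d * p ^ i :=
    (Finset.card_le_card Finset.sdiff_subset).trans (card_waypoints_le hs i)
  exact_mod_cast h1

lemma eight_card_explored_le (hs : s ∈ selections n p) (hp : 2 ≤ p) (hd : 1 ≤ d)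
    (σ : Equiv.Perm (Fin n × Fin d)) {i : ℕ} (h : 24 * ((d : ℝ) * p ^ i) ≤ n) :
    ∀ j ≤ i + 1, 8 * ((explored σ s t j).card : ℝ) ≤ n := by
  have hp' : (1 : ℝ) ≤ p := by exact_mod_cast (by omega : 1 ≤ p)
  have hd' : (1 : ℝ) ≤ d := by exact_mod_cast hd
  intro j hj
  cases j with
  | zero =>
    simp only [explored, Finset.card_singleton, Nat.cast_one, mul_one]
    have : 1 ≤ (d : ℝ) * p ^ i := one_le_mul_of_one_le_of_one_le hd' (one_le_pow₀ hp')
    linarith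
  | succ j =>
    have h1 : ((explored σ s t (j + 1)).card : ℝ) ≤ 3 * (d * p ^ j) := by
      exact_mod_cast card_explored_succ_le hs hp hd j
    have h2 : (d : ℝ) * p ^ j ≤ d * p ^ i := by
      gcongr
      omega
    linarith

lemma sum_pow_hits_explored_le (hs : s ∈ selections n p) (hp : 2 ≤ p) (hd : 1 ≤ d) {z : ℝ}
    (hz : 1 ≤ z) (v : Fin n) (i : ℕ) (h : 48 * z ^ 2 * ((d : ℝ) * p ^ i) ≤ n) :
    ∑ σ ∈ pairingSet (Fin n × Fin d),
        (if v ∉ explored σ s t i then z ^ hits σ (explored σ s t (i + 1)) v else 0) ≤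
      Real.exp (d * (16 * z ^ 2 / n * (1 + ∑ j ∈ Finset.range (i + 1), (d : ℝ) * p ^ j))) *
        (pairingSet (Fin n × Fin d)).card := by
  have hp' : (1 : ℝ) ≤ p := by exact_mod_cast (by omega : 1 ≤ p)
  have hd' : (1 : ℝ) ≤ d := by exact_mod_cast hd
  have hz2 : 1 ≤ z ^ 2 := one_le_pow₀ hz
  have hcap : ∀ j, 1 ≤ (d : ℝ) * p ^ j := fun j =>
    one_le_mul_of_one_le_of_one_le hd' (one_le_pow₀ hp')
  -- one more level
  have hstep : ∀ i : ℕ, 48 * z ^ 2 * ((d : ℝ) * p ^ i) ≤ n →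
      ∑ σ ∈ pairingSet (Fin n × Fin d),
        (if v ∉ explored σ s t i then z ^ hits σ (explored σ s t (i + 1)) v else 0) ≤
      ∑ σ ∈ pairingSet (Fin n × Fin d), Real.exp (d * (16 * z ^ 2 * (d * p ^ i) / n)) *
        (if v ∉ explored σ s t i then z ^ hits σ (explored σ s t i) v else 0) := by
    intro i h
    have h24 : 24 * ((d : ℝ) * p ^ i) ≤ n := by nlinarith [hcap i]
    refine sum_le_of_forall_stage s t i _ _ fun σ₀ hσ₀ => ?_
    have hc : ∀ σ ∈ cylinder (revealed (explored σ₀ s t i) σ₀) σ₀,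
        explored σ s t i = explored σ₀ s t i ∧
          explored σ s t (i + 1) = explored σ₀ s t (i + 1) := fun σ hσ =>
      (waypoints_congr_of_mem_cylinder hσ).2
    rw [← Finset.mul_sum]
    by_cases hv : v ∈ explored σ₀ s t i
    · rw [Finset.sum_eq_zero (fun σ hσ => by rw [(hc σ hσ).1]; simp [hv]),
        Finset.sum_eq_zero (fun σ hσ => by rw [(hc σ hσ).1]; simp [hv])]
      simp
    · have e1 : ∀ σ ∈ cylinder (revealed (explored σ₀ s t i) σ₀) σ₀,
          (if v ∉ explored σ s t i then z ^ hits σ (explored σ s t (i + 1)) v else 0) =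
            z ^ hits σ (explored σ₀ s t (i + 1)) v := fun σ hσ => by
        rw [(hc σ hσ).1, (hc σ hσ).2, if_pos hv]
      have e2 : ∀ σ ∈ cylinder (revealed (explored σ₀ s t i) σ₀) σ₀,
          (if v ∉ explored σ s t i then z ^ hits σ (explored σ s t i) v else 0) =
            z ^ hits σ (explored σ₀ s t i) v := fun σ hσ => by
        rw [(hc σ hσ).1, if_pos hv]
      rw [Finset.sum_congr rfl e1, Finset.sum_congr rfl e2]
      refine sum_pow_hits_le hσ₀ hv hz hd (hcap i) (explored_sdiff_le hs σ₀ i)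
        (eight_card_explored_le hs hp hd σ₀ h24 i (by omega)) (by nlinarith [hcap i])
  induction i with
  | zero =>
    refine (hstep 0 h).trans ?_
    rw [← Finset.mul_sum]
    -- the half-edges of `v` that are matched to `t`
    have h0 : ∑ σ ∈ pairingSet (Fin n × Fin d),
        (if v ∉ explored σ s t 0 then z ^ hits σ (explored σ s t 0) v else 0) ≤
        Real.exp (d * (16 * z ^ 2 * 1 / n)) * (pairingSet (Fin n × Fin d)).card := by
      rcases (pairingSet (Fin n × Fin d)).eq_empty_or_nonempty with he | ⟨σ₀, hσ₀⟩
      · rw [he]; simp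
      have hcyl : cylinder (revealed ∅ σ₀) σ₀ = pairingSet (Fin n × Fin d) := by
        ext σ; simp [mem_cylinder, revealed, halfEdges]
      have h1 := sum_pow_hits_le hσ₀ (v := v) (S := ∅) (S' := {t}) (c := 1) (by simp) hz hd
        le_rfl (by simp) (by simp) (by nlinarith [hcap 0])
      rw [hcyl] at h1
      have h2 : ∑ σ ∈ pairingSet (Fin n × Fin d), z ^ hits σ (∅ : Finset (Fin n)) v =
          (pairingSet (Fin n × Fin d)).card := by simp [hits]
      rw [h2] at h1
      refine le_trans (Finset.sum_le_sum fun σ _ => ?_) h1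
      split_ifs
      · positivity
      · exact le_rfl
    refine (mul_le_mul_of_nonneg_left h0 (Real.exp_pos _).le).trans (le_of_eq ?_)
    rw [← mul_assoc, ← Real.exp_add]
    congr 2
    simp
    ring
  | succ i ih =>
    have hi : 48 * z ^ 2 * ((d : ℝ) * p ^ i) ≤ n := by
      refine le_trans ?_ h
      gcongr
      omega
    refine (hstep (i + 1) h).trans ?_
    rw [← Finset.mul_sum]
    have h1 : ∑ σ ∈ pairingSet (Fin n × Fin d),
        (if v ∉ explored σ s t (i + 1) then z ^ hits σ (explored σ s t (i + 1)) v else 0) ≤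
        ∑ σ ∈ pairingSet (Fin n × Fin d),
        (if v ∉ explored σ s t i then z ^ hits σ (explored σ s t (i + 1)) v else 0) := by
      refine Finset.sum_le_sum fun σ _ => ?_
      have := explored_subset_succ σ s t i
      by_cases h1 : v ∈ explored σ s t (i + 1)
      · rw [if_neg (not_not.2 h1)]
        split_ifs <;> positivity
      · rw [if_pos h1, if_pos fun h2 => h1 (this h2)]
    refine (mul_le_mul_of_nonneg_left (h1.trans (ih hi)) (Real.exp_pos _).le).trans
      (le_of_eq ?_)
    rw [← mul_assoc, ← Real.exp_add]
    congr 2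
    rw [Finset.sum_range_succ _ (i + 1)]
    ring

/-- A node has more than `η d` half-edges into the explored part only with exponentially small
probability. -/
lemma card_filter_hits_le (hs : s ∈ selections n p) (hp : 2 ≤ p) (hd : 1 ≤ d) {η : ℝ}
    (hη : 0 < η) (v : Fin n) (i : ℕ)
    (h : 48 * Real.exp (2 / η) ^ 2 * ((d : ℝ) * p ^ i) ≤ n) :
    (((pairingSet (Fin n × Fin d)).filter fun σ => v ∉ explored σ s t i ∧
        η * d < hits σ (explored σ s t (i + 1)) v).card : ℝ) ≤
      Real.exp (-d) * (pairingSet (Fin n × Fin d)).card := by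
  have hz : 1 ≤ Real.exp (2 / η) := Real.one_le_exp (by positivity)
  have h1 := sum_pow_hits_explored_le (t := t) hs hp hd hz v i h
  have hd' : (1 : ℝ) ≤ d := by exact_mod_cast hd
  have hp' : (1 : ℝ) ≤ p := by exact_mod_cast (by omega : 1 ≤ p)
  have hn : (0 : ℝ) < n := by
    have : 0 < (d : ℝ) * p ^ i := by positivity
    have : 0 < 48 * Real.exp (2 / η) ^ 2 * ((d : ℝ) * p ^ i) := by positivity
    linarith
  have h2 : 16 * Real.exp (2 / η) ^ 2 / n * (1 + ∑ j ∈ Finset.range (i + 1), (d : ℝ) * p ^ j) ≤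
      1 := by
    rw [div_mul_eq_mul_div, div_le_one hn]
    refine le_trans ?_ h
    have := sum_pow_le_three_mul hp hd i
    have h0 : 0 < 16 * Real.exp (2 / η) ^ 2 := by positivity
    nlinarith
  have h3 : Real.exp (2 * d) * (((pairingSet (Fin n × Fin d)).filter fun σ =>
      v ∉ explored σ s t i ∧ η * d < hits σ (explored σ s t (i + 1)) v).card : ℝ) ≤
      Real.exp d * (pairingSet (Fin n × Fin d)).card := by
    rw [mul_comm, ← nsmul_eq_mul, ← Finset.sum_const, Finset.sum_filter]
    refine (Finset.sum_le_sum fun σ _ => ?_).trans (h1.trans ?_)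
    · by_cases h4 : v ∉ explored σ s t i ∧ η * d < hits σ (explored σ s t (i + 1)) v
      · rw [if_pos h4, if_pos h4.1, ← Real.exp_nat_mul]
        apply Real.exp_le_exp.2
        rw [← mul_div_assoc, le_div_iff₀ hη]
        linarith [h4.2]
      · rw [if_neg h4]
        split_ifs <;> positivity
    · gcongr
      nlinarith
  have h4 : Real.exp (2 * d) = Real.exp d * Real.exp d := by rw [← Real.exp_add]; ring_nf
  rw [h4, mul_assoc] at h3
  have h5 := le_of_mul_le_mul_left h3 (Real.exp_pos _)
  rw [Real.exp_neg, inv_mul_eq_div, le_div_iff₀ (Real.exp_pos _)]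
  linarith

end Tail

end Hits

section Counting

variable {α β : Type*} [DecidableEq α] [DecidableEq β]

/-- The number of ordered pairs of distinct elements of `S` with the same image. -/
def numCollisions (S : Finset α) (f : α → β) : ℕ :=
  ((S ×ˢ S).filter fun x => x.1 ≠ x.2 ∧ f x.1 = f x.2).card

lemma sq_card_le_card_image_mul (S : Finset α) (f : α → β) :
    S.card ^ 2 ≤ (S.image f).card * (S.card + numCollisions S f) := by
  have h1 : S.card = ∑ b ∈ S.image f, (S.filter fun a => f a = b).card :=
    Finset.card_eq_sum_card_image f S
  have h2 : S.card + numCollisions S f = ∑ b ∈ S.image f, (S.filter fun a => f a = b).card ^ 2 := by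
    have h3 : S.card = ((S ×ˢ S).filter fun x => x.1 = x.2 ∧ f x.1 = f x.2).card := by
      apply Finset.card_bij (fun a _ => (a, a))
      · intro a ha; simp [ha]
      · intro a _ b _ h; exact congrArg Prod.fst h
      · rintro ⟨a, b⟩ h
        simp only [Finset.mem_filter, Finset.mem_product] at h
        obtain ⟨⟨ha, _⟩, rfl, _⟩ := h
        exact ⟨a, ha, rfl⟩
    have h4 : S.card + numCollisions S f = ((S ×ˢ S).filter fun x => f x.1 = f x.2).card := by
      conv_lhs => rw [h3]
      unfold numCollisions
      rw [← Finset.card_union_of_disjoint]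
      · congr 1
        ext x
        simp only [Finset.mem_union, Finset.mem_filter]
        tauto
      · rw [Finset.disjoint_filter]
        tauto
    rw [h4, Finset.card_eq_sum_card_fiberwise (f := fun x => f x.1) (t := S.image f)]
    · refine Finset.sum_congr rfl fun b _ => ?_
      rw [sq, ← Finset.card_product]
      congr 1
      ext x
      simp only [Finset.mem_filter, Finset.mem_product]
      constructor
      · rintro ⟨⟨⟨ha, hb⟩, h⟩, h'⟩; exact ⟨⟨ha, h'⟩, hb, h ▸ h'⟩
      · rintro ⟨⟨ha, h'⟩, hb, h⟩; exact ⟨⟨⟨ha, hb⟩, h'.trans h.symm⟩, h'⟩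
    · intro x hx
      have := (Finset.mem_filter.1 hx).1
      exact Finset.mem_image_of_mem f (Finset.mem_product.1 this).1
  rw [h2]
  conv_lhs => rw [h1]
  exact sq_sum_le_card_mul_sum_sq

lemma card_le_card_image_add (S : Finset α) (f : α → β) :
    S.card ≤ (S.image f).card + numCollisions S f := by
  have h := sq_card_le_card_image_mul S f
  by_contra! hlt
  nlinarith

end Counting

section Stage

variable {n d : ℕ}

/-- The pairs of distinct half-edges of `u` and `u'` matched to a common node outside `S`. -/
def commonPairs (σ : Equiv.Perm (Fin n × Fin d)) (S : Finset (Fin n)) (u u' : Fin n) :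
    Finset (Fin d × Fin d) :=
  Finset.univ.filter fun j => (u, j.1) ≠ (u', j.2) ∧ (σ (u, j.1)).1 = (σ (u', j.2)).1 ∧
    (σ (u, j.1)).1 ∉ S

lemma degree_le (σ : Equiv.Perm (Fin n × Fin d)) (S : Finset (Fin n)) (u : Fin n) :
    d ≤ (nbrs σ u \ S).card + hits σ S u + (commonPairs σ S u u).card := by
  set J : Finset (Fin d) := Finset.univ.filter fun j => (σ (u, j)).1 ∉ S with hJ
  have h1 : hits σ S u + J.card = d := by
    rw [hits, hJ, Finset.card_filter_add_card_filter_not]; simp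
  have h2 := card_le_card_image_add J fun j => (σ (u, j)).1
  have h3 : (J.image fun j => (σ (u, j)).1) ⊆ nbrs σ u \ S := by
    intro v hv
    obtain ⟨j, hj, rfl⟩ := Finset.mem_image.1 hv
    exact Finset.mem_sdiff.2 ⟨mem_nbrs.2 ⟨j, rfl⟩, (Finset.mem_filter.1 hj).2⟩
  have h4 : numCollisions J (fun j => (σ (u, j)).1) ≤ (commonPairs σ S u u).card := by
    apply Finset.card_le_card
    intro x hx
    simp only [Finset.mem_filter, Finset.mem_product, hJ, Finset.mem_univ, true_and,
      commonPairs] at hx ⊢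
    exact ⟨fun h => hx.2.1 (congrArg Prod.snd h), hx.2.2, hx.1.1⟩
  have h5 := Finset.card_le_card h3
  omega

lemma card_inter_le (σ : Equiv.Perm (Fin n × Fin d)) (S : Finset (Fin n)) {u u' : Fin n}
    (h : u ≠ u') : ((nbrs σ u \ S) ∩ (nbrs σ u' \ S)).card ≤ (commonPairs σ S u u').card := by
  refine (Finset.card_le_card ?_).trans
    (Finset.card_image_le (f := fun j : Fin d × Fin d => (σ (u, j.1)).1))
  intro v hv
  simp only [Finset.mem_inter, Finset.mem_sdiff] at hv
  obtain ⟨j, hj⟩ := mem_nbrs.1 hv.1.1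
  obtain ⟨j', hj'⟩ := mem_nbrs.1 hv.2.1
  refine Finset.mem_image.2 ⟨(j, j'), ?_, hj⟩
  simp only [commonPairs, Finset.mem_filter, Finset.mem_univ, true_and]
  exact ⟨fun h' => h (congrArg Prod.fst h'), hj.trans hj'.symm, hj ▸ hv.1.2⟩

lemma sum_hits_le {σ : Equiv.Perm (Fin n × Fin d)} (W S : Finset (Fin n)) :
    ∑ u ∈ W, hits σ S u ≤ S.card * d := by
  have h1 : ∑ u ∈ W, hits σ S u = (W.sigma fun u =>
      Finset.univ.filter fun j : Fin d => (σ (u, j)).1 ∈ S).card := by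
    rw [Finset.card_sigma]; rfl
  rw [h1, ← card_halfEdges]
  refine Finset.card_le_card_of_injOn (fun x => σ (x.1, x.2)) ?_ ?_
  · intro x hx
    rw [Finset.mem_coe, Finset.mem_sigma, Finset.mem_filter] at hx
    rw [Finset.mem_coe, mem_halfEdges]
    exact hx.2.2
  · rintro ⟨a, b⟩ _ ⟨a', b'⟩ _ h
    have := σ.injective h
    simp only [Prod.mk.injEq] at this
    obtain ⟨rfl, rfl⟩ := this
    rfl

section Cylinder

variable {S S' : Finset (Fin n)} {σ₀ : Equiv.Perm (Fin n × Fin d)}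

lemma half_le_card_compl_sub_three (hn : 12 ≤ n) (hd : 1 ≤ d) (hS : 8 * (S.card : ℝ) ≤ n) :
    (n : ℝ) * d / 2 ≤ ((revealed S σ₀)ᶜ.card : ℝ) - 3 := by
  have h1 := le_card_compl_revealed S σ₀
  have hn' : (12 : ℝ) ≤ n := by exact_mod_cast hn
  have hd' : (1 : ℝ) ≤ d := by exact_mod_cast hd
  nlinarith

lemma sum_cylinder_commonPairs_le (hσ₀ : σ₀ ∈ pairingSet (Fin n × Fin d)) (hn : 12 ≤ n)
    (hd : 1 ≤ d) (hS : 8 * (S.card : ℝ) ≤ n) (hSS' : S ⊆ S') {u u' : Fin n} (hu : u ∈ S' \ S)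
    (hu' : u' ∈ S' \ S) :
    ∑ σ ∈ cylinder (revealed S σ₀) σ₀, ((commonPairs σ S' u u').card : ℝ) ≤
      2 * d ^ 2 / n * (cylinder (revealed S σ₀) σ₀).card := by
  set A := revealed S σ₀ with hA
  have hn' : (12 : ℝ) ≤ n := by exact_mod_cast hn
  have hd' : (1 : ℝ) ≤ d := by exact_mod_cast hd
  have hr := half_le_card_compl_sub_three (S := S) (σ₀ := σ₀) hn hd hS
  rw [← hA] at hr
  rw [Finset.mem_sdiff] at hu hu'
  have key : ∀ j : Fin d × Fin d, (((cylinder A σ₀).filter fun σ =>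
      (u, j.1) ≠ (u', j.2) ∧ (σ (u, j.1)).1 = (σ (u', j.2)).1 ∧ (σ (u, j.1)).1 ∉ S').card : ℝ) ≤
      2 / n * (cylinder A σ₀).card := by
    intro j
    have hfree : ∀ σ ∈ cylinder A σ₀, ∀ w k, w ∉ S → (σ (w, k)).1 ∉ S' → (w, k) ∉ A := by
      intro σ hσ w k hw hk h
      rw [hA, ← revealed_congr hσ, mem_revealed (mem_cylinder.1 hσ).1] at h
      exact h.elim hw fun h => hk (hSS' h)
    rcases ((cylinder A σ₀).filter fun σ =>
      (u, j.1) ≠ (u', j.2) ∧ (σ (u, j.1)).1 = (σ (u', j.2)).1 ∧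
        (σ (u, j.1)).1 ∉ S').eq_empty_or_nonempty with he | ⟨σ₁, hσ₁⟩
    · rw [he]; simp; positivity
    rw [Finset.mem_filter] at hσ₁
    obtain ⟨h1, h2, h3, h4⟩ := hσ₁
    have hx := hfree σ₁ h1 u j.1 hu.2 h4
    have hx' := hfree σ₁ h1 u' j.2 hu'.2 (h3 ▸ h4)
    have h5 := card_cylinder_collision_le (revealed_closed hσ₀ S) hx hx' h2.symm
      (fun y : Fin n × Fin d => y.1) d (by
        intro v
        have : (Finset.univ.filter fun y : Fin n × Fin d => y.1 = v) = halfEdges d {v} := by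
          ext y; simp
        rw [this, card_halfEdges]; simp) (by
          rw [← hA]; nlinarith)
    rw [← hA] at h5
    have h6 : (((cylinder A σ₀).filter fun σ =>
      (u, j.1) ≠ (u', j.2) ∧ (σ (u, j.1)).1 = (σ (u', j.2)).1 ∧ (σ (u, j.1)).1 ∉ S').card : ℝ) ≤
      ((cylinder A σ₀).filter fun σ => σ (u, j.1) ≠ (u', j.2) ∧
        (σ (u, j.1)).1 = (σ (u', j.2)).1).card := by
      refine Nat.cast_le.2 (Finset.card_le_card fun σ hσ => ?_)
      rw [Finset.mem_filter] at hσ ⊢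
      exact ⟨hσ.1, fun h' => hσ.2.2.2 (by rw [h']; exact hu'.1), hσ.2.2.1⟩
    refine h6.trans ?_
    have h7 : (((cylinder A σ₀).filter fun σ => σ (u, j.1) ≠ (u', j.2) ∧
        (σ (u, j.1)).1 = (σ (u', j.2)).1).card : ℝ) * (n * d / 2) ≤
        d * (cylinder A σ₀).card :=
      (mul_le_mul_of_nonneg_left hr (Nat.cast_nonneg _)).trans h5
    rw [div_mul_eq_mul_div, le_div_iff₀ (by linarith)]
    refine le_of_mul_le_mul_right ?_ (by linarith : (0 : ℝ) < d)
    linarith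
  have hcard : ∀ σ : Equiv.Perm (Fin n × Fin d), ((commonPairs σ S' u u').card : ℝ) =
      ∑ j : Fin d × Fin d, if (u, j.1) ≠ (u', j.2) ∧ (σ (u, j.1)).1 = (σ (u', j.2)).1 ∧
        (σ (u, j.1)).1 ∉ S' then 1 else 0 := by
    intro σ
    rw [commonPairs, Finset.card_filter]
    push_cast
    rfl
  rw [Finset.sum_congr rfl fun σ _ => hcard σ, Finset.sum_comm]
  calc _ ≤ ∑ j : Fin d × Fin d, 2 / (n : ℝ) * (cylinder A σ₀).card := by
        refine Finset.sum_le_sum fun j _ => ?_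
        refine le_trans (le_of_eq ?_) (key j)
        rw [Finset.card_filter]; push_cast; rfl
    _ = _ := by
        rw [Finset.sum_const, nsmul_eq_mul, Finset.card_univ, Fintype.card_prod, Fintype.card_fin]
        push_cast; ring

lemma sum_cylinder_hits_le (hσ₀ : σ₀ ∈ pairingSet (Fin n × Fin d)) (hn : 12 ≤ n)
    (hd : 1 ≤ d) (hS : 8 * (S.card : ℝ) ≤ n) {c : ℝ} (hc : ((S' \ S).card : ℝ) ≤ c)
    {u : Fin n} (hu : u ∉ S) :
    ∑ σ ∈ cylinder (revealed S σ₀) σ₀, (hits σ S' u : ℝ) ≤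
      ∑ σ ∈ cylinder (revealed S σ₀) σ₀, ((hits σ S u : ℝ) + 2 * d * c / n) := by
  set A := revealed S σ₀ with hA
  have hn' : (12 : ℝ) ≤ n := by exact_mod_cast hn
  have hd' : (1 : ℝ) ≤ d := by exact_mod_cast hd
  have hr := half_le_card_compl_sub_three (S := S) (σ₀ := σ₀) hn hd hS
  rw [← hA] at hr
  have hc0 : 0 ≤ c := (Nat.cast_nonneg _).trans hc
  have key : ∀ x ∈ freeHalfEdges σ₀ S u,
      (((cylinder A σ₀).filter fun σ => (σ x).1 ∈ S').card : ℝ) ≤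
        2 * c / n * (cylinder A σ₀).card := by
    intro x hx
    have hxA : x ∉ A := (Finset.mem_sdiff.1 hx).2
    have h1 := card_cylinder_apply_mem_le (revealed_closed hσ₀ S) hxA
      (halfEdges d (S' \ S) \ A) (fun y hy => (Finset.mem_sdiff.1 hy).2)
    rw [← hA] at h1
    have h2 : (((cylinder A σ₀).filter fun σ => (σ x).1 ∈ S').card : ℝ) ≤
        ((cylinder A σ₀).filter fun σ => σ x ∈ halfEdges d (S' \ S) \ A).card := by
      refine Nat.cast_le.2 (Finset.card_le_card fun σ hσ => ?_)
      rw [Finset.mem_filter] at hσ ⊢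
      have h3 := cylinder_apply_notMem (revealed_closed hσ₀ S) hσ.1 hxA
      refine ⟨hσ.1, ?_⟩
      rw [Finset.mem_sdiff, mem_halfEdges, Finset.mem_sdiff]
      exact ⟨⟨hσ.2, fun h => h3 ((mem_revealed hσ₀).2 (Or.inl h))⟩, h3⟩
    refine h2.trans ?_
    have h3 : ((halfEdges d (S' \ S) \ A).card : ℝ) ≤ c * d := by
      have : (halfEdges d (S' \ S) \ A).card ≤ (S' \ S).card * d := by
        rw [← card_halfEdges]; exact Finset.card_le_card Finset.sdiff_subset
      calc ((halfEdges d (S' \ S) \ A).card : ℝ) ≤ (S' \ S).card * d := by exact_mod_cast this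
        _ ≤ _ := by gcongr
    have h4 : (((cylinder A σ₀).filter fun σ => σ x ∈ halfEdges d (S' \ S) \ A).card : ℝ) *
        (n * d / 2) ≤ c * d * (cylinder A σ₀).card := by
      refine (mul_le_mul_of_nonneg_left (by linarith : (n : ℝ) * d / 2 ≤ Aᶜ.card - 1)
        (Nat.cast_nonneg _)).trans (h1.trans ?_)
      gcongr
    rw [div_mul_eq_mul_div, le_div_iff₀ (by linarith)]
    refine le_of_mul_le_mul_right ?_ (by linarith : (0 : ℝ) < d)
    linarith
  have h1 : ∀ σ ∈ cylinder A σ₀, (hits σ S' u : ℝ) ≤ hits σ S u +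
      ∑ x ∈ freeHalfEdges σ₀ S u, if (σ x).1 ∈ S' then 1 else 0 := by
    intro σ hσ
    have := hits_le_add (S' := S') hσ hu
    rw [Finset.card_filter] at this
    exact_mod_cast this
  refine (Finset.sum_le_sum h1).trans ?_
  rw [Finset.sum_add_distrib, Finset.sum_add_distrib, Finset.sum_comm]
  gcongr 1
  calc _ ≤ ∑ x ∈ freeHalfEdges σ₀ S u, 2 * c / n * (cylinder A σ₀).card := by
        refine Finset.sum_le_sum fun x hx => ?_
        refine le_trans (le_of_eq ?_) (key x hx)
        rw [Finset.card_filter]; push_cast; rfl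
    _ ≤ d * (2 * c / n * (cylinder A σ₀).card) := by
        rw [Finset.sum_const, nsmul_eq_mul]
        gcongr
        exact card_freeHalfEdges_le σ₀ S u
    _ = _ := by rw [Finset.sum_const, nsmul_eq_mul]; ring

end Cylinder

section Waypoints

variable {s : Fin n → Finset (Fin n) → Finset (Fin n)} {t : Fin n} {p : ℕ}

lemma waypoints_subset_sdiff (hs : s ∈ selections n p) (σ : Equiv.Perm (Fin n × Fin d)) (i : ℕ) :
    waypoints σ s t i ⊆ explored σ s t (i + 1) \ explored σ s t i := fun _ hu =>
  Finset.mem_sdiff.2 ⟨waypoints_subset_explored σ s t i hu,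
    Finset.disjoint_left.1 (disjoint_waypoints_explored hs i) hu⟩

lemma sum_commonPairs_self_le (hs : s ∈ selections n p) (hp : 2 ≤ p) (hd : 1 ≤ d) (hn : 12 ≤ n)
    (i : ℕ) (h : 24 * ((d : ℝ) * p ^ i) ≤ n) :
    ∑ σ ∈ pairingSet (Fin n × Fin d), ∑ u ∈ waypoints σ s t i,
        ((commonPairs σ (explored σ s t (i + 1)) u u).card : ℝ) ≤
      (d * p ^ i) * (2 * d ^ 2 / n) * (pairingSet (Fin n × Fin d)).card := by
  rw [mul_comm, ← nsmul_eq_mul, ← Finset.sum_const]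
  refine sum_le_of_forall_stage s t i _ _ fun σ₀ hσ₀ => ?_
  have h1 : ∀ σ ∈ cylinder (revealed (explored σ₀ s t i) σ₀) σ₀,
      ∑ u ∈ waypoints σ s t i, ((commonPairs σ (explored σ s t (i + 1)) u u).card : ℝ) =
      ∑ u ∈ waypoints σ₀ s t i, ((commonPairs σ (explored σ₀ s t (i + 1)) u u).card : ℝ) := by
    intro σ hσ
    have := waypoints_congr_of_mem_cylinder hσ
    rw [this.1, this.2.2]
  rw [Finset.sum_congr rfl h1, Finset.sum_comm, Finset.sum_const, nsmul_eq_mul]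
  have h2 : ((waypoints σ₀ s t i).card : ℝ) ≤ d * p ^ i := by
    exact_mod_cast card_waypoints_le hs i
  calc _ ≤ ∑ u ∈ waypoints σ₀ s t i,
        2 * d ^ 2 / (n : ℝ) * (cylinder (revealed (explored σ₀ s t i) σ₀) σ₀).card :=
        Finset.sum_le_sum fun u hu => sum_cylinder_commonPairs_le hσ₀ hn hd
          (eight_card_explored_le hs hp hd σ₀ h i (by omega)) (explored_subset_succ _ _ _ _)
          (waypoints_subset_sdiff hs σ₀ i hu) (waypoints_subset_sdiff hs σ₀ i hu)
    _ = ((waypoints σ₀ s t i).card : ℝ) * (2 * d ^ 2 / n) *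
          (cylinder (revealed (explored σ₀ s t i) σ₀) σ₀).card := by
        rw [Finset.sum_const, nsmul_eq_mul, mul_assoc]
    _ ≤ (d * p ^ i) * (2 * d ^ 2 / n) *
          (cylinder (revealed (explored σ₀ s t i) σ₀) σ₀).card := by gcongr
    _ = _ := by ring

lemma sum_commonPairs_le (hs : s ∈ selections n p) (hp : 2 ≤ p) (hd : 1 ≤ d) (hn : 12 ≤ n)
    (i : ℕ) (h : 24 * ((d : ℝ) * p ^ i) ≤ n) :
    ∑ σ ∈ pairingSet (Fin n × Fin d), ∑ u ∈ waypoints σ s t i, ∑ u' ∈ waypoints σ s t i,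
        ((commonPairs σ (explored σ s t (i + 1)) u u').card : ℝ) ≤
      (d * p ^ i) ^ 2 * (2 * d ^ 2 / n) * (pairingSet (Fin n × Fin d)).card := by
  rw [mul_comm, ← nsmul_eq_mul, ← Finset.sum_const]
  refine sum_le_of_forall_stage s t i _ _ fun σ₀ hσ₀ => ?_
  have h1 : ∀ σ ∈ cylinder (revealed (explored σ₀ s t i) σ₀) σ₀,
      ∑ u ∈ waypoints σ s t i, ∑ u' ∈ waypoints σ s t i,
        ((commonPairs σ (explored σ s t (i + 1)) u u').card : ℝ) =
      ∑ x ∈ waypoints σ₀ s t i ×ˢ waypoints σ₀ s t i,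
        ((commonPairs σ (explored σ₀ s t (i + 1)) x.1 x.2).card : ℝ) := by
    intro σ hσ
    have := waypoints_congr_of_mem_cylinder hσ
    rw [this.1, this.2.2, Finset.sum_product]
  rw [Finset.sum_congr rfl h1, Finset.sum_comm, Finset.sum_const, nsmul_eq_mul]
  have h2 : ((waypoints σ₀ s t i).card : ℝ) ≤ d * p ^ i := by
    exact_mod_cast card_waypoints_le hs i
  calc _ ≤ ∑ x ∈ waypoints σ₀ s t i ×ˢ waypoints σ₀ s t i,
        2 * d ^ 2 / (n : ℝ) * (cylinder (revealed (explored σ₀ s t i) σ₀) σ₀).card :=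
        Finset.sum_le_sum fun x hx => sum_cylinder_commonPairs_le hσ₀ hn hd
          (eight_card_explored_le hs hp hd σ₀ h i (by omega)) (explored_subset_succ _ _ _ _)
          (waypoints_subset_sdiff hs σ₀ i (Finset.mem_product.1 hx).1)
          (waypoints_subset_sdiff hs σ₀ i (Finset.mem_product.1 hx).2)
    _ = ((waypoints σ₀ s t i).card : ℝ) ^ 2 * (2 * d ^ 2 / n) *
          (cylinder (revealed (explored σ₀ s t i) σ₀) σ₀).card := by
        rw [Finset.sum_const, nsmul_eq_mul, Finset.card_product]; push_cast; ring
    _ ≤ (d * p ^ i) ^ 2 * (2 * d ^ 2 / n) *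
          (cylinder (revealed (explored σ₀ s t i) σ₀) σ₀).card := by gcongr
    _ = _ := by ring

lemma sum_hits_waypoints_le (hs : s ∈ selections n p) (hp : 2 ≤ p) (hpd : p ≤ d) (hn : 12 ≤ n)
    (i : ℕ) (h : 24 * ((d : ℝ) * p ^ i) ≤ n) :
    ∑ σ ∈ pairingSet (Fin n × Fin d), ∑ u ∈ waypoints σ s t i,
        (hits σ (explored σ s t (i + 1)) u : ℝ) ≤
      (3 * (d * p ^ i) / p * d + (d * p ^ i) * (2 * d * (d * p ^ i) / n)) *
        (pairingSet (Fin n × Fin d)).card := by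
  have hd : 1 ≤ d := by omega
  have hp0 : (0 : ℝ) < p := by exact_mod_cast (by omega : 0 < p)
  rw [mul_comm, ← nsmul_eq_mul, ← Finset.sum_const]
  refine sum_le_of_forall_stage s t i _ _ fun σ₀ hσ₀ => ?_
  set C := cylinder (revealed (explored σ₀ s t i) σ₀) σ₀ with hC
  have h1 : ∀ σ ∈ C,
      ∑ u ∈ waypoints σ s t i, (hits σ (explored σ s t (i + 1)) u : ℝ) =
      ∑ u ∈ waypoints σ₀ s t i, (hits σ (explored σ₀ s t (i + 1)) u : ℝ) := by
    intro σ hσ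
    have := waypoints_congr_of_mem_cylinder hσ
    rw [this.1, this.2.2]
  rw [Finset.sum_congr rfl h1, Finset.sum_comm]
  have h2 : ((waypoints σ₀ s t i).card : ℝ) ≤ d * p ^ i := by
    exact_mod_cast card_waypoints_le hs i
  have h3 : ((explored σ₀ s t i).card : ℝ) ≤ 3 * (d * p ^ i) / p := by
    rw [le_div_iff₀ hp0]
    cases i with
    | zero =>
      have : (p : ℝ) ≤ d := by exact_mod_cast hpd
      simp [explored]; linarith
    | succ i =>
      have : ((explored σ₀ s t (i + 1)).card : ℝ) ≤ 3 * (d * p ^ i) := by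
        exact_mod_cast card_explored_succ_le hs hp hd i
      rw [pow_succ]
      nlinarith
  calc _ ≤ ∑ u ∈ waypoints σ₀ s t i, ∑ σ ∈ C,
        ((hits σ (explored σ₀ s t i) u : ℝ) + 2 * d * (d * p ^ i) / n) :=
        Finset.sum_le_sum fun _ hu => sum_cylinder_hits_le hσ₀ hn hd
          (eight_card_explored_le hs hp hd σ₀ h i (by omega)) (explored_sdiff_le hs σ₀ i)
          (Finset.mem_sdiff.1 (waypoints_subset_sdiff hs σ₀ i hu)).2
    _ = ∑ σ ∈ C, ((∑ u ∈ waypoints σ₀ s t i, hits σ (explored σ₀ s t i) u : ℕ) +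
          ((waypoints σ₀ s t i).card : ℝ) * (2 * d * (d * p ^ i) / n)) := by
        rw [Finset.sum_comm]
        refine Finset.sum_congr rfl fun σ _ => ?_
        rw [Finset.sum_add_distrib, Finset.sum_const, nsmul_eq_mul]; push_cast; rfl
    _ ≤ _ := by
        refine Finset.sum_le_sum fun σ _ => ?_
        have h4 : ((∑ u ∈ waypoints σ₀ s t i, hits σ (explored σ₀ s t i) u : ℕ) : ℝ) ≤
            (explored σ₀ s t i).card * d := by
          exact_mod_cast sum_hits_le (σ := σ) (waypoints σ₀ s t i) (explored σ₀ s t i)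
        gcongr
        exact h4.trans (by gcongr)

end Waypoints

end Stage

section Selected

variable {n d : ℕ}

section Defs

variable (σ : Equiv.Perm (Fin n × Fin d)) (s : Fin n → Finset (Fin n) → Finset (Fin n))
  (t : Fin n) (p i : ℕ)

/-- The neighbors of `u` among which it selects, if `u` is on level `i`. -/
def eligible (u : Fin n) : Finset (Fin n) := nbrs σ u \ explored σ s t (i + 1)

/-- The nodes of level `i` that select each eligible node with probability at most `2 p / d`. -/
def fullWaypoints : Finset (Fin n) :=
  (waypoints σ s t i).filter fun u => d ≤ 2 * (eligible σ s t i u).card ∨ d < 2 * p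

/-- The number of selections, with multiplicity, made by `fullWaypoints`. -/
def numSelected : ℕ :=
  ∑ u ∈ fullWaypoints σ s t p i, (s u (eligible σ s t i u)).card

/-- The number of ordered pairs of coinciding selections made by `fullWaypoints`. -/
def numCoincidences : ℕ :=
  ∑ u ∈ fullWaypoints σ s t p i, ∑ u' ∈ (fullWaypoints σ s t p i).erase u,
    (s u (eligible σ s t i u) ∩ s u' (eligible σ s t i u')).card

end Defs

variable {σ : Equiv.Perm (Fin n × Fin d)} {s : Fin n → Finset (Fin n) → Finset (Fin n)}
  {t : Fin n} {p : ℕ}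

lemma fullWaypoints_subset (i : ℕ) : fullWaypoints σ s t p i ⊆ waypoints σ s t i :=
  Finset.filter_subset _ _

lemma sq_numSelected_le (i : ℕ) : numSelected σ s t p i ^ 2 ≤
    (waypoints σ s t (i + 1)).card * (numSelected σ s t p i + numCoincidences σ s t p i) := by
  set G := fullWaypoints σ s t p i with hG
  set P : Finset (Σ _ : Fin n, Fin n) := G.sigma fun u => s u (eligible σ s t i u) with hP
  have h1 : P.card = numSelected σ s t p i := by rw [hP, Finset.card_sigma]; rfl
  have h2 := sq_card_le_card_image_mul P fun x => x.2
  have h3 : P.image (fun x => x.2) ⊆ waypoints σ s t (i + 1) := by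
    intro v hv
    obtain ⟨⟨u, v⟩, hx, rfl⟩ := Finset.mem_image.1 hv
    rw [hP, Finset.mem_sigma] at hx
    rw [waypoints_succ, Finset.mem_biUnion]
    exact ⟨u, fullWaypoints_subset i hx.1, hx.2⟩
  have h4 : numCollisions P (fun x => x.2) ≤ numCoincidences σ s t p i := by
    have : numCoincidences σ s t p i = (G.sigma fun u => (G.erase u).sigma fun u' =>
        s u (eligible σ s t i u) ∩ s u' (eligible σ s t i u')).card := by
      simp only [Finset.card_sigma]; rfl
    rw [this]
    refine Finset.card_le_card_of_injOn (fun x => ⟨x.1.1, x.2.1, x.1.2⟩) ?_ ?_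
    · rintro ⟨⟨u, v⟩, ⟨u', v'⟩⟩ hx
      simp only [Finset.mem_coe, Finset.mem_filter, Finset.mem_product, hP, Finset.mem_sigma,
        Finset.mem_erase, Finset.mem_inter] at hx ⊢
      obtain ⟨⟨⟨hu, hv⟩, hu', hv'⟩, hne, rfl⟩ := hx
      exact ⟨hu, ⟨fun h => hne (by rw [h]), hu'⟩, hv, hv'⟩
    · rintro ⟨⟨u, v⟩, ⟨u', v'⟩⟩ hx ⟨⟨w, y⟩, ⟨w', y'⟩⟩ hy h
      simp only [Finset.mem_coe, Finset.mem_filter] at hx hy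
      have hv := hx.2.2
      have hv' := hy.2.2
      subst hv hv'
      simp only [Sigma.mk.injEq, heq_eq_eq] at h
      obtain ⟨rfl, rfl, rfl⟩ := h
      rfl
  calc numSelected σ s t p i ^ 2 = P.card ^ 2 := by rw [h1]
    _ ≤ _ := h2
    _ ≤ _ := Nat.mul_le_mul (Finset.card_le_card h3) (by rw [h1]; omega)

lemma numSelected_le (i : ℕ) :
    numSelected σ s t p i ≤ (waypoints σ s t (i + 1)).card + numCoincidences σ s t p i := by
  have h := sq_numSelected_le (σ := σ) (s := s) (t := t) (p := p) i
  by_contra! hlt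
  nlinarith

lemma numSelected_le_mul (hs : s ∈ selections n p) (i : ℕ) :
    numSelected σ s t p i ≤ p * (waypoints σ s t i).card := by
  unfold numSelected
  refine (Finset.sum_le_card_nsmul _ _ p fun u _ => ?_).trans ?_
  · rw [(mem_selections.1 hs _ _).2]; exact min_le_left _ _
  · rw [smul_eq_mul, mul_comm]
    exact Nat.mul_le_mul_left _ (Finset.card_le_card (fullWaypoints_subset i))

lemma eligible_card_le (i : ℕ) (u : Fin n) : (eligible σ s t i u).card ≤ d :=
  (Finset.card_le_card Finset.sdiff_subset).trans (card_nbrs_le σ u)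

/-- The selections lost because nodes of level `i` see too few eligible neighbors. -/
lemma deficit_le (hs : s ∈ selections n p) (hpd : p ≤ d) (i : ℕ) :
    p * (waypoints σ s t i).card ≤ numSelected σ s t p i + ∑ u ∈ waypoints σ s t i,
      if 2 * p ≤ d then (if 2 * (eligible σ s t i u).card < d then p else 0)
      else d - (eligible σ s t i u).card := by
  have h1 : numSelected σ s t p i = ∑ u ∈ waypoints σ s t i,
      if d ≤ 2 * (eligible σ s t i u).card ∨ d < 2 * p then (s u (eligible σ s t i u)).card
      else 0 := by
    rw [numSelected, fullWaypoints, Finset.sum_filter]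
  rw [h1, ← Finset.sum_add_distrib, mul_comm, ← smul_eq_mul, ← Finset.sum_const]
  refine Finset.sum_le_sum fun u _ => ?_
  rw [(mem_selections.1 hs _ _).2]
  have := eligible_card_le (σ := σ) (s := s) (t := t) i u
  split_ifs <;> omega

lemma sum_deficit_le (hs : s ∈ selections n p) (hp : 2 ≤ p) (hpd : p ≤ d) (hn : 12 ≤ n)
    (i : ℕ) (h : 48 * Real.exp 8 ^ 2 * ((d : ℝ) * p ^ i) ≤ n) :
    ∑ σ ∈ pairingSet (Fin n × Fin d),
        ((p : ℝ) * (waypoints σ s t i).card - numSelected σ s t p i) / (d * p ^ (i + 1)) ≤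
      (n * Real.exp (-d) + 12 * (d * p ^ i) / n + if 2 * p ≤ d then (0 : ℝ) else 12 / (d : ℝ)) *
        (pairingSet (Fin n × Fin d)).card := by
  have hd : 1 ≤ d := by omega
  have hd' : (1 : ℝ) ≤ d := by exact_mod_cast hd
  have hp' : (2 : ℝ) ≤ p := by exact_mod_cast hp
  have hn' : (12 : ℝ) ≤ n := by exact_mod_cast hn
  have hpi : (1 : ℝ) ≤ (p : ℝ) ^ i := one_le_pow₀ (by linarith)
  set c : ℝ := d * p ^ i with hc
  have hdc : (d : ℝ) ≤ c := by rw [hc]; nlinarith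
  have hc1 : 1 ≤ c := by linarith
  have hcp : (d : ℝ) * p ^ (i + 1) = p * c := by rw [hc, pow_succ]; ring
  have he8 : (1 : ℝ) ≤ Real.exp 8 ^ 2 := one_le_pow₀ (Real.one_le_exp (by norm_num))
  have h24 : 24 * c ≤ n := by nlinarith
  set Q : ℝ := ((pairingSet (Fin n × Fin d)).card : ℝ) with hQ
  have hQ0 : 0 ≤ Q := Nat.cast_nonneg _
  rw [hcp, ← Finset.sum_div, div_le_iff₀ (by positivity)]
  have hcol := sum_commonPairs_self_le (t := t) hs hp hd hn i h24
  rw [← hc, ← hQ] at hcol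
  have hdef : ∀ σ : Equiv.Perm (Fin n × Fin d),
      (p : ℝ) * (waypoints σ s t i).card - numSelected σ s t p i ≤ ∑ u ∈ waypoints σ s t i,
      ((if 2 * p ≤ d then (if 2 * (eligible σ s t i u).card < d then p else 0)
      else d - (eligible σ s t i u).card : ℕ) : ℝ) := by
    intro σ
    have := deficit_le (σ := σ) (t := t) hs hpd i
    rw [sub_le_iff_le_add', ← Nat.cast_sum]
    exact_mod_cast this
  have hdn : (d : ℝ) / n ≤ c / n := by gcongr
  by_cases h2p : 2 * p ≤ d
  · rw [if_pos h2p, add_zero]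
    have hhits : ∑ σ ∈ pairingSet (Fin n × Fin d), ∑ v : Fin n,
        (if v ∉ explored σ s t i ∧ 1 / 4 * (d : ℝ) < hits σ (explored σ s t (i + 1)) v
          then (1 : ℝ) else 0) ≤ n * Real.exp (-d) * Q := by
      rw [Finset.sum_comm]
      calc _ ≤ ∑ v : Fin n, Real.exp (-d) * Q := by
            refine Finset.sum_le_sum fun v _ => ?_
            have := card_filter_hits_le (t := t) hs hp hd (η := 1 / 4) (by norm_num) v i
              (by norm_num; exact h)
            rw [← hQ] at this
            refine le_trans (le_of_eq ?_) this
            rw [Finset.card_filter]; push_cast; rfl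
        _ = _ := by rw [Finset.sum_const, nsmul_eq_mul]; simp; ring
    have hpt : ∀ σ : Equiv.Perm (Fin n × Fin d),
        (p : ℝ) * (waypoints σ s t i).card - numSelected σ s t p i ≤
        p * ∑ v : Fin n,
        (if v ∉ explored σ s t i ∧ 1 / 4 * (d : ℝ) < hits σ (explored σ s t (i + 1)) v
          then (1 : ℝ) else 0) + p * (4 / d) * ∑ u ∈ waypoints σ s t i,
        ((commonPairs σ (explored σ s t (i + 1)) u u).card : ℝ) := by
      intro σ
      refine (hdef σ).trans ?_
      have h3 : ∑ u ∈ waypoints σ s t i,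
        (if v_mem : u ∉ explored σ s t i ∧ 1 / 4 * (d : ℝ) < hits σ (explored σ s t (i + 1)) u
          then (1 : ℝ) else 0) ≤ ∑ v : Fin n,
        (if v ∉ explored σ s t i ∧ 1 / 4 * (d : ℝ) < hits σ (explored σ s t (i + 1)) v
          then (1 : ℝ) else 0) :=
        Finset.sum_le_sum_of_subset_of_nonneg (Finset.subset_univ _)
          fun u _ _ => by split_ifs <;> norm_num
      refine le_trans ?_ (add_le_add_left (mul_le_mul_of_nonneg_left h3 (by linarith)) _)
      rw [Finset.mul_sum, Finset.mul_sum, ← Finset.sum_add_distrib]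
      refine Finset.sum_le_sum fun u hu => ?_
      rw [if_pos h2p]
      have hdeg := degree_le σ (explored σ s t (i + 1)) u
      have hu' := (Finset.mem_sdiff.1 (waypoints_subset_sdiff hs σ i hu)).2
      have hcol0 : 0 ≤ (p : ℝ) * (4 / d) *
          ((commonPairs σ (explored σ s t (i + 1)) u u).card : ℝ) := by positivity
      by_cases hlt : 2 * (eligible σ s t i u).card < d
      · rw [if_pos hlt]
        by_cases hh : 1 / 4 * (d : ℝ) < hits σ (explored σ s t (i + 1)) u
        · rw [dif_pos ⟨hu', hh⟩]; linarith
        · rw [dif_neg (fun h => hh h.2)]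
          have h5 : (d : ℝ) ≤ (eligible σ s t i u).card + hits σ (explored σ s t (i + 1)) u +
            (commonPairs σ (explored σ s t (i + 1)) u u).card := by exact_mod_cast hdeg
          have h6 : 2 * ((eligible σ s t i u).card : ℝ) < d := by exact_mod_cast hlt
          have h7 : (d : ℝ) / 4 ≤ (commonPairs σ (explored σ s t (i + 1)) u u).card := by
            linarith
          have h8 : (p : ℝ) = p * (4 / d) * (d / 4) := by field_simp
          have h9 : (p : ℝ) * (4 / d) * (d / 4) ≤ p * (4 / d) *
            (commonPairs σ (explored σ s t (i + 1)) u u).card := by gcongr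
          linarith
      · rw [if_neg hlt]
        have : (0 : ℝ) ≤ (p : ℝ) * (if v_mem : u ∉ explored σ s t i ∧
            1 / 4 * (d : ℝ) < hits σ (explored σ s t (i + 1)) u then (1 : ℝ) else 0) := by
          split_ifs <;> simp
        push_cast
        linarith
    calc _ ≤ _ := Finset.sum_le_sum fun σ _ => hpt σ
      _ = _ := by rw [Finset.sum_add_distrib, ← Finset.mul_sum, ← Finset.mul_sum]
      _ ≤ p * (n * Real.exp (-d) * Q) + p * (4 / d) * (c * (2 * d ^ 2 / n) * Q) := by gcongr
      _ = p * Q * (n * Real.exp (-d) + 8 * (d / n) * c) := by field_simp; ring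
      _ ≤ p * Q * (n * Real.exp (-d) * c + 12 * (c / n) * c) := by
          refine mul_le_mul_of_nonneg_left ?_ (by positivity)
          have h1 : n * Real.exp (-(d : ℝ)) ≤ n * Real.exp (-(d : ℝ)) * c :=
            le_mul_of_one_le_right (by positivity) hc1
          have h2 : 8 * ((d : ℝ) / n) * c ≤ 12 * (c / n) * c := by gcongr; norm_num
          linarith
      _ = _ := by ring
  · rw [if_neg h2p]
    have hhits := sum_hits_waypoints_le (t := t) hs hp hpd hn i h24
    rw [← hc, ← hQ] at hhits
    have h2p' : (d : ℝ) ≤ 2 * p := by exact_mod_cast (by omega : d ≤ 2 * p)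
    have hpt : ∀ σ : Equiv.Perm (Fin n × Fin d),
        (p : ℝ) * (waypoints σ s t i).card - numSelected σ s t p i ≤
        ∑ u ∈ waypoints σ s t i, (hits σ (explored σ s t (i + 1)) u : ℝ) +
        ∑ u ∈ waypoints σ s t i, ((commonPairs σ (explored σ s t (i + 1)) u u).card : ℝ) := by
      intro σ
      refine (hdef σ).trans ?_
      rw [← Finset.sum_add_distrib]
      refine Finset.sum_le_sum fun u hu => ?_
      rw [if_neg h2p]
      have hdeg := degree_le σ (explored σ s t (i + 1)) u
      have : d - (eligible σ s t i u).card ≤ hits σ (explored σ s t (i + 1)) u +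
        (commonPairs σ (explored σ s t (i + 1)) u u).card := by
        unfold eligible; omega
      exact_mod_cast this
    calc _ ≤ _ := Finset.sum_le_sum fun σ _ => hpt σ
      _ = _ := by rw [Finset.sum_add_distrib]
      _ ≤ (3 * c / p * d + c * (2 * d * c / n)) * Q + c * (2 * d ^ 2 / n) * Q := by gcongr
      _ = c * Q * (3 * d / p + 2 * d * (c / n) + 2 * d * (d / n)) := by field_simp
      _ ≤ c * Q * (3 * (2 * p) / (d / 2) + 2 * (2 * p) * (c / n) + 2 * (2 * p) * (c / n)) := by
          have h1 : (d : ℝ) / 2 ≤ p := by linarith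
          gcongr
      _ = p * c * Q * (12 / d + 8 * c / n) := by field_simp; ring
      _ ≤ p * c * Q * (n * Real.exp (-d) + 12 * c / n + 12 / d) := by
          refine mul_le_mul_of_nonneg_left ?_ (by positivity)
          have h1 : 0 ≤ n * Real.exp (-(d : ℝ)) := by positivity
          have h2 : 8 * c / n ≤ 12 * c / n := by gcongr; norm_num
          linarith
      _ = _ := by ring

end Selected

section Coincidences

variable {n d : ℕ}

lemma levels_congr_selection {σ : Equiv.Perm (Fin n × Fin d)}
    {s s' : Fin n → Finset (Fin n) → Finset (Fin n)} {t u : Fin n} {i : ℕ}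
    (hu : u ∉ explored σ s t i) (h : ∀ u', u' ≠ u → s' u' = s u') :
    levels σ s' t i = levels σ s t i :=
  levels_congr i (fun _ _ => rfl) fun u' hu' => h u' fun h' => hu (h' ▸ hu')

variable {t : Fin n} {p : ℕ}

lemma min_le_two_mul_div {e : ℕ} (hd : 1 ≤ d) (h : d ≤ 2 * e ∨ d < 2 * p) :
    ((min p e : ℕ) : ℝ) ≤ 2 * p / d * e := by
  have hd' : (1 : ℝ) ≤ d := by exact_mod_cast hd
  rw [div_mul_eq_mul_div, le_div_iff₀ (by linarith)]
  have : min p e * d ≤ 2 * p * e := by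
    rcases h with h | h
    · nlinarith [min_le_left p e]
    · nlinarith [min_le_right p e]
  exact_mod_cast this

lemma sum_numCoincidences_le (σ : Equiv.Perm (Fin n × Fin d)) (hd : 1 ≤ d) (i : ℕ) :
    ∑ s ∈ selections n p, (numCoincidences σ s t p i : ℝ) ≤
      (2 * p / d) ^ 2 * ∑ s ∈ selections n p, ∑ u ∈ waypoints σ s t i, ∑ u' ∈ waypoints σ s t i,
        ((commonPairs σ (explored σ s t (i + 1)) u u').card : ℝ) := by
  have hd' : (1 : ℝ) ≤ d := by exact_mod_cast hd
  have key : ∀ u u' v : Fin n, u' ≠ u →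
      (((selections n p).filter fun s => (u ∈ fullWaypoints σ s t p i ∧
        u' ∈ fullWaypoints σ s t p i) ∧ v ∈ s u (eligible σ s t i u) ∧
          v ∈ s u' (eligible σ s t i u')).card : ℝ) ≤
      (2 * p / d) ^ 2 * ((selections n p).filter fun s => (u ∈ fullWaypoints σ s t p i ∧
        u' ∈ fullWaypoints σ s t p i) ∧ v ∈ eligible σ s t i u ∧
          v ∈ eligible σ s t i u').card := by
    intro u u' v huu'
    -- changing the choice of `w` on level `i` affects neither level `i` nor eligibility
    have hinv : ∀ w ∈ ({u, u'} : Finset (Fin n)), ∀ s ∈ selections n p, ∀ s' ∈ selections n p,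
        (∀ w', w' ≠ w → s' w' = s w') → w ∈ waypoints σ s t i →
        fullWaypoints σ s' t p i = fullWaypoints σ s t p i ∧
          ∀ x, eligible σ s' t i x = eligible σ s t i x := by
      intro w _ s hs s' _ h hw
      have hl := levels_congr_selection
        (Finset.disjoint_left.1 (disjoint_waypoints_explored hs i) hw) h
      have he : ∀ x, eligible σ s' t i x = eligible σ s t i x := fun x => by
        simp only [eligible, explored, hl]
      refine ⟨?_, he⟩
      simp only [fullWaypoints, waypoints, hl, he]
    have hmin : ∀ s w, w ∈ fullWaypoints σ s t p i →
        ((min p (eligible σ s t i w).card : ℕ) : ℝ) ≤ 2 * p / d * (eligible σ s t i w).card :=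
      fun s w hw => min_le_two_mul_div hd (Finset.mem_filter.1 hw).2
    have h1 := card_selections_filter_le (p := p) u v (c := 2 * p / d)
      (fun s => (u ∈ fullWaypoints σ s t p i ∧ u' ∈ fullWaypoints σ s t p i) ∧
        v ∈ s u' (eligible σ s t i u')) (fun s => eligible σ s t i u)
      (by
        rintro s hs s' hs' h ⟨⟨hu, hu'⟩, hv⟩
        obtain ⟨h2, h3⟩ := hinv u (by simp) s hs s' hs' h (fullWaypoints_subset i hu)
        rw [h2, h3, h u' huu', h3]
        exact ⟨⟨⟨hu, hu'⟩, hv⟩, rfl⟩)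
      (fun s hs _ => hmin s u hs.1.1)
    have h2 := card_selections_filter_le (p := p) u' v (c := 2 * p / d)
      (fun s => (u ∈ fullWaypoints σ s t p i ∧ u' ∈ fullWaypoints σ s t p i) ∧
        v ∈ eligible σ s t i u) (fun s => eligible σ s t i u')
      (by
        rintro s hs s' hs' h ⟨⟨hu, hu'⟩, hv⟩
        obtain ⟨h2, h3⟩ := hinv u' (by simp) s hs s' hs' h (fullWaypoints_subset i hu')
        rw [h2, h3, h3]
        exact ⟨⟨⟨hu, hu'⟩, hv⟩, rfl⟩)
      (fun s hs _ => hmin s u' hs.1.2)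
    have e1 : ((selections n p).filter fun s => (u ∈ fullWaypoints σ s t p i ∧
        u' ∈ fullWaypoints σ s t p i) ∧ v ∈ s u (eligible σ s t i u) ∧
          v ∈ s u' (eligible σ s t i u')) = (selections n p).filter fun s =>
        ((u ∈ fullWaypoints σ s t p i ∧ u' ∈ fullWaypoints σ s t p i) ∧
        v ∈ s u' (eligible σ s t i u')) ∧ v ∈ s u (eligible σ s t i u) :=
      Finset.filter_congr fun s _ => by tauto
    have e2 : ((selections n p).filter fun s =>
        ((u ∈ fullWaypoints σ s t p i ∧ u' ∈ fullWaypoints σ s t p i) ∧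
        v ∈ s u' (eligible σ s t i u')) ∧ v ∈ eligible σ s t i u) =
        (selections n p).filter fun s =>
        ((u ∈ fullWaypoints σ s t p i ∧ u' ∈ fullWaypoints σ s t p i) ∧
        v ∈ eligible σ s t i u) ∧ v ∈ s u' (eligible σ s t i u') :=
      Finset.filter_congr fun s _ => by tauto
    have e3 : ((selections n p).filter fun s => (u ∈ fullWaypoints σ s t p i ∧
        u' ∈ fullWaypoints σ s t p i) ∧ v ∈ eligible σ s t i u ∧ v ∈ eligible σ s t i u') =
        (selections n p).filter fun s =>
        ((u ∈ fullWaypoints σ s t p i ∧ u' ∈ fullWaypoints σ s t p i) ∧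
        v ∈ eligible σ s t i u) ∧ v ∈ eligible σ s t i u' :=
      Finset.filter_congr fun s _ => by tauto
    rw [e1, e3, sq, mul_assoc]
    refine h1.trans ?_
    rw [e2]
    gcongr
  have hexp : ∀ s : Fin n → Finset (Fin n) → Finset (Fin n),
      ∀ F : Fin n → Finset (Fin n),
      ((∑ u ∈ fullWaypoints σ s t p i, ∑ u' ∈ (fullWaypoints σ s t p i).erase u,
        (F u ∩ F u').card : ℕ) : ℝ) = ∑ u, ∑ u', ∑ v, if u' ≠ u then
        (if (u ∈ fullWaypoints σ s t p i ∧ u' ∈ fullWaypoints σ s t p i) ∧ v ∈ F u ∧ v ∈ F u'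
          then (1 : ℝ) else 0) else 0 := by
    intro s F
    push_cast
    rw [← Finset.sum_filter_add_sum_filter_not Finset.univ
      (fun u => u ∈ fullWaypoints σ s t p i), Finset.filter_mem_eq_inter, Finset.univ_inter]
    rw [Finset.sum_eq_zero (s := Finset.univ.filter fun u => ¬ u ∈ fullWaypoints σ s t p i)
      (fun u hu => by simp [(Finset.mem_filter.1 hu).2]), add_zero]
    refine Finset.sum_congr rfl fun u hu => ?_
    rw [← Finset.sum_filter_add_sum_filter_not Finset.univ
      (fun u' => u' ∈ (fullWaypoints σ s t p i).erase u), Finset.filter_mem_eq_inter,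
      Finset.univ_inter]
    rw [Finset.sum_eq_zero
      (s := Finset.univ.filter fun u' => ¬ u' ∈ (fullWaypoints σ s t p i).erase u)
      (fun u' hu' => by
        have h1 := (Finset.mem_filter.1 hu').2
        rw [Finset.mem_erase] at h1
        refine Finset.sum_eq_zero fun v _ => ?_
        split_ifs with h2 h3
        · exact absurd ⟨h2, h3.1.2⟩ h1
        · rfl
        · rfl), add_zero]
    refine Finset.sum_congr rfl fun u' hu' => ?_
    rw [Finset.mem_erase] at hu'
    rw [Finset.card_eq_sum_ones, ← Finset.univ_inter (F u ∩ F u'), ← Finset.filter_mem_eq_inter,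
      Finset.sum_filter]
    push_cast
    refine Finset.sum_congr rfl fun v _ => ?_
    simp [hu, hu'.1, hu'.2]
  have hswap : ∀ F : (Fin n → Finset (Fin n) → Finset (Fin n)) → Fin n → Finset (Fin n),
      ∑ s ∈ selections n p, ((∑ u ∈ fullWaypoints σ s t p i,
        ∑ u' ∈ (fullWaypoints σ s t p i).erase u, (F s u ∩ F s u').card : ℕ) : ℝ) =
      ∑ u, ∑ u', ∑ v, if u' ≠ u then
        (((selections n p).filter fun s => (u ∈ fullWaypoints σ s t p i ∧
        u' ∈ fullWaypoints σ s t p i) ∧ v ∈ F s u ∧ v ∈ F s u').card : ℝ) else 0 := by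
    intro F
    rw [Finset.sum_congr rfl fun s _ => hexp s (F s), Finset.sum_comm]
    refine Finset.sum_congr rfl fun u _ => ?_
    rw [Finset.sum_comm]
    refine Finset.sum_congr rfl fun u' _ => ?_
    rw [Finset.sum_comm]
    refine Finset.sum_congr rfl fun v _ => ?_
    split_ifs
    · rw [Finset.card_filter]; push_cast; rfl
    · simp
  calc ∑ s ∈ selections n p, (numCoincidences σ s t p i : ℝ)
      = _ := hswap fun s u => s u (eligible σ s t i u)
    _ ≤ ∑ u, ∑ u', ∑ v, (2 * p / d : ℝ) ^ 2 * if u' ≠ u then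
        (((selections n p).filter fun s => (u ∈ fullWaypoints σ s t p i ∧
        u' ∈ fullWaypoints σ s t p i) ∧ v ∈ eligible σ s t i u ∧
          v ∈ eligible σ s t i u').card : ℝ) else 0 := by
        refine Finset.sum_le_sum fun u _ => Finset.sum_le_sum fun u' _ =>
          Finset.sum_le_sum fun v _ => ?_
        split_ifs with h
        · exact key u u' v h
        · simp
    _ = (2 * p / d) ^ 2 * ∑ s ∈ selections n p, ((∑ u ∈ fullWaypoints σ s t p i,
        ∑ u' ∈ (fullWaypoints σ s t p i).erase u,
          (eligible σ s t i u ∩ eligible σ s t i u').card : ℕ) : ℝ) := by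
        rw [hswap fun s u => eligible σ s t i u]
        simp only [Finset.mul_sum]
    _ ≤ _ := by
        gcongr with s _
        push_cast
        refine (Finset.sum_le_sum fun u _ => ?_).trans (Finset.sum_le_sum_of_subset_of_nonneg
          (fullWaypoints_subset i) fun u _ _ => Finset.sum_nonneg fun _ _ => Nat.cast_nonneg _)
        refine (Finset.sum_le_sum fun u' hu' => ?_).trans
          (Finset.sum_le_sum_of_subset_of_nonneg
          ((Finset.erase_subset _ _).trans (fullWaypoints_subset i))
            fun u' _ _ => Nat.cast_nonneg _)
        exact Nat.cast_le.2 (card_inter_le σ _ (Finset.mem_erase.1 hu').1.symm)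

/-- The expected number of coinciding selections. -/
lemma sum_sum_numCoincidences_le (hp : 2 ≤ p) (hd : 1 ≤ d) (hn : 12 ≤ n) (i : ℕ)
    (h : 24 * ((d : ℝ) * p ^ i) ≤ n) :
    ∑ σ ∈ pairingSet (Fin n × Fin d), ∑ s ∈ selections n p,
        (numCoincidences σ s t p i : ℝ) ≤
      8 * (d * p ^ (i + 1)) ^ 2 / n *
        ((pairingSet (Fin n × Fin d)).card * (selections n p).card) := by
  have hd' : (1 : ℝ) ≤ d := by exact_mod_cast hd
  refine (Finset.sum_le_sum fun σ _ => sum_numCoincidences_le σ hd i).trans ?_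
  rw [← Finset.mul_sum, Finset.sum_comm]
  calc _ ≤ (2 * p / d : ℝ) ^ 2 * ∑ s ∈ selections n p,
        (((d : ℝ) * p ^ i) ^ 2 * (2 * d ^ 2 / n) * (pairingSet (Fin n × Fin d)).card) := by
        gcongr with s hs
        exact sum_commonPairs_le hs hp hd hn i h
    _ = _ := by
        rw [Finset.sum_const, nsmul_eq_mul]
        field_simp
        ring

end Coincidences

section Deficit

variable {n d : ℕ}

/-- The relative number of waypoints missing because of loops, multiple edges and edges back into
the explored part, accumulated over the first `m` selection steps. -/
noncomputable def relDeficit (σ : Equiv.Perm (Fin n × Fin d))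
    (s : Fin n → Finset (Fin n) → Finset (Fin n)) (t : Fin n) (p m : ℕ) : ℝ :=
  ((d : ℝ) - (waypoints σ s t 0).card) / d + ∑ i ∈ Finset.range m,
    ((p : ℝ) * (waypoints σ s t i).card - numSelected σ s t p i) / (d * p ^ (i + 1))

/-- The relative number of waypoints missing because of coinciding selections, accumulated over
those of the first `m` selection steps whose target size is at most `B`. -/
noncomputable def relCoincidences (σ : Equiv.Perm (Fin n × Fin d))
    (s : Fin n → Finset (Fin n) → Finset (Fin n)) (t : Fin n) (p : ℕ) (B : ℝ) (m : ℕ) : ℝ :=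
  ∑ i ∈ Finset.range m, if (d : ℝ) * p ^ (i + 1) ≤ B then
    (numCoincidences σ s t p i : ℝ) / (d * p ^ (i + 1)) else 0

variable {σ : Equiv.Perm (Fin n × Fin d)} {s : Fin n → Finset (Fin n) → Finset (Fin n)}
  {t : Fin n} {p : ℕ}

lemma relDeficit_term_nonneg (hs : s ∈ selections n p) (i : ℕ) :
    0 ≤ ((p : ℝ) * (waypoints σ s t i).card - numSelected σ s t p i) / (d * p ^ (i + 1)) := by
  apply div_nonneg _ (by positivity)
  have : (numSelected σ s t p i : ℝ) ≤ p * (waypoints σ s t i).card := by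
    exact_mod_cast numSelected_le_mul hs i
  linarith

lemma relDeficit_nonneg (hs : s ∈ selections n p) (m : ℕ) : 0 ≤ relDeficit σ s t p m := by
  refine add_nonneg (div_nonneg ?_ (Nat.cast_nonneg _))
    (Finset.sum_nonneg fun i _ => relDeficit_term_nonneg hs i)
  have h1 : ((waypoints σ s t 0).card : ℝ) ≤ d := by
    have := card_waypoints_le (σ := σ) (t := t) hs 0
    rw [pow_zero, mul_one] at this
    exact_mod_cast this
  linarith

lemma relDeficit_mono (hs : s ∈ selections n p) {m m' : ℕ} (h : m ≤ m') :
    relDeficit σ s t p m ≤ relDeficit σ s t p m' := by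
  unfold relDeficit
  gcongr 1
  exact Finset.sum_le_sum_of_subset_of_nonneg (Finset.range_mono h)
    fun i _ _ => relDeficit_term_nonneg hs i

lemma relCoincidences_term_nonneg (B : ℝ) (i : ℕ) : 0 ≤ if (d : ℝ) * p ^ (i + 1) ≤ B then
    (numCoincidences σ s t p i : ℝ) / (d * p ^ (i + 1)) else 0 := by
  split_ifs <;> positivity

lemma relCoincidences_nonneg (B : ℝ) (m : ℕ) : 0 ≤ relCoincidences σ s t p B m :=
  Finset.sum_nonneg fun i _ => relCoincidences_term_nonneg B i

lemma relCoincidences_mono (B : ℝ) {m m' : ℕ} (h : m ≤ m') :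
    relCoincidences σ s t p B m ≤ relCoincidences σ s t p B m' :=
  Finset.sum_le_sum_of_subset_of_nonneg (Finset.range_mono h)
    fun i _ _ => relCoincidences_term_nonneg B i

lemma le_card_waypoints (hp : 2 ≤ p) (hd : 1 ≤ d) {B : ℝ} (m : ℕ)
    (hB : (d : ℝ) * p ^ m ≤ B) :
    (d : ℝ) * p ^ m * (1 - relDeficit σ s t p m - relCoincidences σ s t p B m) ≤
      (waypoints σ s t m).card := by
  have hd' : (1 : ℝ) ≤ d := by exact_mod_cast hd
  have hp' : (2 : ℝ) ≤ p := by exact_mod_cast hp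
  induction m with
  | zero =>
    simp only [relDeficit, relCoincidences, Finset.range_zero, Finset.sum_empty]
    have : (d : ℝ) ≠ 0 := by positivity
    field_simp
    linarith
  | succ m ih =>
    have hpm : 0 < (p : ℝ) ^ m := by positivity
    have h1 := ih (le_trans (by rw [pow_succ]; gcongr; nlinarith) hB)
    have h2 : relDeficit σ s t p (m + 1) = relDeficit σ s t p m +
        ((p : ℝ) * (waypoints σ s t m).card - numSelected σ s t p m) / (d * p ^ (m + 1)) := by
      simp only [relDeficit, Finset.sum_range_succ]; ring
    have h3 : relCoincidences σ s t p B (m + 1) = relCoincidences σ s t p B m +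
        (numCoincidences σ s t p m : ℝ) / (d * p ^ (m + 1)) := by
      simp only [relCoincidences, Finset.sum_range_succ]; rw [if_pos hB]
    have h4 : (numSelected σ s t p m : ℝ) ≤
        (waypoints σ s t (m + 1)).card + numCoincidences σ s t p m := by
      exact_mod_cast numSelected_le m
    have h5 : (d : ℝ) * p ^ (m + 1) * (1 - relDeficit σ s t p (m + 1) -
        relCoincidences σ s t p B (m + 1)) =
        p * ((d : ℝ) * p ^ m * (1 - relDeficit σ s t p m - relCoincidences σ s t p B m)) -
        ((p : ℝ) * (waypoints σ s t m).card - numSelected σ s t p m) -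
        numCoincidences σ s t p m := by
      rw [h2, h3]
      field_simp
      ring
    rw [h5]
    have h6 := mul_le_mul_of_nonneg_left h1 (by linarith : (0 : ℝ) ≤ p)
    linarith

lemma le_numSelected (hp : 2 ≤ p) (hd : 1 ≤ d) {B : ℝ} (m : ℕ)
    (hB : (d : ℝ) * p ^ m ≤ B) :
    (d : ℝ) * p ^ (m + 1) * (1 - relDeficit σ s t p (m + 1) - relCoincidences σ s t p B (m + 1)) ≤
      numSelected σ s t p m := by
  have hd' : (1 : ℝ) ≤ d := by exact_mod_cast hd
  have hp' : (2 : ℝ) ≤ p := by exact_mod_cast hp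
  have h1 := le_card_waypoints (σ := σ) (s := s) (t := t) hp hd m hB
  have h2 : relDeficit σ s t p (m + 1) = relDeficit σ s t p m +
      ((p : ℝ) * (waypoints σ s t m).card - numSelected σ s t p m) / (d * p ^ (m + 1)) := by
    simp only [relDeficit, Finset.sum_range_succ]; ring
  have h3 := relCoincidences_mono (σ := σ) (s := s) (t := t) (p := p) B (Nat.le_succ m)
  calc _ ≤ (d : ℝ) * p ^ (m + 1) * (1 - relDeficit σ s t p (m + 1) -
        relCoincidences σ s t p B m) := by gcongr
    _ = p * ((d : ℝ) * p ^ m * (1 - relDeficit σ s t p m - relCoincidences σ s t p B m)) -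
        ((p : ℝ) * (waypoints σ s t m).card - numSelected σ s t p m) := by
      rw [h2]
      field_simp
      ring
    _ ≤ _ := by
      have h6 := mul_le_mul_of_nonneg_left h1 (by linarith : (0 : ℝ) ≤ p)
      linarith

lemma sum_degree_sub_card_waypoints_zero_le (s : Fin n → Finset (Fin n) → Finset (Fin n))
    (t : Fin n) (hd : 1 ≤ d) (hn : 12 ≤ n) :
    ∑ σ ∈ pairingSet (Fin n × Fin d), ((d : ℝ) - (waypoints σ s t 0).card) / d ≤
      4 * d / n * (pairingSet (Fin n × Fin d)).card := by
  have hd' : (1 : ℝ) ≤ d := by exact_mod_cast hd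
  have hn' : (12 : ℝ) ≤ n := by exact_mod_cast hn
  rcases (pairingSet (Fin n × Fin d)).eq_empty_or_nonempty with he | ⟨σ₀, hσ₀⟩
  · rw [he]; simp
  have hcyl : cylinder (revealed ∅ σ₀) σ₀ = pairingSet (Fin n × Fin d) := by
    ext σ; simp [mem_cylinder, revealed, halfEdges]
  have h1 := sum_cylinder_commonPairs_le (S := ∅) (S' := {t}) hσ₀ hn hd (by simp) (by simp)
    (u := t) (u' := t) (by simp) (by simp)
  have h2 := sum_cylinder_hits_le (S := ∅) (S' := {t}) (c := 1) hσ₀ hn hd (by simp) (by simp)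
    (u := t) (by simp)
  rw [hcyl] at h1 h2
  have h3 : ∑ σ ∈ pairingSet (Fin n × Fin d),
      ((hits σ ∅ t : ℝ) + 2 * d * 1 / n) = 2 * d / n * (pairingSet (Fin n × Fin d)).card := by
    simp [hits]; ring
  rw [h3] at h2
  have h4 : ∀ σ : Equiv.Perm (Fin n × Fin d), (d : ℝ) - (waypoints σ s t 0).card ≤
      hits σ {t} t + (commonPairs σ {t} t t).card := by
    intro σ
    have h5 : waypoints σ s t 0 = nbrs σ t \ {t} := by
      simp [waypoints, levels, Finset.erase_eq]
    have h6 : (d : ℝ) ≤ (nbrs σ t \ {t}).card + hits σ {t} t + (commonPairs σ {t} t t).card := by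
      exact_mod_cast degree_le σ {t} t
    rw [h5]; linarith
  rw [← Finset.sum_div, div_le_iff₀ (by linarith)]
  calc _ ≤ _ := Finset.sum_le_sum fun σ _ => h4 σ
    _ = _ := Finset.sum_add_distrib
    _ ≤ 2 * d / n * (pairingSet (Fin n × Fin d)).card +
        2 * d ^ 2 / n * (pairingSet (Fin n × Fin d)).card := add_le_add h2 h1
    _ ≤ 2 * (d * d) / n * (pairingSet (Fin n × Fin d)).card +
        2 * d ^ 2 / n * (pairingSet (Fin n × Fin d)).card := by
        gcongr; nlinarith
    _ = _ := by ring

lemma sum_relDeficit_le (hs : s ∈ selections n p) (hp : 2 ≤ p) (hpd : p ≤ d) (hn : 12 ≤ n)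
    {δ : ℝ} (m : ℕ) (hδ : 48 * Real.exp 8 ^ 2 * δ ≤ 1) (hm : (d : ℝ) * p ^ m ≤ δ * n) :
    ∑ σ ∈ pairingSet (Fin n × Fin d), relDeficit σ s t p (m + 1) ≤
      (40 * δ + (m + 1) * (n * Real.exp (-d)) +
        if 2 * p ≤ d then (0 : ℝ) else 12 * (m + 1) / (d : ℝ)) *
        (pairingSet (Fin n × Fin d)).card := by
  have hd : 1 ≤ d := by omega
  have hd' : (1 : ℝ) ≤ d := by exact_mod_cast hd
  have hp' : (1 : ℝ) ≤ p := by exact_mod_cast (by omega : 1 ≤ p)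
  have hn' : (12 : ℝ) ≤ n := by exact_mod_cast hn
  have hmono : ∀ i ∈ Finset.range (m + 1), (d : ℝ) * p ^ i ≤ d * p ^ m := by
    intro i hi
    have := Finset.mem_range.1 hi
    gcongr
    omega
  set Q : ℝ := ((pairingSet (Fin n × Fin d)).card : ℝ) with hQ
  unfold relDeficit
  rw [Finset.sum_add_distrib, Finset.sum_comm]
  have h1 := sum_degree_sub_card_waypoints_zero_le s t hd hn
  have h2 : ∀ i ∈ Finset.range (m + 1), _ := fun i hi =>
    sum_deficit_le (t := t) hs hp hpd hn i (by
      have h0 : 0 < Real.exp 8 ^ 2 := by positivity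
      have := hmono i hi
      nlinarith)
  refine (add_le_add h1 (Finset.sum_le_sum h2)).trans ?_
  rw [← hQ, ← Finset.sum_mul, ← add_mul]
  refine mul_le_mul_of_nonneg_right ?_ (Nat.cast_nonneg _)
  rw [Finset.sum_add_distrib, Finset.sum_add_distrib, Finset.sum_const, Finset.sum_const,
    Finset.card_range, nsmul_eq_mul, nsmul_eq_mul, ← Finset.sum_div, ← Finset.mul_sum]
  have h3 := sum_pow_le_three_mul hp hd m
  have h4 : 12 * (∑ i ∈ Finset.range (m + 1), (d : ℝ) * p ^ i) / n ≤ 36 * δ := by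
    rw [div_le_iff₀ (by linarith)]
    linarith
  have h5 : 4 * (d : ℝ) / n ≤ 4 * δ := by
    rw [div_le_iff₀ (by linarith)]
    have := hmono 0 (by simp)
    rw [pow_zero, mul_one] at this
    linarith
  have h6 : ((m + 1 : ℕ) : ℝ) * (if 2 * p ≤ d then (0 : ℝ) else 12 / (d : ℝ)) =
      if 2 * p ≤ d then (0 : ℝ) else 12 * (m + 1) / (d : ℝ) := by
    split_ifs
    · simp
    · push_cast; ring
  rw [h6]
  push_cast
  linarith

lemma sum_ite_pow_le (hp : 2 ≤ p) (hd : 1 ≤ d) {B : ℝ} (hB : 0 ≤ B) (m : ℕ) :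
    ∑ i ∈ Finset.range m, (if (d : ℝ) * p ^ (i + 1) ≤ B then (d : ℝ) * p ^ (i + 1) else 0) ≤
      3 * B := by
  induction m with
  | zero => simp; exact hB
  | succ m ih =>
    by_cases h : (d : ℝ) * p ^ (m + 1) ≤ B
    · have h1 := sum_pow_le_three_mul hp hd (m + 1)
      rw [Finset.sum_range_succ'] at h1
      have h2 : ∑ i ∈ Finset.range (m + 1),
          (if (d : ℝ) * p ^ (i + 1) ≤ B then (d : ℝ) * p ^ (i + 1) else 0) ≤
          ∑ i ∈ Finset.range (m + 1), (d : ℝ) * p ^ (i + 1) := by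
        refine Finset.sum_le_sum fun i _ => ?_
        split_ifs
        · exact le_rfl
        · positivity
      have : 0 ≤ (d : ℝ) * p ^ 0 := by positivity
      linarith
    · rw [Finset.sum_range_succ, if_neg h, add_zero]
      exact ih

lemma sum_relCoincidences_le (hp : 2 ≤ p) (hd : 1 ≤ d) (hn : 12 ≤ n)
    {δ : ℝ} (hδ0 : 0 ≤ δ) (m : ℕ) (hδ : 24 * δ ≤ 1) (hm : (d : ℝ) * p ^ m ≤ δ * n) :
    ∑ σ ∈ pairingSet (Fin n × Fin d), ∑ s ∈ selections n p,
        relCoincidences σ s t p (δ * n) (m + 1) ≤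
      24 * δ * ((pairingSet (Fin n × Fin d)).card * (selections n p).card) := by
  have hn' : (12 : ℝ) ≤ n := by exact_mod_cast hn
  have hd' : (1 : ℝ) ≤ d := by exact_mod_cast hd
  have hp' : (1 : ℝ) ≤ p := by exact_mod_cast (by omega : 1 ≤ p)
  have hmono : ∀ i ∈ Finset.range (m + 1), 24 * ((d : ℝ) * p ^ i) ≤ n := by
    intro i hi
    have := Finset.mem_range.1 hi
    have h1 : (d : ℝ) * p ^ i ≤ d * p ^ m := by
      gcongr
      omega
    nlinarith
  set Q : ℝ := ((pairingSet (Fin n × Fin d)).card : ℝ) * (selections n p).card with hQ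
  have h1 : ∑ σ ∈ pairingSet (Fin n × Fin d), ∑ s ∈ selections n p,
        relCoincidences σ s t p (δ * n) (m + 1) =
      ∑ i ∈ Finset.range (m + 1), if (d : ℝ) * p ^ (i + 1) ≤ δ * n then
        (∑ σ ∈ pairingSet (Fin n × Fin d), ∑ s ∈ selections n p,
          (numCoincidences σ s t p i : ℝ)) / (d * p ^ (i + 1)) else 0 := by
    unfold relCoincidences
    rw [Finset.sum_congr rfl fun σ _ => Finset.sum_comm, Finset.sum_comm]
    refine Finset.sum_congr rfl fun i _ => ?_
    split_ifs
    · simp only [Finset.sum_div]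
    · simp
  rw [h1]
  calc _ ≤ ∑ i ∈ Finset.range (m + 1), 8 / n * Q * (if (d : ℝ) * p ^ (i + 1) ≤ δ * n then
        (d : ℝ) * p ^ (i + 1) else 0) := by
        refine Finset.sum_le_sum fun i hi => ?_
        split_ifs
        · rw [div_le_iff₀ (by positivity)]
          refine (sum_sum_numCoincidences_le hp hd hn i (hmono i hi)).trans (le_of_eq ?_)
          rw [← hQ]; ring
        · simp
    _ ≤ 8 / n * Q * (3 * (δ * n)) := by
        rw [← Finset.mul_sum]
        gcongr
        exact sum_ite_pow_le hp hd (by positivity) _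
    _ = _ := by field_simp; ring

end Deficit

section Unreached

variable {n d : ℕ}

/-- The nodes outside `S` and `W` that have no neighbor in `W`. -/
def unreached (σ : Equiv.Perm (Fin n × Fin d)) (S W : Finset (Fin n)) : Finset (Fin n) :=
  Finset.univ.filter fun v => v ∉ S ∪ W ∧ ∀ j, (σ (v, j)).1 ∉ W

lemma mem_unreached {σ : Equiv.Perm (Fin n × Fin d)} {S W : Finset (Fin n)} {v : Fin n} :
    v ∈ unreached σ S W ↔ v ∉ S ∪ W ∧ ∀ j, (σ (v, j)).1 ∉ W := by
  simp [unreached]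

lemma card_pow_le_choose {N k : ℕ} {x : ℝ} (hx0 : 0 ≤ x) (hx : x + k ≤ N) :
    x ^ k ≤ k.factorial * (N.choose k : ℝ) := by
  have h1 := Nat.pow_le_choose k N (α := ℝ)
  rw [div_le_iff₀ (by exact_mod_cast k.factorial_pos)] at h1
  rw [mul_comm]
  refine le_trans ?_ h1
  have hkN : (k : ℝ) ≤ N := by linarith
  have hkN' : k ≤ N := by exact_mod_cast hkN
  have : ((N + 1 - k : ℕ) : ℝ) = N + 1 - k := by
    rw [Nat.cast_sub (by omega)]; push_cast; ring
  gcongr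
  rw [this]; linarith

section Cylinder

variable {S W : Finset (Fin n)} {σ₀ : Equiv.Perm (Fin n × Fin d)} {η : ℝ}

lemma le_card_freeHalfEdges (hσ₀ : σ₀ ∈ pairingSet (Fin n × Fin d)) {v : Fin n} (hv : v ∉ S)
    (hh : (hits σ₀ S v : ℝ) ≤ η * d) : (1 - η) * d ≤ ((freeHalfEdges σ₀ S v).card : ℝ) := by
  have : ((freeHalfEdges σ₀ S v).card : ℝ) + hits σ₀ S v = d := by
    exact_mod_cast card_freeHalfEdges hσ₀ hv
  linarith

lemma card_biUnion_freeHalfEdges (V : Finset (Fin n)) :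
    (V.biUnion (freeHalfEdges σ₀ S)).card = ∑ v ∈ V, (freeHalfEdges σ₀ S v).card := by
  apply Finset.card_biUnion
  intro u _ v _ huv
  refine Finset.disjoint_left.2 fun x hx hx' => ?_
  have h1 := (Finset.mem_sdiff.1 hx).1
  have h2 := (Finset.mem_sdiff.1 hx').1
  rw [mem_halfEdges, Finset.mem_singleton] at h1 h2
  exact huv (h1.symm.trans h2)

lemma card_biUnion_freeHalfEdges_le (V : Finset (Fin n)) :
    ((V.biUnion (freeHalfEdges σ₀ S)).card : ℝ) ≤ V.card * d := by
  rw [card_biUnion_freeHalfEdges]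
  push_cast
  calc _ ≤ ∑ _u ∈ V, (d : ℝ) := Finset.sum_le_sum fun u _ => by
        exact_mod_cast card_freeHalfEdges_le σ₀ S u
    _ = _ := by rw [Finset.sum_const, nsmul_eq_mul]

lemma le_card_biUnion_freeHalfEdges (hσ₀ : σ₀ ∈ pairingSet (Fin n × Fin d))
    (hh : ∀ v, v ∉ S → (hits σ₀ S v : ℝ) ≤ η * d) {V : Finset (Fin n)} (hV : ∀ v ∈ V, v ∉ S) :
    (1 - η) * (V.card * d) ≤ ((V.biUnion (freeHalfEdges σ₀ S)).card : ℝ) := by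
  rw [card_biUnion_freeHalfEdges]
  push_cast
  calc (1 - η) * (V.card * d) = ∑ _u ∈ V, (1 - η) * (d : ℝ) := by
        rw [Finset.sum_const, nsmul_eq_mul]; ring
    _ ≤ _ := Finset.sum_le_sum fun u hu =>
        le_card_freeHalfEdges hσ₀ (hV u hu) (hh u (hV u hu))

lemma sum_compl_revealed_notMem :
    ∑ x ∈ (revealed S σ₀)ᶜ, (if x.1 ∈ W then (0 : ℝ) else 1) =
      (revealed S σ₀)ᶜ.card - (W.biUnion (freeHalfEdges σ₀ S)).card := by
  have h1 : ∀ x : Fin n × Fin d, (if x.1 ∈ W then (0 : ℝ) else 1) =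
      1 - if x.1 ∈ W then 1 else 0 := fun x => by
    split_ifs <;> norm_num
  rw [Finset.sum_congr rfl fun x _ => h1 x, Finset.sum_sub_distrib, ← Finset.sum_filter,
    Finset.sum_const, Finset.sum_const, nsmul_eq_mul, nsmul_eq_mul, mul_one, mul_one]
  congr 3
  ext x
  simp only [Finset.mem_filter, Finset.mem_compl, Finset.mem_biUnion, freeHalfEdges,
    Finset.mem_sdiff, mem_halfEdges, Finset.mem_singleton]
  constructor
  · rintro ⟨h1, h2⟩; exact ⟨x.1, h2, rfl, h1⟩
  · rintro ⟨u, h1, rfl, h2⟩; exact ⟨h2, h1⟩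

lemma pow_card_le_exp {m : ℕ} {q c r N κ η k : ℝ} (hq0 : 0 ≤ q) (hq : q ≤ 1 - c / r)
    (hc : 0 ≤ c) (hr : 0 < r) (hrN : r ≤ N) (hm : (1 - η) * k ≤ m)
    (hκ : κ ≤ (1 - η) * c / N) (hk : 0 ≤ k) : q ^ m ≤ Real.exp (-(k * κ)) := by
  have hqe : q ≤ Real.exp (-(c / r)) := by
    have := Real.add_one_le_exp (-(c / r))
    linarith
  calc q ^ m ≤ Real.exp (-(c / r)) ^ m := by gcongr
    _ = Real.exp (m * -(c / r)) := by rw [← Real.exp_nat_mul]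
    _ ≤ _ := by
        apply Real.exp_le_exp.2
        rw [mul_neg, neg_le_neg_iff]
        calc k * κ ≤ k * ((1 - η) * c / N) := by gcongr
          _ = ((1 - η) * k) * (c / N) := by ring
          _ ≤ m * (c / r) := by
              have : 0 ≤ c / N := div_nonneg hc (hr.le.trans hrN)
              gcongr

set_option maxHeartbeats 400000 in
/-- The probability that a given set of nodes stays unreached by `W`. -/
lemma card_cylinder_subset_unreached_le (hσ₀ : σ₀ ∈ pairingSet (Fin n × Fin d)) (hd : 1 ≤ d)
    (hS : 8 * (S.card : ℝ) ≤ n) (hW : 4 * (W.card : ℝ) ≤ n)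
    (hWS : Disjoint W S) (hη : η ≤ 1)
    (hh : ∀ v, v ∉ S → (hits σ₀ S v : ℝ) ≤ η * d) (V : Finset (Fin n)) :
    (((cylinder (revealed S σ₀) σ₀).filter fun σ => V ⊆ unreached σ S W).card : ℝ) ≤
      Real.exp (-((1 - η) * ((1 - η) * (W.card * d) - 6 * (V.card * d)) / n)) ^ V.card *
        (cylinder (revealed S σ₀) σ₀).card := by
  set A := revealed S σ₀ with hA
  set k := V.card with hk
  set C := cylinder A σ₀ with hC
  rcases (C.filter fun σ => V ⊆ unreached σ S W).eq_empty_or_nonempty with he | ⟨σ₁, hσ₁⟩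
  · rw [he]; simp; positivity
  rcases Nat.eq_zero_or_pos k with hk0 | hk1
  · rw [hk0, pow_zero, one_mul]
    exact_mod_cast Finset.card_filter_le _ _
  have hd' : (1 : ℝ) ≤ d := by exact_mod_cast hd
  have hk' : (1 : ℝ) ≤ k := by exact_mod_cast hk1
  have hVS : ∀ v ∈ V, v ∉ S := by
    intro v hv
    have := (mem_unreached.1 ((Finset.mem_filter.1 hσ₁).2 hv)).1
    rw [Finset.mem_union] at this
    tauto
  have hn : (0 : ℝ) < n := by
    obtain ⟨v, _⟩ := Finset.card_pos.1 hk1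
    exact_mod_cast (lt_of_le_of_lt (Nat.zero_le _) v.2)
  set y : ℝ := ((W.biUnion (freeHalfEdges σ₀ S)).card : ℝ) with hy
  set X := V.biUnion (freeHalfEdges σ₀ S) with hX
  have hWS' : ∀ u ∈ W, u ∉ S := fun u hu => Finset.disjoint_left.1 hWS hu
  have hylo : (1 - η) * (W.card * d) ≤ y := le_card_biUnion_freeHalfEdges hσ₀ hh hWS'
  have hyhi : y ≤ W.card * d := card_biUnion_freeHalfEdges_le W
  have hXlo : (1 - η) * (k * d) ≤ X.card := le_card_biUnion_freeHalfEdges hσ₀ hh hVS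
  have hXhi : (X.card : ℝ) ≤ k * d := card_biUnion_freeHalfEdges_le V
  set K : ℝ := k * d with hK
  have hK1 : 1 ≤ K := by nlinarith
  rw [← Real.exp_nat_mul]
  rcases lt_or_ge y (6 * K) with hlt | hge
  · have h1 : (1 : ℝ) ≤ Real.exp (k * -((1 - η) * ((1 - η) * (W.card * d) - 6 * K) / n)) := by
      apply Real.one_le_exp
      apply mul_nonneg (by linarith)
      rw [← neg_div]
      apply div_nonneg _ hn.le
      have : (1 - η) * (6 * K - (1 - η) * (W.card * d)) ≥ 0 :=
        mul_nonneg (by linarith) (by linarith)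
      linarith
    have h2 : ((C.filter fun σ => V ⊆ unreached σ S W).card : ℝ) ≤ C.card := by
      exact_mod_cast Finset.card_filter_le _ _
    nlinarith [(Nat.cast_nonneg C.card : (0 : ℝ) ≤ C.card)]
  set r : ℝ := (Aᶜ.card : ℝ) with hr
  have hrlo := le_card_compl_revealed S σ₀
  have hrhi := card_compl_revealed_le S σ₀
  rw [← hA, ← hr] at hrlo hrhi
  have hr34 : 3 / 4 * (n * d : ℝ) ≤ r := by nlinarith
  have hr0 : 0 < r := lt_of_lt_of_le (by positivity) hr34
  have hyr : y ≤ r / 2 := by nlinarith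
  set q : ℝ := 1 - (y - 6 * K) / r with hq
  have hqr : q * r = r - (y - 6 * K) := by rw [hq]; field_simp
  have hq2 : 1 / 2 ≤ q := by
    rw [hq]
    have : (y - 6 * K) / r ≤ 1 / 2 := by rw [div_le_iff₀ hr0]; linarith
    linarith
  have hq1 : q ≤ 1 := by
    rw [hq]
    have : 0 ≤ (y - 6 * K) / r := div_nonneg (by linarith) hr0.le
    linarith
  set g : Fin n × Fin d → ℝ := fun x => if x.1 ∈ W then 0 else 1 with hg
  have hgsum : ∑ x ∈ Aᶜ, g x = r - y := sum_compl_revealed_notMem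
  have hmain := sum_cylinder_prod_le (g := g) (M := 1) (q := q)
    (fun x => by simp only [hg]; split_ifs <;> norm_num)
    (fun x => by simp only [hg]; split_ifs <;> norm_num) (by linarith) X.card A σ₀
    (revealed_closed hσ₀ S) X (by
      intro x hx
      obtain ⟨u, _, hu⟩ := Finset.mem_biUnion.1 hx
      exact (Finset.mem_sdiff.1 hu).2) rfl (by
      rw [hgsum, ← hr]
      have h1 : (X.card : ℝ) * 1 ^ 2 / q ≤ 2 * K := by
        rw [div_le_iff₀ (by linarith)]; nlinarith
      have h2 : q * (1 + 2 * X.card) ≤ 1 * (1 + 2 * K) := by gcongr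
      nlinarith)
  have hevent : ((C.filter fun σ => V ⊆ unreached σ S W).card : ℝ) ≤
      ∑ σ ∈ C, ∏ x ∈ X, g (σ x) := by
    rw [Finset.card_filter]
    push_cast
    refine Finset.sum_le_sum fun σ _ => ?_
    have h0 : ∀ x ∈ X, 0 ≤ g (σ x) := fun x _ => by simp only [hg]; split_ifs <;> norm_num
    split_ifs with h
    · refine le_of_eq (Finset.prod_eq_one fun x hx => ?_).symm
      obtain ⟨u, hu, hxu⟩ := Finset.mem_biUnion.1 hx
      have h1 := (Finset.mem_sdiff.1 hxu).1
      rw [mem_halfEdges, Finset.mem_singleton] at h1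
      have h2 := (mem_unreached.1 (h hu)).2 x.2
      rw [← h1, Prod.mk.eta] at h2
      simp [hg, h2]
    · exact Finset.prod_nonneg h0
  refine hevent.trans (hmain.trans ?_)
  gcongr
  have hκ : (1 - η) * ((1 - η) * (W.card * d) - 6 * K) / n ≤
      d * ((1 - η) * (y - 6 * K) / (n * d)) := by
    have h1 : (d : ℝ) * ((1 - η) * (y - 6 * K) / (n * d)) = (1 - η) * (y - 6 * K) / n := by
      field_simp
    rw [h1]
    gcongr
  refine (pow_card_le_exp (k := K) (κ := (1 - η) * (y - 6 * K) / (n * d)) (by linarith) hq.le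
    (by linarith) hr0 hrhi hXlo le_rfl (by linarith)).trans ?_
  apply Real.exp_le_exp.2
  rw [mul_neg, neg_le_neg_iff, hK, mul_assoc]
  gcongr
/-- The number of unreached nodes is concentrated from above. -/
lemma card_cylinder_lt_card_unreached_le (hσ₀ : σ₀ ∈ pairingSet (Fin n × Fin d)) (hd : 1 ≤ d)
    (hS : 8 * (S.card : ℝ) ≤ n) (hW : 4 * (W.card : ℝ) ≤ n)
    (hWS : Disjoint W S) (hη : η ≤ 1)
    (hh : ∀ v, v ∉ S → (hits σ₀ S v : ℝ) ≤ η * d) {k : ℕ} {μ θ a : ℝ}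
    (hμ : Real.exp (-((1 - η) * ((1 - η) * (W.card * d) - 6 * (k * d)) / n)) ≤ μ)
    (ha : k < a) (haμ : n * μ ≤ θ * (a - k)) :
    (((cylinder (revealed S σ₀) σ₀).filter fun σ => a < (unreached σ S W).card).card : ℝ) ≤
      θ ^ k * (cylinder (revealed S σ₀) σ₀).card := by
  set C := cylinder (revealed S σ₀) σ₀ with hC
  have hμ0 : 0 ≤ μ := (Real.exp_pos _).le.trans hμ
  have h1 : ∑ σ ∈ C, ((unreached σ S W).card.choose k : ℝ) ≤ (n.choose k : ℝ) * (μ ^ k * C.card) := by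
    have h2 : ∀ σ : Equiv.Perm (Fin n × Fin d), ((unreached σ S W).card.choose k : ℝ) =
        ∑ V ∈ (Finset.univ : Finset (Fin n)).powersetCard k,
          if V ⊆ unreached σ S W then (1 : ℝ) else 0 := by
      intro σ
      rw [← Finset.card_powersetCard, ← Finset.sum_filter, Finset.sum_const, nsmul_eq_mul, mul_one]
      congr 2
      ext V
      simp only [Finset.mem_powersetCard, Finset.mem_filter, Finset.subset_univ, true_and]
      tauto
    rw [Finset.sum_congr rfl fun σ _ => h2 σ, Finset.sum_comm]
    calc _ ≤ ∑ V ∈ (Finset.univ : Finset (Fin n)).powersetCard k, μ ^ k * (C.card : ℝ) := by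
          refine Finset.sum_le_sum fun V hV => ?_
          have hVk := (Finset.mem_powersetCard.1 hV).2
          have h3 := card_cylinder_subset_unreached_le hσ₀ hd hS hW hWS hη hh V
          rw [hVk, ← hC, Finset.card_filter] at h3
          push_cast at h3
          refine h3.trans ?_
          gcongr
      _ = _ := by rw [Finset.sum_const, nsmul_eq_mul, Finset.card_powersetCard]; simp
  have h4 : ((C.filter fun σ => a < (unreached σ S W).card).card : ℝ) * (a - k) ^ k ≤
      k.factorial * ∑ σ ∈ C, ((unreached σ S W).card.choose k : ℝ) := by
    rw [Finset.mul_sum, ← nsmul_eq_mul, ← Finset.sum_const, Finset.sum_filter]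
    refine Finset.sum_le_sum fun σ _ => ?_
    split_ifs with h
    · exact card_pow_le_choose (by linarith) (by linarith)
    · positivity
  have h5 : (k.factorial : ℝ) * (n.choose k : ℝ) ≤ (n : ℝ) ^ k := by
    have := Nat.choose_le_pow_div k n (α := ℝ)
    rw [le_div_iff₀ (by exact_mod_cast k.factorial_pos)] at this
    linarith
  have h6 : ((C.filter fun σ => a < (unreached σ S W).card).card : ℝ) * (a - k) ^ k ≤
      (θ ^ k * C.card) * (a - k) ^ k := by
    calc _ ≤ _ := h4
      _ ≤ k.factorial * ((n.choose k : ℝ) * (μ ^ k * C.card)) := by gcongr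
      _ = (k.factorial * (n.choose k : ℝ)) * (μ ^ k * C.card) := by ring
      _ ≤ (n : ℝ) ^ k * (μ ^ k * C.card) := by gcongr
      _ = (n * μ) ^ k * C.card := by rw [mul_pow]; ring
      _ ≤ (θ * (a - k)) ^ k * C.card := by gcongr
      _ = _ := by rw [mul_pow]; ring
  exact le_of_mul_le_mul_right h6 (pow_pos (by linarith) k)

end Cylinder

section CylinderBoth

variable {S W : Finset (Fin n)} {σ₀ : Equiv.Perm (Fin n × Fin d)} {η : ℝ}

lemma unreached_congr (hσ₀ : σ₀ ∈ pairingSet (Fin n × Fin d)) {σ : Equiv.Perm (Fin n × Fin d)}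
    (h : σ ∈ cylinder (revealed (S ∪ W) σ₀) σ₀) : unreached σ S W = unreached σ₀ S W := by
  have hσ := (mem_cylinder.1 h).1
  have key : ∀ τ ∈ pairingSet (Fin n × Fin d), ∀ v : Fin n,
      (∀ j, (τ (v, j)).1 ∉ W) ↔ ∀ x : Fin n × Fin d, x.1 ∈ W → (τ x).1 ≠ v := by
    intro τ hτ v
    constructor
    · rintro h1 x hx rfl
      apply h1 (τ x).2
      rw [Prod.mk.eta, (mem_pairingSet.1 hτ x).1]
      exact hx
    · intro h1 j hj
      exact h1 _ hj (by rw [(mem_pairingSet.1 hτ _).1])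
  ext v
  rw [mem_unreached, mem_unreached, key σ hσ, key σ₀ hσ₀]
  refine and_congr_right fun _ => forall₂_congr fun x hx => ?_
  rw [cylinder_revealed_apply h (Finset.mem_union_right _ hx)]

lemma hits_union_of_mem_unreached {σ : Equiv.Perm (Fin n × Fin d)} {v : Fin n}
    (hv : v ∈ unreached σ S W) : hits σ (S ∪ W) v = hits σ S v := by
  unfold hits
  congr 1
  refine Finset.filter_congr fun j _ => ?_
  rw [Finset.mem_union]
  exact or_iff_left ((mem_unreached.1 hv).2 j)

/-- An unreached node is unlikely to have all its remaining edges to unreached nodes. -/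
lemma card_cylinder_isolated_le (hσ₀ : σ₀ ∈ pairingSet (Fin n × Fin d)) (hd : 1 ≤ d)
    (hn : 47 ≤ n) (hSW : 40 * ((S ∪ W).card : ℝ) ≤ n) (hη : η ≤ 1 / 10)
    (hU : ((unreached σ₀ S W).card : ℝ) ≤ 2 / 5 * n) {v : Fin n} (hv : v ∈ unreached σ₀ S W)
    (hh : (hits σ₀ S v : ℝ) ≤ η * d) :
    (((cylinder (revealed (S ∪ W) σ₀) σ₀).filter fun σ =>
        ∀ j, (σ (v, j)).1 ∈ S ∪ W ∪ unreached σ S W).card : ℝ) ≤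
      Real.exp (-(3 / 5 * d)) * (cylinder (revealed (S ∪ W) σ₀) σ₀).card := by
  set A := revealed (S ∪ W) σ₀ with hA
  set C := cylinder A σ₀ with hC
  set X := freeHalfEdges σ₀ (S ∪ W) v with hX
  set U := unreached σ₀ S W with hUdef
  have hd' : (1 : ℝ) ≤ d := by exact_mod_cast hd
  have hn' : (47 : ℝ) ≤ n := by exact_mod_cast hn
  have hXlo : (1 - η) * d ≤ (X.card : ℝ) := by
    apply le_card_freeHalfEdges hσ₀ (mem_unreached.1 hv).1
    rw [hits_union_of_mem_unreached hv]; exact hh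
  have hXhi : (X.card : ℝ) ≤ d := by exact_mod_cast card_freeHalfEdges_le σ₀ (S ∪ W) v
  have hr := le_card_compl_revealed (S ∪ W) σ₀
  rw [← hA] at hr
  have hr' : 19 / 20 * (n * d : ℝ) ≤ Aᶜ.card := by nlinarith
  set g : Fin n × Fin d → ℝ := fun x => if x.1 ∈ U then 1 else 0 with hg
  have hgsum : ∑ x ∈ Aᶜ, g x ≤ 2 / 5 * n * d := by
    have h1 : ∑ x ∈ Aᶜ, g x ≤ ((halfEdges d U).card : ℝ) := by
      rw [← Finset.sum_filter, Finset.sum_const, nsmul_eq_mul, mul_one]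
      refine Nat.cast_le.2 (Finset.card_le_card fun x hx => ?_)
      rw [mem_halfEdges]
      exact (Finset.mem_filter.1 hx).2
    refine h1.trans ?_
    rw [card_halfEdges]
    push_cast
    gcongr
  have hmain := sum_cylinder_prod_le (g := g) (M := 1) (q := 1 / 2)
    (fun x => by simp only [hg]; split_ifs <;> norm_num)
    (fun x => by simp only [hg]; split_ifs <;> norm_num) (by norm_num) X.card A σ₀
    (revealed_closed hσ₀ _) X (fun x hx => (Finset.mem_sdiff.1 hx).2) rfl (by
      have : (47 : ℝ) * d ≤ n * d := by gcongr
      linarith)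
  have hevent : ((C.filter fun σ => ∀ j, (σ (v, j)).1 ∈ S ∪ W ∪ unreached σ S W).card : ℝ) ≤
      ∑ σ ∈ C, ∏ x ∈ X, g (σ x) := by
    rw [Finset.card_filter]
    push_cast
    refine Finset.sum_le_sum fun σ hσ => ?_
    have h0 : ∀ x ∈ X, 0 ≤ g (σ x) := fun x _ => by simp only [hg]; split_ifs <;> norm_num
    split_ifs with h
    · refine le_of_eq (Finset.prod_eq_one fun x hx => ?_).symm
      rw [hX, freeHalfEdges, Finset.mem_sdiff, mem_halfEdges, Finset.mem_singleton] at hx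
      have h2 := h x.2
      rw [← hx.1, Prod.mk.eta, unreached_congr hσ₀ hσ, Finset.mem_union] at h2
      have h3 : (σ x).1 ∉ S ∪ W := fun h4 => by
        apply hx.2
        rw [← revealed_congr hσ, mem_revealed (mem_cylinder.1 hσ).1]
        exact Or.inr h4
      simp only [hg]
      rw [if_pos (h2.resolve_left h3)]
    · exact Finset.prod_nonneg h0
  refine hevent.trans (hmain.trans ?_)
  gcongr
  have h2 : (1 / 2 : ℝ) = Real.exp (-Real.log 2) := by
    rw [Real.exp_neg, Real.exp_log (by norm_num)]; norm_num
  rw [h2, ← Real.exp_nat_mul]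
  apply Real.exp_le_exp.2
  have h3 := Real.log_two_gt_d9
  have h4 : 9 / 10 * (d : ℝ) ≤ X.card := by nlinarith
  nlinarith

end CylinderBoth

section OuterRing

variable {σ : Equiv.Perm (Fin n × Fin d)} {s : Fin n → Finset (Fin n) → Finset (Fin n)}
  {t : Fin n} {l : ℕ} {W : Finset (Fin n)}

lemma mem_outerRing (hσ : σ ∈ pairingSet (Fin n × Fin d)) {v : Fin n} :
    v ∈ outerRing σ s t l ↔
      v ∉ explored σ s t (l + 1) ∧ ∀ j, (σ (v, j)).1 ∉ waypoints σ s t l := by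
  have h1 : (∃ u ∈ waypoints σ s t l, v ∈ nbrs σ u) ↔ ∃ j, (σ (v, j)).1 ∈ waypoints σ s t l := by
    constructor
    · rintro ⟨u, hu, hv⟩
      obtain ⟨j, rfl⟩ := mem_nbrs.1 ((mem_nbrs_comm hσ).1 hv)
      exact ⟨j, hu⟩
    · rintro ⟨j, hj⟩
      exact ⟨_, hj, (mem_nbrs_comm hσ).1 (mem_nbrs.2 ⟨j, rfl⟩)⟩
  simp only [outerRing, innerRing, Finset.mem_sdiff, Finset.mem_univ, true_and,
    Finset.mem_union, Finset.mem_biUnion, h1, explored]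
  push Not
  tauto

lemma outerRing_subset_unreached (hσ : σ ∈ pairingSet (Fin n × Fin d))
    (hW : W ⊆ waypoints σ s t l) :
    outerRing σ s t l ⊆ unreached σ (explored σ s t l) W := by
  intro v hv
  rw [mem_outerRing hσ] at hv
  rw [mem_unreached, Finset.mem_union]
  refine ⟨?_, fun j hj => hv.2 j (hW hj)⟩
  rintro (h | h)
  · exact hv.1 (explored_subset_succ _ _ _ _ h)
  · exact hv.1 (waypoints_subset_explored _ _ _ _ (hW h))

/-- The neighbors of an outer node without neighbors in the inner ring. -/
lemma nbr_mem_of_outerRing (hσ : σ ∈ pairingSet (Fin n × Fin d))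
    (hW : W ⊆ waypoints σ s t l) {v : Fin n} (hv : v ∈ outerRing σ s t l)
    (h : ¬ ∃ u ∈ innerRing σ s t l, u ∈ nbrs σ v) (j : Fin d) :
    (σ (v, j)).1 ∈ explored σ s t l ∪ W ∪ unreached σ (explored σ s t l) W := by
  have hv' := (mem_outerRing hσ).1 hv
  have hnW := hv'.2 j
  have hnI : (σ (v, j)).1 ∉ innerRing σ s t l := fun h' => h ⟨_, h', mem_nbrs.2 ⟨j, rfl⟩⟩
  by_cases hE : (σ (v, j)).1 ∈ explored σ s t (l + 1)
  · rw [explored_succ, Finset.mem_union] at hE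
    exact Finset.mem_union_left _ (Finset.mem_union_left _ (hE.resolve_left hnW))
  · refine Finset.mem_union_right _ (outerRing_subset_unreached hσ hW ?_)
    simp only [outerRing, Finset.mem_sdiff, Finset.mem_univ, true_and, Finset.mem_union]
    exact fun h' => h'.elim hE hnI

end OuterRing

end Unreached

section Truncate

variable {α : Type*}

/-- A subset of `S` of size `min m |S|`. -/
noncomputable def truncate (m : ℕ) (S : Finset α) : Finset α :=
  (Finset.exists_subset_card_eq (min_le_right m S.card)).choose

lemma truncate_subset (m : ℕ) (S : Finset α) : truncate m S ⊆ S :=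
  (Finset.exists_subset_card_eq (min_le_right m S.card)).choose_spec.1

lemma card_truncate (m : ℕ) (S : Finset α) : (truncate m S).card = min m S.card :=
  (Finset.exists_subset_card_eq (min_le_right m S.card)).choose_spec.2

end Truncate

section FinalStage

lemma mul_card_eq_sum {α : Type*} (S : Finset α) (c : ℝ) : c * (S.card : ℝ) = ∑ _x ∈ S, c := by
  rw [Finset.sum_const, nsmul_eq_mul, mul_comm]

variable {n d p : ℕ} {s : Fin n → Finset (Fin n) → Finset (Fin n)} {t : Fin n}

open Classical in
lemma card_filter_many_unreached_le (hs : s ∈ selections n p) (hp : 2 ≤ p) (hd : 1 ≤ d) {m M k : ℕ}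
    (hm : 24 * ((d : ℝ) * p ^ m) ≤ n) (hM : 4 * (M : ℝ) ≤ n) {η μ θ a w w₀ : ℝ} (hη : η ≤ 1)
    (hwM : w ≤ M) (hww : w ≤ w₀)
    (hμ : Real.exp (-((1 - η) * ((1 - η) * (w * d) - 6 * (k * d)) / n)) ≤ μ)
    (ha : k < a) (haμ : n * μ ≤ θ * (a - k)) (hθ : 0 ≤ θ) :
    (((pairingSet (Fin n × Fin d)).filter fun σ =>
      ((∀ v, v ∉ explored σ s t (m + 1) → (hits σ (explored σ s t (m + 1)) v : ℝ) ≤ η * d) ∧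
        w₀ ≤ (waypoints σ s t (m + 1)).card) ∧
      a < (unreached σ (explored σ s t (m + 1))
        (truncate M (waypoints σ s t (m + 1)))).card).card : ℝ) ≤
      θ ^ k * (pairingSet (Fin n × Fin d)).card := by
  rw [Finset.card_filter]
  push_cast
  rw [mul_card_eq_sum]
  refine sum_le_of_forall_stage s t (m + 1) _ _ fun σ₀ hσ₀ => ?_
  set C := cylinder (revealed (explored σ₀ s t (m + 1)) σ₀) σ₀ with hC
  by_cases hgood : (∀ v, v ∉ explored σ₀ s t (m + 1) →
      (hits σ₀ (explored σ₀ s t (m + 1)) v : ℝ) ≤ η * d) ∧ w₀ ≤ (waypoints σ₀ s t (m + 1)).card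
  · have hn : (0 : ℝ) < n := by exact_mod_cast (lt_of_le_of_lt (Nat.zero_le _) t.2)
    have hcard := card_truncate M (waypoints σ₀ s t (m + 1))
    have hlo : w ≤ ((truncate M (waypoints σ₀ s t (m + 1))).card : ℝ) := by
      rw [hcard, Nat.cast_min]
      exact le_min hwM (hww.trans hgood.2)
    have hhi : ((truncate M (waypoints σ₀ s t (m + 1))).card : ℝ) ≤ M := by
      rw [hcard, Nat.cast_min]; exact min_le_left _ _
    have h1 := card_cylinder_lt_card_unreached_le hσ₀ hd
      (eight_card_explored_le hs hp hd σ₀ hm (m + 1) le_rfl)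
      (by linarith) (Finset.disjoint_of_subset_left (truncate_subset M _)
        (disjoint_waypoints_explored hs (m + 1))) hη hgood.1 (k := k) (μ := μ) (θ := θ) (a := a)
      (le_trans (Real.exp_le_exp.2 (by
        rw [neg_le_neg_iff]
        have : 0 ≤ 1 - η := by linarith
        gcongr)) hμ) ha haμ
    rw [← mul_card_eq_sum]
    refine le_trans ?_ h1
    rw [Finset.card_filter]
    push_cast
    refine Finset.sum_le_sum fun σ hσ => ?_
    obtain ⟨e1, e2, _⟩ := waypoints_congr_of_mem_cylinder hσ
    rw [e1, e2]
    split_ifs with h2 h3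
    · exact le_rfl
    · exact absurd h2.2 h3
    · norm_num
    · exact le_rfl
  · refine le_trans (le_of_eq (Finset.sum_eq_zero fun σ hσ => ?_))
      (Finset.sum_nonneg fun _ _ => pow_nonneg hθ k)
    obtain ⟨e1, e2, _⟩ := waypoints_congr_of_mem_cylinder hσ
    rw [if_neg]
    rintro ⟨⟨h1, h2⟩, _⟩
    apply hgood
    rw [e2] at h1
    refine ⟨fun v hv => ?_, e1 ▸ h2⟩
    rw [← hits_congr hσ₀ hσ hv]
    exact h1 v hv

open Classical in
lemma card_filter_isolated_le (hs : s ∈ selections n p) (hp : 2 ≤ p) (hd : 1 ≤ d) {m M : ℕ}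
    (hn : 47 ≤ n) (hm : 40 * (3 * ((d : ℝ) * p ^ m) + M) ≤ n) {η : ℝ} (hη : η ≤ 1 / 10) :
    (((pairingSet (Fin n × Fin d)).filter fun σ =>
      (∀ v, v ∉ explored σ s t (m + 1) → (hits σ (explored σ s t (m + 1)) v : ℝ) ≤ η * d) ∧
      ((unreached σ (explored σ s t (m + 1))
        (truncate M (waypoints σ s t (m + 1)))).card : ℝ) ≤ 2 / 5 * n ∧
      ∃ v ∈ outerRing σ s t (m + 1), ¬ ∃ u ∈ innerRing σ s t (m + 1), u ∈ nbrs σ v).card : ℝ) ≤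
      n * Real.exp (-(3 / 5 * d)) * (pairingSet (Fin n × Fin d)).card := by
  set E : Equiv.Perm (Fin n × Fin d) → Finset (Fin n) := fun σ => explored σ s t (m + 1) with hE
  set W : Equiv.Perm (Fin n × Fin d) → Finset (Fin n) :=
    fun σ => truncate M (waypoints σ s t (m + 1)) with hW
  have hcongr : ∀ σ₀ : Equiv.Perm (Fin n × Fin d), ∀ σ ∈ cylinder (revealed (E σ₀ ∪ W σ₀) σ₀) σ₀,
      E σ = E σ₀ ∧ W σ = W σ₀ := by
    intro σ₀ σ hσ
    have h1 : σ ∈ cylinder (revealed (E σ₀) σ₀) σ₀ := by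
      rw [mem_cylinder] at hσ ⊢
      exact ⟨hσ.1, fun x hx => hσ.2 x (revealed_mono Finset.subset_union_left σ₀ hx)⟩
    obtain ⟨e1, e2, _⟩ := waypoints_congr_of_mem_cylinder h1
    exact ⟨e2, by simp only [hW, e1]⟩
  have key : ∀ v : Fin n, (((pairingSet (Fin n × Fin d)).filter fun σ =>
      v ∈ unreached σ (E σ) (W σ) ∧ (hits σ (E σ) v : ℝ) ≤ η * d ∧
      ((unreached σ (E σ) (W σ)).card : ℝ) ≤ 2 / 5 * n ∧
      ∀ j, (σ (v, j)).1 ∈ E σ ∪ W σ ∪ unreached σ (E σ) (W σ)).card : ℝ) ≤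
      Real.exp (-(3 / 5 * d)) * (pairingSet (Fin n × Fin d)).card := by
    intro v
    rw [Finset.card_filter]
    push_cast
    rw [mul_card_eq_sum]
    refine sum_pairingSet_le (fun σ => revealed (E σ ∪ W σ) σ) ?_ _ _ fun σ₀ hσ₀ => ?_
    · intro σ₀ _ σ hσ
      obtain ⟨e1, e2⟩ := hcongr σ₀ σ hσ
      simp only [e1, e2]
      exact revealed_congr hσ
    set C := cylinder (revealed (E σ₀ ∪ W σ₀) σ₀) σ₀ with hC
    by_cases hgood : v ∈ unreached σ₀ (E σ₀) (W σ₀) ∧ (hits σ₀ (E σ₀) v : ℝ) ≤ η * d ∧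
      ((unreached σ₀ (E σ₀) (W σ₀)).card : ℝ) ≤ 2 / 5 * n
    · have hcard : 40 * ((E σ₀ ∪ W σ₀).card : ℝ) ≤ n := by
        have h1 : ((E σ₀).card : ℝ) ≤ 3 * (d * p ^ m) := by
          exact_mod_cast card_explored_succ_le hs hp hd m
        have h2 : ((W σ₀).card : ℝ) ≤ M := by
          simp only [hW]; rw [card_truncate, Nat.cast_min]; exact min_le_left _ _
        have h3 : ((E σ₀ ∪ W σ₀).card : ℝ) ≤ (E σ₀).card + (W σ₀).card := by
          exact_mod_cast Finset.card_union_le _ _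
        linarith
      have h1 := card_cylinder_isolated_le hσ₀ hd hn hcard hη hgood.2.2 hgood.1 hgood.2.1
      rw [← mul_card_eq_sum]
      refine le_trans ?_ h1
      rw [Finset.card_filter]
      push_cast
      refine Finset.sum_le_sum fun σ hσ => ?_
      obtain ⟨e1, e2⟩ := hcongr σ₀ σ hσ
      rw [e1, e2]
      split_ifs with h2 h3
      · exact le_rfl
      · exact absurd h2.2.2.2 h3
      · norm_num
      · exact le_rfl
    · refine le_trans (le_of_eq (Finset.sum_eq_zero fun σ hσ => ?_))
        (Finset.sum_nonneg fun _ _ => (Real.exp_pos _).le)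
      obtain ⟨e1, e2⟩ := hcongr σ₀ σ hσ
      rw [if_neg]
      rintro ⟨h1, h2, h3, _⟩
      apply hgood
      rw [e1, e2] at h1 h3
      rw [e1] at h2
      have h4 := unreached_congr hσ₀ hσ
      have h5 : σ ∈ cylinder (revealed (E σ₀) σ₀) σ₀ := by
        rw [mem_cylinder]
        exact ⟨(mem_cylinder.1 hσ).1, fun x hx => (mem_cylinder.1 hσ).2 x
          (revealed_mono Finset.subset_union_left σ₀ hx)⟩
      have hvE : v ∉ E σ₀ := fun h =>
        (mem_unreached.1 h1).1 (Finset.mem_union_left _ h)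
      rw [h4] at h1 h3
      exact ⟨h1, hits_congr hσ₀ h5 hvE ▸ h2, h3⟩
  have hcover : ((pairingSet (Fin n × Fin d)).filter fun σ =>
      (∀ v, v ∉ E σ → (hits σ (E σ) v : ℝ) ≤ η * d) ∧
      ((unreached σ (E σ) (W σ)).card : ℝ) ≤ 2 / 5 * n ∧
      ∃ v ∈ outerRing σ s t (m + 1), ¬ ∃ u ∈ innerRing σ s t (m + 1), u ∈ nbrs σ v) ⊆
      Finset.univ.biUnion fun v => (pairingSet (Fin n × Fin d)).filter fun σ =>
      v ∈ unreached σ (E σ) (W σ) ∧ (hits σ (E σ) v : ℝ) ≤ η * d ∧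
      ((unreached σ (E σ) (W σ)).card : ℝ) ≤ 2 / 5 * n ∧
      ∀ j, (σ (v, j)).1 ∈ E σ ∪ W σ ∪ unreached σ (E σ) (W σ) := by
    intro σ hσ
    rw [Finset.mem_filter] at hσ
    obtain ⟨hσ1, h1, h2, v, hv, h3⟩ := hσ
    rw [Finset.mem_biUnion]
    have hsub := truncate_subset M (waypoints σ s t (m + 1))
    have hvU := outerRing_subset_unreached hσ1 hsub hv
    refine ⟨v, Finset.mem_univ _, Finset.mem_filter.2 ⟨hσ1, hvU, h1 v fun h =>
      (mem_unreached.1 hvU).1 (Finset.mem_union_left _ h), h2,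
      nbr_mem_of_outerRing hσ1 hsub hv h3⟩⟩
  calc _ ≤ _ := Nat.cast_le.2 ((Finset.card_le_card hcover).trans Finset.card_biUnion_le)
    _ ≤ ∑ _v : Fin n, Real.exp (-(3 / 5 * d)) * ((pairingSet (Fin n × Fin d)).card : ℝ) := by
        push_cast
        exact Finset.sum_le_sum fun v _ => key v
    _ = _ := by rw [Finset.sum_const, nsmul_eq_mul]; simp; ring

end FinalStage

section Markov

variable {α β : Type*}

open Classical in
lemma card_filter_lt_mul_le (S : Finset α) (f : α → ℝ) (hf : ∀ x ∈ S, 0 ≤ f x) {a : ℝ} :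
    ((S.filter fun x => a < f x).card : ℝ) * a ≤ ∑ x ∈ S, f x := by
  rw [← nsmul_eq_mul, ← Finset.sum_const, Finset.sum_filter]
  refine Finset.sum_le_sum fun x hx => ?_
  split_ifs with h
  · exact h.le
  · exact hf x hx

open Classical in
lemma card_filter_lt_le {S : Finset α} {f : α → ℝ} (hf : ∀ x ∈ S, 0 ≤ f x) {a c : ℝ} (ha : 0 < a)
    (h : ∑ x ∈ S, f x ≤ a * c * S.card) : ((S.filter fun x => a < f x).card : ℝ) ≤ c * S.card := by
  have h1 := (card_filter_lt_mul_le S f hf (a := a)).trans h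
  refine le_of_mul_le_mul_right ?_ ha
  linarith

open Classical in
lemma card_filter_product_le {S : Finset α} {T : Finset β} {Q : α → β → Prop} {c : ℝ}
    (h : ∀ y ∈ T, ((S.filter fun x => Q x y).card : ℝ) ≤ c * S.card) :
    (((S ×ˢ T).filter fun ω => Q ω.1 ω.2).card : ℝ) ≤ c * (S ×ˢ T).card := by
  rw [Finset.card_filter, Finset.sum_product_right, Finset.card_product]
  push_cast
  calc _ ≤ ∑ y ∈ T, c * (S.card : ℝ) := by
        refine Finset.sum_le_sum fun y hy => le_trans (le_of_eq ?_) (h y hy)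
        rw [Finset.card_filter]; push_cast; rfl
    _ = _ := by rw [Finset.sum_const, nsmul_eq_mul]; ring

end Markov

section LowerBound

variable {n d p : ℕ} {σ : Equiv.Perm (Fin n × Fin d)}
  {s : Fin n → Finset (Fin n) → Finset (Fin n)} {t : Fin n}

lemma min_le_card_waypoints (hs : s ∈ selections n p) (hp : 2 ≤ p) (hd : 1 ≤ d) {m : ℕ}
    {δ e K κ : ℝ} (hδ : 0 < δ) (hm : (d : ℝ) * p ^ m ≤ δ * n) (he : e ≤ 1 / 4)
    (hdef : relDeficit σ s t p (m + 1) ≤ e)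
    (hco : relCoincidences σ s t p (δ * n) (m + 1) ≤ e)
    (hK : 0 ≤ K) (hC : (numCoincidences σ s t p m : ℝ) ≤ K * (d * p ^ (m + 1)) ^ 2 / n)
    (hκ : κ * (4 * (1 / δ + K)) ≤ 1) :
    min ((1 - 2 * e) * (d * p ^ (m + 1))) (κ * n) ≤ ((waypoints σ s t (m + 1)).card : ℝ) := by
  have hn : (0 : ℝ) < n := by exact_mod_cast (lt_of_le_of_lt (Nat.zero_le _) t.2)
  have hd' : (1 : ℝ) ≤ d := by exact_mod_cast hd
  have hp' : (2 : ℝ) ≤ p := by exact_mod_cast hp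
  have hΛ0 : 0 < (d : ℝ) * p ^ (m + 1) := by positivity
  rcases le_or_gt ((d : ℝ) * p ^ (m + 1)) (δ * n) with hle | hgt
  · refine (min_le_left _ _).trans
      (le_trans ?_ (le_card_waypoints (t := t) hp hd (m + 1) hle))
    rw [mul_comm]
    exact mul_le_mul_of_nonneg_left (by linarith) hΛ0.le
  · refine (min_le_right _ _).trans ?_
    have hN1 := le_numSelected (σ := σ) (s := s) (t := t) hp hd m hm
    have hN2 : (numSelected σ s t p m : ℝ) ≤ d * p ^ (m + 1) := by
      have h1 : numSelected σ s t p m ≤ p * (d * p ^ m) :=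
        (numSelected_le_mul hs m).trans (Nat.mul_le_mul_left _ (card_waypoints_le hs m))
      have h2 : (numSelected σ s t p m : ℝ) ≤ p * (d * p ^ m) := by exact_mod_cast h1
      rw [pow_succ]; linarith
    have hsq : (numSelected σ s t p m : ℝ) ^ 2 ≤ (waypoints σ s t (m + 1)).card *
        (numSelected σ s t p m + numCoincidences σ s t p m) := by
      exact_mod_cast sq_numSelected_le m
    set Λ : ℝ := d * p ^ (m + 1) with hΛ
    set w : ℝ := ((waypoints σ s t (m + 1)).card : ℝ) with hw
    have hw0 : 0 ≤ w := Nat.cast_nonneg _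
    have hN3 : Λ / 2 ≤ numSelected σ s t p m := by
      refine le_trans ?_ hN1
      nlinarith
    have h1 : (Λ / 2) ^ 2 ≤ w * (Λ ^ 2 * (1 / δ + K) / n) := by
      calc (Λ / 2) ^ 2 ≤ (numSelected σ s t p m : ℝ) ^ 2 := by gcongr
        _ ≤ _ := hsq
        _ ≤ w * (Λ ^ 2 * (1 / δ + K) / n) := by
          gcongr
          have h2 : Λ ≤ Λ ^ 2 / (δ * n) := by
            rw [le_div_iff₀ (by positivity)]
            nlinarith
          calc (numSelected σ s t p m : ℝ) + numCoincidences σ s t p m ≤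
                Λ ^ 2 / (δ * n) + K * Λ ^ 2 / n := by linarith
            _ = _ := by field_simp
    have h2 : (n : ℝ) ≤ w * (4 * (1 / δ + K)) := by
      have h3 : w * (Λ ^ 2 * (1 / δ + K) / n) = (Λ / 2) ^ 2 * (w * (4 * (1 / δ + K)) / n) := by
        field_simp; ring
      rw [h3] at h1
      have h4 : 1 ≤ w * (4 * (1 / δ + K)) / n := by
        refine le_of_mul_le_mul_left ?_ (by positivity : 0 < (Λ / 2) ^ 2)
        linarith
      rwa [le_div_iff₀ hn, one_mul] at h4
    have hpos : 0 < 4 * (1 / δ + K) := by positivity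
    refine le_of_mul_le_mul_right ?_ hpos
    nlinarith

open Classical in
lemma card_filter_exists_hits_le (hs : s ∈ selections n p) (hp : 2 ≤ p) (hd : 1 ≤ d) {η : ℝ}
    (hη : 0 < η) (m : ℕ) (h : 48 * Real.exp (2 / η) ^ 2 * ((d : ℝ) * p ^ m) ≤ n) :
    (((pairingSet (Fin n × Fin d)).filter fun σ => ¬ ∀ v, v ∉ explored σ s t (m + 1) →
        (hits σ (explored σ s t (m + 1)) v : ℝ) ≤ η * d).card : ℝ) ≤
      n * Real.exp (-d) * (pairingSet (Fin n × Fin d)).card := by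
  have hcover : ((pairingSet (Fin n × Fin d)).filter fun σ => ¬ ∀ v, v ∉ explored σ s t (m + 1) →
        (hits σ (explored σ s t (m + 1)) v : ℝ) ≤ η * d) ⊆
      Finset.univ.biUnion fun v => (pairingSet (Fin n × Fin d)).filter fun σ =>
        v ∉ explored σ s t m ∧ η * d < hits σ (explored σ s t (m + 1)) v := by
    intro σ hσ
    rw [Finset.mem_filter] at hσ
    obtain ⟨h1, h2⟩ := hσ
    push Not at h2
    obtain ⟨v, hv, h3⟩ := h2
    exact Finset.mem_biUnion.2 ⟨v, Finset.mem_univ _, Finset.mem_filter.2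
      ⟨h1, fun h4 => hv (explored_subset_succ _ _ _ _ h4), h3⟩⟩
  calc _ ≤ _ := Nat.cast_le.2 ((Finset.card_le_card hcover).trans Finset.card_biUnion_le)
    _ ≤ ∑ _v : Fin n, Real.exp (-d) * ((pairingSet (Fin n × Fin d)).card : ℝ) := by
        push_cast
        exact Finset.sum_le_sum fun v _ => by
          convert card_filter_hits_le (t := t) hs hp hd hη v m h
    _ = _ := by rw [Finset.sum_const, nsmul_eq_mul]; simp; ring

end LowerBound

section Estimates

lemma exp_neg_one_sub_mul_le {ρ x : ℝ} (hρ0 : 0 ≤ ρ) (hρ : ρ ≤ 1 / 2) :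
    Real.exp (-((1 - ρ) * x)) ≤ Real.exp (-x) + 2 * ρ := by
  have h1 : Real.exp (-x) = Real.exp (-((1 - ρ) * x)) * Real.exp (-(ρ * x)) := by
    rw [← Real.exp_add]; ring_nf
  have h2 : 1 - ρ * x ≤ Real.exp (-(ρ * x)) := by
    linarith [Real.add_one_le_exp (-(ρ * x))]
  set E := Real.exp (-((1 - ρ) * x)) with hE
  have hE0 : 0 < E := Real.exp_pos _
  have h3 : (1 - ρ) * x * E ≤ 1 := by
    have h4 : (1 - ρ) * x ≤ Real.exp ((1 - ρ) * x) := by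
      linarith [Real.add_one_le_exp ((1 - ρ) * x)]
    calc (1 - ρ) * x * E ≤ Real.exp ((1 - ρ) * x) * E := by gcongr
      _ = 1 := by rw [hE, ← Real.exp_add]; simp
  have h5 : x * E ≤ 2 := by nlinarith
  rw [h1]
  nlinarith

lemma exp_neg_le_exp_neg_lam_add {n d k Λ ε δ κ : ℝ} (hε : 0 < ε) (hε1 : ε ≤ 1 / 50) (hn : 0 < n)
    (hd : 0 ≤ d) (hk : 0 ≤ k) (hΛ : 0 ≤ Λ) (hdn : d ≤ δ * n) (hδ1 : δ ≤ 1)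
    (hkδ : 24 * (k * δ) ≤ ε / 10)
    (hκn : 1 ≤ κ * n) (hκd : Real.exp (-(κ * d / 2 - 2)) ≤ ε / 4) :
    Real.exp (-((1 - ε / 100) * ((1 - ε / 100) * (min ((1 - 2 * (ε / 100)) * Λ) (κ * n - 1) * d) -
      6 * (k * d)) / n)) ≤ Real.exp (-(Λ * d / n)) + ε / 4 := by
  set η := ε / 100 with hη
  set w := min ((1 - 2 * η) * Λ) (κ * n - 1) with hw
  have hη1 : η ≤ 1 / 5000 := by rw [hη]; linarith
  have hη0 : 0 < η := by positivity
  have hsmall : 6 * (k * d) / n ≤ ε / 40 := by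
    rw [div_le_iff₀ hn]
    nlinarith
  have hT : (1 - η) ^ 2 * (w * (d / n)) - ε / 40 ≤
      (1 - η) * ((1 - η) * (w * d) - 6 * (k * d)) / n := by
    have h1 : (1 - η) * ((1 - η) * (w * d) - 6 * (k * d)) / n =
        (1 - η) ^ 2 * (w * (d / n)) - (1 - η) * (6 * (k * d) / n) := by field_simp
    rw [h1]
    have : 0 ≤ 6 * (k * d) / n := by positivity
    nlinarith
  have hdn0 : 0 ≤ d / n := by positivity
  rcases le_total ((1 - 2 * η) * Λ) (κ * n - 1) with h | h
  · rw [min_eq_left h] at hw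
    set x := Λ * d / n with hx
    have hx0 : 0 ≤ x := by positivity
    have h1 : (1 - 4 * η) * x - ε / 40 ≤ (1 - η) * ((1 - η) * (w * d) - 6 * (k * d)) / n := by
      refine le_trans ?_ hT
      have h2 : (1 - η) ^ 2 * (w * (d / n)) = (1 - η) ^ 2 * (1 - 2 * η) * x := by
        rw [hw, hx]; ring
      rw [h2]
      gcongr
      nlinarith [sq_nonneg η]
    have h3 : Real.exp (ε / 40) ≤ 1 + ε / 20 := by
      have := Real.abs_exp_sub_one_le (x := ε / 40) (by rw [abs_of_pos (by positivity)]; linarith)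
      rw [abs_of_pos (by positivity : 0 < ε / 40)] at this
      linarith [le_abs_self (Real.exp (ε / 40) - 1)]
    have h4 := exp_neg_one_sub_mul_le (ρ := 4 * η) (x := x) (by linarith) (by linarith)
    have h5 : Real.exp (-x) ≤ 1 := by
      rw [Real.exp_le_one_iff]; linarith
    calc _ ≤ Real.exp (-((1 - 4 * η) * x - ε / 40)) := Real.exp_le_exp.2 (by linarith)
      _ = Real.exp (-((1 - 4 * η) * x)) * Real.exp (ε / 40) := by
          rw [← Real.exp_add]; ring_nf
      _ ≤ (Real.exp (-x) + 2 * (4 * η)) * (1 + ε / 20) := by gcongr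
      _ ≤ _ := by rw [hη]; nlinarith
  · rw [min_eq_right h] at hw
    have h1 : κ * d / 2 - 2 ≤ (1 - η) * ((1 - η) * (w * d) - 6 * (k * d)) / n := by
      refine le_trans ?_ hT
      have h2 : w * (d / n) = κ * d - d / n := by rw [hw]; field_simp
      have h3 : d / n ≤ 1 := by
        rw [div_le_iff₀ hn]; nlinarith
      have h4 : 0 ≤ w * (d / n) := mul_nonneg (by rw [hw]; linarith) hdn0
      have h5 : 1 / 2 ≤ (1 - η) ^ 2 := by nlinarith
      have h6 : 1 / 2 * (w * (d / n)) ≤ (1 - η) ^ 2 * (w * (d / n)) := by gcongr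
      linarith
    calc _ ≤ Real.exp (-(κ * d / 2 - 2)) := Real.exp_le_exp.2 (by linarith)
      _ ≤ ε / 4 := hκd
      _ ≤ _ := by linarith [Real.exp_pos (-(Λ * d / n))]

end Estimates

lemma one_sub_le_uniformProb {α : Type*} {S : Finset α} (hS : S.Nonempty) {A B : α → Prop}
    [DecidablePred B] {ε : ℝ} (hAB : ∀ x ∈ S, ¬ A x → B x) (hB : ((S.filter B).card : ℝ) ≤ ε * S.card) :
    1 - ε ≤ uniformProb S A := by
  classical
  have hS' : (0 : ℝ) < S.card := by exact_mod_cast Finset.card_pos.2 hS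
  have h1 : S.card ≤ (S.filter A).card + (S.filter B).card := by
    rw [← Finset.card_filter_add_card_filter_not A]
    refine Nat.add_le_add_left (Finset.card_le_card fun x hx => ?_) _
    rw [Finset.mem_filter] at hx ⊢
    exact ⟨hx.1, hAB x hx.1 hx.2⟩
  have h2 : (S.card : ℝ) ≤ (S.filter A).card + (S.filter B).card := by exact_mod_cast h1
  have h3 : 1 - ε ≤ ((S.filter A).card : ℝ) / S.card := by
    rw [le_div_iff₀ hS']
    linarith
  unfold uniformProb
  convert h3

open Classical in
lemma uniformProb_mono {α : Type*} {S : Finset α} {A B : α → Prop} (h : ∀ x, A x → B x) :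
    uniformProb S A ≤ uniformProb S B := by
  refine div_le_div_of_nonneg_right (Nat.cast_le.2 (Finset.card_le_card fun x hx => ?_))
    (Nat.cast_nonneg _)
  rw [Finset.mem_filter] at hx ⊢
  exact ⟨hx.1, h x hx.2⟩

lemma card_filter_or_le {α : Type*} {S : Finset α} {A B : α → Prop} [DecidablePred A]
    [DecidablePred B] [DecidablePred fun x => A x ∨ B x] {a b : ℝ}
    (hA : ((S.filter A).card : ℝ) ≤ a * S.card) (hB : ((S.filter B).card : ℝ) ≤ b * S.card) :
    ((S.filter fun x => A x ∨ B x).card : ℝ) ≤ (a + b) * S.card := by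
  have h : ((S.filter fun x => A x ∨ B x).card : ℝ) ≤ (S.filter A).card + (S.filter B).card := by
    classical
    have h1 : (S.filter fun x => A x ∨ B x).card ≤ (S.filter A ∪ S.filter B).card :=
      Finset.card_le_card fun x hx => by
        simpa only [Finset.mem_union, Finset.mem_filter, and_or_left] using hx
    exact_mod_cast h1.trans (Finset.card_union_le _ _)
  linarith

/-- The three assertions about the waypoints and rings of `t`. -/
def RingsGood {n d : ℕ} (ε δ : ℝ) (p l : ℕ) (x : ℝ) (t : Fin n)
    (ω : Equiv.Perm (Fin n × Fin d) × (Fin n → Finset (Fin n) → Finset (Fin n))) : Prop :=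
  (∀ i : ℕ, i ≤ l → (d : ℝ) * (p : ℝ) ^ i ≤ δ * n →
    |((waypoints ω.1 ω.2 t i).card : ℝ) - (d : ℝ) * (p : ℝ) ^ i| ≤ ε * ((d : ℝ) * (p : ℝ) ^ i)) ∧
  ((outerRing ω.1 ω.2 t l).card : ℝ) ≤ (Real.exp (-x) + ε) * n ∧
  ∀ v ∈ outerRing ω.1 ω.2 t l, ∃ u ∈ innerRing ω.1 ω.2 t l, u ∈ nbrs ω.1 v

open Classical in
theorem ringsGood_probability {n d p m k : ℕ} {ε δ κ : ℝ} (t : Fin n) (hε : 0 < ε)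
    (hε1 : ε ≤ 1 / 50) (hδ : 0 < δ)
    (hδz : 48 * Real.exp (2 / (ε / 100)) ^ 2 * δ ≤ 1)
    (hδε : 80 * δ ≤ (ε / 100) * (ε / 8)) (hδk : 24 * (k * δ) ≤ ε / 10)
    (hk : (1 - ε / 8) ^ k ≤ ε / 8) (hκ1 : κ ≤ 1 / 100)
    (hκ : κ * (4 * (1 / δ + 8 * (8 / ε))) ≤ 1) (hn : 47 ≤ n) (hkn : 2 * (k : ℝ) < ε * n)
    (hκn : 1 ≤ κ * n) (heven : Even (n * d)) (hp : 2 ≤ p) (hpd : p ≤ d) (hdn : (d : ℝ) ≤ δ * n)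
    (hm : (d : ℝ) * p ^ m ≤ δ * n)
    (hdef : (m + 1) * (n * Real.exp (-d)) + (if 2 * p ≤ d then (0 : ℝ) else
      12 * (m + 1) / (d : ℝ)) ≤ (ε / 100) * (ε / 8) / 2)
    (hne : n * Real.exp (-d) ≤ ε / 8) (hne' : n * Real.exp (-(3 / 5 * d)) ≤ ε / 8)
    (hκd : Real.exp (-(κ * d / 2 - 2)) ≤ ε / 4)
    (hlam : 1 ≤ d * p ^ (m + 1) * d / (n : ℝ)) :
    1 - ε ≤ uniformProb (pairings n d ×ˢ selections n p)
      (RingsGood ε δ p (m + 1) (d * p ^ (m + 1) * d / (n : ℝ)) t) := by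
  have hd : 1 ≤ d := by omega
  have hd' : (1 : ℝ) ≤ d := by exact_mod_cast hd
  have hp' : (1 : ℝ) ≤ p := by exact_mod_cast (by omega : 1 ≤ p)
  have hn' : (47 : ℝ) ≤ n := by exact_mod_cast hn
  set η := ε / 100 with hη
  have hη0 : 0 < η := by positivity
  have hη1 : η ≤ 1 / 5000 := by rw [hη]; linarith
  set Λ : ℝ := d * p ^ (m + 1) with hΛ
  set lam : ℝ := Λ * d / n with hlamdef
  have hΛ0 : 0 < Λ := by positivity
  set P := pairingSet (Fin n × Fin d) with hP
  set Sel := selections n p with hSel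
  rw [pairings_eq, ← hP]
  have hPne : P.Nonempty := pairingSet_nonempty (by simpa using heven)
  set M := ⌊κ * n⌋₊ with hM
  have hMhi : (M : ℝ) ≤ κ * n := Nat.floor_le (by linarith)
  have hMlo : κ * n - 1 ≤ M := (Nat.sub_one_lt_floor _).le
  have hδ1 : δ ≤ 1 / 1000000 := by
    have : η * (ε / 8) ≤ 1 / 5000 * (1 / 50 / 8) := by gcongr
    linarith
  have hz8 : 48 * Real.exp 8 ^ 2 * δ ≤ 1 := by
    refine le_trans ?_ hδz
    have : (8 : ℝ) ≤ 2 / (ε / 100) := by rw [le_div_iff₀ (by positivity)]; linarith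
    gcongr
  have hκ0 : 0 < κ := by
    by_contra! h
    linarith [mul_nonpos_of_nonpos_of_nonneg h (by linarith : (0 : ℝ) ≤ n)]
  -- the exceptional events
  set w₀ := min ((1 - 2 * η) * Λ) (κ * n) with hw₀
  set a := (Real.exp (-lam) + ε) * n with ha
  set U := fun (σ : Equiv.Perm (Fin n × Fin d)) (s : Fin n → Finset (Fin n) → Finset (Fin n)) =>
    unreached σ (explored σ s t (m + 1)) (truncate M (waypoints σ s t (m + 1))) with hU
  obtain ⟨Q1, hQ1⟩ : ∃ Q : Equiv.Perm (Fin n × Fin d) → (Fin n → Finset (Fin n) → Finset (Fin n)) → Prop,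
      ∀ σ s, Q σ s ↔ η < relDeficit σ s t p (m + 1) :=
    ⟨_, fun _ _ => Iff.rfl⟩
  obtain ⟨Q2, hQ2⟩ : ∃ Q : Equiv.Perm (Fin n × Fin d) → (Fin n → Finset (Fin n) → Finset (Fin n)) → Prop,
      ∀ σ s, Q σ s ↔ η < relCoincidences σ s t p (δ * n) (m + 1) :=
    ⟨_, fun _ _ => Iff.rfl⟩
  obtain ⟨Q3, hQ3⟩ : ∃ Q : Equiv.Perm (Fin n × Fin d) → (Fin n → Finset (Fin n) → Finset (Fin n)) → Prop,
      ∀ σ s, Q σ s ↔ 8 * (8 / ε) * Λ ^ 2 / n < numCoincidences σ s t p m :=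
    ⟨_, fun _ _ => Iff.rfl⟩
  obtain ⟨Q4, hQ4⟩ : ∃ Q : Equiv.Perm (Fin n × Fin d) → (Fin n → Finset (Fin n) → Finset (Fin n)) → Prop,
      ∀ σ s, Q σ s ↔ ¬ (∀ v, v ∉ explored σ s t (m + 1) →
      (hits σ (explored σ s t (m + 1)) v : ℝ) ≤ η * d) :=
    ⟨_, fun _ _ => Iff.rfl⟩
  obtain ⟨Q5, hQ5⟩ : ∃ Q : Equiv.Perm (Fin n × Fin d) → (Fin n → Finset (Fin n) → Finset (Fin n)) → Prop,
      ∀ σ s, Q σ s ↔ ((∀ v, v ∉ explored σ s t (m + 1) →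
      (hits σ (explored σ s t (m + 1)) v : ℝ) ≤ η * d) ∧
      w₀ ≤ (waypoints σ s t (m + 1)).card) ∧ a < (U σ s).card :=
    ⟨_, fun _ _ => Iff.rfl⟩
  obtain ⟨Q6, hQ6⟩ : ∃ Q : Equiv.Perm (Fin n × Fin d) → (Fin n → Finset (Fin n) → Finset (Fin n)) → Prop,
      ∀ σ s, Q σ s ↔ (∀ v, v ∉ explored σ s t (m + 1) →
      (hits σ (explored σ s t (m + 1)) v : ℝ) ≤ η * d) ∧ ((U σ s).card : ℝ) ≤ 2 / 5 * n ∧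
      ∃ v ∈ outerRing σ s t (m + 1), ¬ ∃ u ∈ innerRing σ s t (m + 1), u ∈ nbrs σ v :=
    ⟨_, fun _ _ => Iff.rfl⟩
  have hexp1 : Real.exp (-lam) ≤ 0.37 := by
    refine (Real.exp_le_exp.2 (neg_le_neg hlam)).trans ?_
    have := Real.exp_neg_one_lt_d9
    linarith
  have ha25 : a ≤ 2 / 5 * n := by
    rw [ha]; gcongr; linarith
  -- outside the exceptional events all assertions hold
  have hgood : ∀ ω ∈ P ×ˢ Sel, ¬ RingsGood ε δ p (m + 1) lam t ω →
      Q1 ω.1 ω.2 ∨ Q2 ω.1 ω.2 ∨ Q3 ω.1 ω.2 ∨ Q4 ω.1 ω.2 ∨ Q5 ω.1 ω.2 ∨ Q6 ω.1 ω.2 := by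
    rintro ⟨σ, s⟩ hω hbad
    rw [Finset.mem_product] at hω
    obtain ⟨hσ, hs⟩ := hω
    by_contra hcon
    push Not at hcon
    obtain ⟨h1, h2, h3, h4, h5, h6⟩ := hcon
    rw [hQ1, not_lt] at h1
    rw [hQ2, not_lt] at h2
    rw [hQ3, not_lt] at h3
    rw [hQ4, not_not] at h4
    rw [hQ5] at h5
    rw [hQ6] at h6
    have hw := min_le_card_waypoints (t := t) hs hp hd hδ hm (by linarith) h1 h2
      (by positivity) h3 hκ
    have h7 : ((U σ s).card : ℝ) ≤ a := by
      by_contra! h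
      exact h5 ⟨⟨h4, hw⟩, h⟩
    apply hbad
    refine ⟨fun i hi hB => ?_, ?_, ?_⟩
    · have h8 := le_card_waypoints (σ := σ) (s := s) (t := t) hp hd i hB
      have h9 : ((waypoints σ s t i).card : ℝ) ≤ d * p ^ i := by
        exact_mod_cast card_waypoints_le hs i
      have h10 := (relDeficit_mono (σ := σ) (t := t) hs hi).trans h1
      have h11 := (relCoincidences_mono (σ := σ) (s := s) (t := t) (p := p) (δ * n) hi).trans h2
      have h12 : 0 ≤ (d : ℝ) * p ^ i := by positivity
      rw [abs_le]
      constructor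
      · have : (d : ℝ) * p ^ i * (1 - ε) ≤ (d : ℝ) * p ^ i *
            (1 - relDeficit σ s t p i - relCoincidences σ s t p (δ * n) i) :=
          mul_le_mul_of_nonneg_left (by linarith) h12
        linarith
      · have : 0 ≤ ε * ((d : ℝ) * p ^ i) := by positivity
        linarith
    · refine le_trans ?_ h7
      exact_mod_cast Finset.card_le_card (outerRing_subset_unreached hσ (truncate_subset M _))
    · by_contra! h8
      obtain ⟨v, hv, h9⟩ := h8
      exact h6 ⟨h4, h7.trans ha25, v, hv, by push Not; exact h9⟩
  -- their probabilities
  have hδ24 : 24 * δ ≤ η * (ε / 8) := by linarith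
  have hδn : δ * n ≤ 1 / 1000000 * n := by gcongr
  have hκn' : κ * n ≤ 1 / 100 * n := by gcongr
  have h24m : 24 * ((d : ℝ) * p ^ m) ≤ n := by linarith
  have hB1 : (((P ×ˢ Sel).filter fun ω => Q1 ω.1 ω.2).card : ℝ) ≤ ε / 8 * (P ×ˢ Sel).card := by
    refine card_filter_product_le fun s hs => ?_
    simp only [hQ1]
    have h : (((P.filter fun σ => η < relDeficit σ s t p (m + 1)).card : ℕ) : ℝ) ≤
        ε / 8 * P.card := by
      refine card_filter_lt_le (fun σ _ => relDeficit_nonneg hs _) hη0 ?_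
      refine (sum_relDeficit_le hs hp hpd (by omega) m hz8 hm).trans ?_
      exact mul_le_mul_of_nonneg_right (by linarith) (Nat.cast_nonneg _)
    convert h
  have hB2 : (((P ×ˢ Sel).filter fun ω => Q2 ω.1 ω.2).card : ℝ) ≤ ε / 8 * (P ×ˢ Sel).card := by
    simp only [hQ2]
    have h : (((P ×ˢ Sel).filter fun ω =>
        η < relCoincidences ω.1 ω.2 t p (δ * n) (m + 1)).card : ℝ) ≤ ε / 8 * (P ×ˢ Sel).card := by
      refine card_filter_lt_le (fun ω _ => relCoincidences_nonneg _ _) hη0 ?_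
      rw [Finset.sum_product, Finset.card_product]
      refine (sum_relCoincidences_le hp hd (by omega) hδ.le m (by linarith) hm).trans ?_
      rw [Nat.cast_mul]
      exact mul_le_mul_of_nonneg_right hδ24 (by positivity)
    convert h
  have hB3 : (((P ×ˢ Sel).filter fun ω => Q3 ω.1 ω.2).card : ℝ) ≤ ε / 8 * (P ×ˢ Sel).card := by
    simp only [hQ3]
    have h : (((P ×ˢ Sel).filter fun ω => 8 * (8 / ε) * Λ ^ 2 / n <
        (numCoincidences ω.1 ω.2 t p m : ℝ)).card : ℝ) ≤ ε / 8 * (P ×ˢ Sel).card := by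
      refine card_filter_lt_le (fun ω _ => Nat.cast_nonneg _) (by positivity) ?_
      rw [Finset.sum_product, Finset.card_product]
      refine (sum_sum_numCoincidences_le hp hd (by omega) m h24m).trans (le_of_eq ?_)
      rw [Nat.cast_mul, ← hΛ, hP]
      congr 1
      field_simp
    convert h
  have hB4 : (((P ×ˢ Sel).filter fun ω => Q4 ω.1 ω.2).card : ℝ) ≤ ε / 8 * (P ×ˢ Sel).card := by
    have h1 : 48 * Real.exp (2 / η) ^ 2 * ((d : ℝ) * p ^ m) ≤ n := by
      have h0 : 0 ≤ 48 * Real.exp (2 / η) ^ 2 := by positivity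
      have h2 := mul_le_mul_of_nonneg_left hm h0
      have h3 := mul_le_mul_of_nonneg_right hδz (by linarith : (0 : ℝ) ≤ n)
      linarith
    refine card_filter_product_le fun s hs => ?_
    simp only [hQ4]
    have h := (card_filter_exists_hits_le (t := t) hs hp hd hη0 m h1).trans
      (mul_le_mul_of_nonneg_right hne (Nat.cast_nonneg _))
    convert h
  have hB5 : (((P ×ˢ Sel).filter fun ω => Q5 ω.1 ω.2).card : ℝ) ≤ ε / 8 * (P ×ˢ Sel).card := by
    refine card_filter_product_le fun s hs => ?_
    simp only [hQ5]
    have hexp0 : 0 < Real.exp (-lam) := Real.exp_pos _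
    have hμ := exp_neg_le_exp_neg_lam_add hε hε1 (by linarith) (by linarith) (Nat.cast_nonneg k)
        hΛ0.le hdn (by linarith) hδk hκn hκd
    have ha1 : (k : ℝ) < a := by
      have : 0 < Real.exp (-lam) * n := by positivity
      rw [ha]; linarith
    have ha2 : n * (Real.exp (-lam) + ε / 4) ≤ (1 - ε / 8) * (a - k) := by
      have h1 : (Real.exp (-lam) + ε / 2) * n ≤ a - k := by rw [ha]; linarith
      have h2 : Real.exp (-lam) + ε / 4 ≤ (1 - ε / 8) * (Real.exp (-lam) + ε / 2) := by
        have : ε / 8 * (Real.exp (-lam) + ε / 2) ≤ ε / 8 * 2 := by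
          gcongr
          linarith
        linarith
      have h3 := mul_le_mul_of_nonneg_left h1 (by linarith : (0 : ℝ) ≤ 1 - ε / 8)
      have h4 := mul_le_mul_of_nonneg_right h2 (by linarith : (0 : ℝ) ≤ n)
      linarith
    have h := (card_filter_many_unreached_le (t := t) (k := k) (θ := 1 - ε / 8)
      (μ := Real.exp (-lam) + ε / 4) (w := min ((1 - 2 * η) * Λ) (κ * n - 1)) (w₀ := w₀) (a := a)
      (η := η) hs hp hd h24m (by linarith) (by linarith)
      ((min_le_right _ _).trans hMlo) (min_le_min_left _ (by linarith))
      hμ ha1 ha2 (by linarith)).trans (mul_le_mul_of_nonneg_right hk (Nat.cast_nonneg _))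
    convert h
  have hB6 : (((P ×ˢ Sel).filter fun ω => Q6 ω.1 ω.2).card : ℝ) ≤ ε / 8 * (P ×ˢ Sel).card := by
    refine card_filter_product_le fun s hs => ?_
    simp only [hQ6]
    have h40 : 40 * (3 * ((d : ℝ) * p ^ m) + M) ≤ n := by linarith
    have h := (card_filter_isolated_le (t := t) hs hp hd hn h40 (by linarith : η ≤ 1 / 10)).trans
      (mul_le_mul_of_nonneg_right hne' (Nat.cast_nonneg _))
    convert h
  have hor := card_filter_or_le hB1 (card_filter_or_le hB2 (card_filter_or_le hB3
    (card_filter_or_le hB4 (card_filter_or_le hB5 hB6))))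
  have hor' := hor.trans (mul_le_mul_of_nonneg_right (by linarith :
    ε / 8 + (ε / 8 + (ε / 8 + (ε / 8 + (ε / 8 + ε / 8)))) ≤ ε) (Nat.cast_nonneg _))
  exact one_sub_le_uniformProb (hPne.product (selections_nonempty n p)) hgood hor'

lemma exists_numLevels_eq {n d p : ℕ} (hn : 1 ≤ n) (hd : 1 ≤ d) (hp : 2 ≤ p) :
    ∃ m : ℕ, numLevels n d p = m + 1 ∧ (m = 0 ∨ (p : ℝ) ^ m ≤ n / (2 * (d : ℝ) ^ 2)) := by
  have hp' : (1 : ℝ) < p := by exact_mod_cast hp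
  have hd' : (1 : ℝ) ≤ d := by exact_mod_cast hd
  have hn' : (1 : ℝ) ≤ n := by exact_mod_cast hn
  refine ⟨numLevels n d p - 1, ?_, ?_⟩
  · have : 1 ≤ numLevels n d p := le_max_left _ _
    omega
  · rcases Nat.eq_zero_or_pos (numLevels n d p - 1) with h | h
    · exact Or.inl h
    · right
      have h1 : numLevels n d p - 1 < ⌈Real.logb p ((n : ℝ) / (2 * (d : ℝ) ^ 2))⌉₊ := by
        unfold numLevels at h ⊢
        omega
      have h2 := (Real.lt_logb_iff_rpow_lt hp' (by positivity)).1 (Nat.lt_ceil.1 h1)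
      rw [Real.rpow_natCast] at h2
      exact h2.le

lemma lam_eq (n d p : ℕ) :
    lam n d p = d * (p : ℝ) ^ numLevels n d p * d / n := by
  unfold lam
  ring

lemma one_le_lam {n d p : ℕ} (hn : 1 ≤ n) (hd : 1 ≤ d)
    (h : ((n : ℝ) / (d : ℝ) ^ 2) ^ (1 / (numLevels n d p : ℝ)) ≤ (p : ℝ)) : 1 ≤ lam n d p := by
  have hd' : (1 : ℝ) ≤ d := by exact_mod_cast hd
  have hn' : (1 : ℝ) ≤ n := by exact_mod_cast hn
  have hl : numLevels n d p ≠ 0 := (Nat.lt_of_lt_of_le one_pos (le_max_left _ _)).ne'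
  have h1 := pow_le_pow_left₀ (by positivity) h (numLevels n d p)
  rw [one_div, Real.rpow_inv_natCast_pow (by positivity) hl] at h1
  unfold lam
  rw [le_div_iff₀ (by linarith), one_mul]
  rwa [div_le_iff₀ (by positivity)] at h1

lemma le_exp_half_of_two_log_le {n d : ℕ} (hn : 1 ≤ n) (h : 2 * (Real.log n + 5) ≤ (d : ℝ)) :
    (n : ℝ) ≤ Real.exp (d / 2) := by
  rw [← Real.log_le_iff_le_exp (by exact_mod_cast hn)]
  linarith

/-- The number of waypoint levels is at most `d`, and small compared with `d` if `p` is
comparable to `d`. -/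
lemma levels_le_of_pow_le {n d p m : ℕ} (hn : 1 ≤ n) (hp : 2 ≤ p) (hpm : (p : ℝ) ^ m ≤ n)
    (h : 2 * (Real.log n + 5) ≤ (d : ℝ)) :
    (m + 1 : ℝ) ≤ d ∧ (d < 2 * p → m * Real.log (d / 2) ≤ (d : ℝ) / 2) := by
  have hp' : (2 : ℝ) ≤ p := by exact_mod_cast hp
  have hn' : (1 : ℝ) ≤ n := by exact_mod_cast hn
  have hm : (0 : ℝ) ≤ m := Nat.cast_nonneg m
  have hlog : m * Real.log p ≤ Real.log n := by
    rw [← Real.log_pow]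
    exact Real.log_le_log (by positivity) hpm
  have hlog0 := Real.log_nonneg hn'
  constructor
  · have h1 : m * Real.log 2 ≤ m * Real.log p :=
      mul_le_mul_of_nonneg_left (Real.log_le_log (by norm_num) hp') hm
    have h2 : m * 0.6 ≤ m * Real.log 2 :=
      mul_le_mul_of_nonneg_left (by linarith [Real.log_two_gt_d9]) hm
    linarith
  · intro hdp
    have hdp' : (d : ℝ) < 2 * p := by exact_mod_cast hdp
    have h1 : m * Real.log (d / 2) ≤ m * Real.log p :=
      mul_le_mul_of_nonneg_left (Real.log_le_log (by linarith) (by linarith)) hm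
    linarith

open Filter Topology in
lemma eventually_degree_bounds {c δ ε κ : ℝ} (hc : 0 < c) (hδ : 0 < δ) (hε : 0 < ε) (hκ : 0 < κ) :
    ∀ᶠ x : ℝ in atTop, x * Real.exp (-(x / 2)) ≤ c ∧ Real.exp (-(x / 10)) ≤ ε / 8 ∧
      Real.exp (-(κ * x / 2 - 2)) ≤ ε / 4 ∧ 1 ≤ 2 * δ * x ∧
      12 / x + 6 / Real.log (x / 2) ≤ c ∧ 3 ≤ x := by
  have h1 : Tendsto (fun x : ℝ => x * Real.exp (-(x / 2))) atTop (𝓝 0) := by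
    have h := (Real.tendsto_pow_mul_exp_neg_atTop_nhds_zero 1).comp
      (tendsto_id.atTop_div_const (by norm_num : (0 : ℝ) < 2))
    have h' := h.const_mul 2
    rw [mul_zero] at h'
    refine h'.congr fun x => ?_
    simp only [Function.comp, id, pow_one]
    ring
  have h2 : Tendsto (fun x : ℝ => Real.exp (-(x / 10))) atTop (𝓝 0) :=
    Real.tendsto_exp_neg_atTop_nhds_zero.comp
      (tendsto_id.atTop_div_const (by norm_num : (0 : ℝ) < 10))
  have h3 : Tendsto (fun x : ℝ => Real.exp (-(κ * x / 2 - 2))) atTop (𝓝 0) := by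
    refine Real.tendsto_exp_neg_atTop_nhds_zero.comp (tendsto_atTop_add_const_right _ (-2) ?_)
    exact (tendsto_id.const_mul_atTop hκ).atTop_div_const (by norm_num)
  have h4 : Tendsto (fun x : ℝ => 2 * δ * x) atTop atTop :=
    tendsto_id.const_mul_atTop (by positivity)
  have h5 : Tendsto (fun x : ℝ => 12 / x + 6 / Real.log (x / 2)) atTop (𝓝 0) := by
    rw [← add_zero (0 : ℝ)]
    refine (tendsto_id.const_div_atTop 12).add (Tendsto.const_div_atTop ?_ 6)
    exact Real.tendsto_log_atTop.comp (tendsto_id.atTop_div_const (by norm_num : (0 : ℝ) < 2))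
  filter_upwards [h1.eventually_le_const hc, h2.eventually_le_const (by positivity : 0 < ε / 8),
    h3.eventually_le_const (by positivity : 0 < ε / 4), h4.eventually_ge_atTop 1,
    h5.eventually_le_const hc, eventually_ge_atTop 3] with x a1 a2 a3 a4 a5 a6
  exact ⟨a1, a2, a3, a4, a5, a6⟩

theorem exists_ringsGood_probability {ε : ℝ} (hε : 0 < ε) (hε1 : ε ≤ 1 / 50) :
    ∃ δ : ℝ, 0 < δ ∧ ∃ N : ℕ, ∀ (n d p : ℕ) (t : Fin n), N ≤ n → Even (n * d) →
      2 * (Real.log n + 5) ≤ (d : ℝ) → (d : ℝ) ≤ δ * n → 2 ≤ p → p ≤ d →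
      ((n : ℝ) / (d : ℝ) ^ 2) ^ (1 / (numLevels n d p : ℝ)) ≤ (p : ℝ) →
      1 - ε ≤ uniformProb (pairings n d ×ˢ selections n p)
        (RingsGood ε δ p (numLevels n d p) (lam n d p) t) := by
  obtain ⟨k, hk⟩ := exists_pow_lt_of_lt_one (by positivity : 0 < ε / 8)
    (by linarith : 1 - ε / 8 < 1)
  have hA : 0 < 48 * Real.exp (2 / (ε / 100)) ^ 2 := by positivity
  obtain ⟨δ, hδ, hδ1⟩ : ∃ δ : ℝ, 0 < δ ∧ δ ≤ 1 / (48 * Real.exp (2 / (ε / 100)) ^ 2) ∧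
      δ ≤ (ε / 100) * (ε / 8) / 80 ∧ δ ≤ ε / 10 / (24 * (k + 1)) :=
    ⟨min (1 / (48 * Real.exp (2 / (ε / 100)) ^ 2))
      (min ((ε / 100) * (ε / 8) / 80) (ε / 10 / (24 * (k + 1)))), by positivity,
      min_le_left _ _, (min_le_right _ _).trans (min_le_left _ _),
      (min_le_right _ _).trans (min_le_right _ _)⟩
  obtain ⟨hδz, hδε, hδk⟩ := hδ1
  rw [le_div_iff₀ hA] at hδz
  rw [le_div_iff₀ (by positivity)] at hδε hδk
  obtain ⟨κ, hκ0, hκ1, hκ⟩ : ∃ κ : ℝ, 0 < κ ∧ κ ≤ 1 / 100 ∧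
      κ ≤ 1 / (4 * (1 / δ + 8 * (8 / ε))) :=
    ⟨min (1 / 100) (1 / (4 * (1 / δ + 8 * (8 / ε)))), by positivity, min_le_left _ _,
      min_le_right _ _⟩
  rw [le_div_iff₀ (by positivity)] at hκ
  set c := (ε / 100) * (ε / 8) / 4 with hc
  have hc0 : 0 < c := by positivity
  have hcε : c ≤ ε / 8 := by
    have : ε / 100 * (ε / 8) ≤ 1 * (ε / 8) := by
      gcongr
      linarith
    linarith
  obtain ⟨D, hD⟩ := Filter.eventually_atTop.1 (eventually_degree_bounds hc0 hδ hε hκ0)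
  obtain ⟨N, hN⟩ := exists_nat_ge
    (max (max 47 (Real.exp D)) (max (2 * k / ε + 1) (1 / κ)))
  simp only [max_le_iff] at hN
  obtain ⟨⟨hN1, hN2⟩, hN3, hN4⟩ := hN
  refine ⟨δ, hδ, N, fun n d p t hNn heven hlog hdn hp hpd hpl => ?_⟩
  have hNn' : (N : ℝ) ≤ n := by exact_mod_cast hNn
  have hn' : (47 : ℝ) ≤ n := hN1.trans hNn'
  have hn : 47 ≤ n := by exact_mod_cast hn'
  have hd : 1 ≤ d := by omega
  have hd' : (1 : ℝ) ≤ d := by exact_mod_cast hd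
  have hp' : (2 : ℝ) ≤ p := by exact_mod_cast hp
  have hDd : D ≤ d := by
    have h1 : D ≤ Real.log n := by
      rw [Real.le_log_iff_exp_le (by linarith)]
      exact hN2.trans hNn'
    have := Real.log_nonneg (by linarith : (1 : ℝ) ≤ n)
    linarith
  obtain ⟨b1, b2, b3, b4, b5, b6⟩ := hD d hDd
  have hlam := one_le_lam (by omega) hd hpl
  obtain ⟨m, hm, hpm⟩ := exists_numLevels_eq (n := n) (by omega) hd hp
  rw [lam_eq] at hlam ⊢
  rw [hm] at hlam ⊢
  have hpn : (p : ℝ) ^ m ≤ n := by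
    rcases hpm with rfl | h
    · rw [pow_zero]; linarith
    · refine h.trans (div_le_self (by linarith) ?_)
      nlinarith
  have hdpm : (d : ℝ) * p ^ m ≤ δ * n := by
    rcases hpm with rfl | h
    · rwa [pow_zero, mul_one]
    · rw [le_div_iff₀ (by positivity)] at h
      have h1 : (d : ℝ) * p ^ m * 1 ≤ d * p ^ m * (2 * δ * d) := by gcongr
      have h2 : δ * ((p : ℝ) ^ m * (2 * d ^ 2)) ≤ δ * n := by gcongr
      linarith
  obtain ⟨hmd, hmp⟩ := levels_le_of_pow_le (d := d) (by omega) hp hpn hlog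
  have hexp := le_exp_half_of_two_log_le (by omega) hlog
  have hne : (n : ℝ) * Real.exp (-d) ≤ Real.exp (-(d / 2)) := by
    calc (n : ℝ) * Real.exp (-d) ≤ Real.exp (d / 2) * Real.exp (-d) := by gcongr
      _ = Real.exp (-(d / 2)) := by rw [← Real.exp_add]; congr 1; ring
  have hne' : (n : ℝ) * Real.exp (-(3 / 5 * d)) ≤ Real.exp (-(d / 10)) := by
    calc (n : ℝ) * Real.exp (-(3 / 5 * d)) ≤ Real.exp (d / 2) * Real.exp (-(3 / 5 * d)) := by
          gcongr
      _ = Real.exp (-(d / 10)) := by rw [← Real.exp_add]; congr 1; ring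
  have hdef1 : (m + 1) * (n * Real.exp (-d)) ≤ c :=
    (mul_le_mul hmd hne (by positivity) (by linarith)).trans b1
  have hdef2 : (if 2 * p ≤ d then (0 : ℝ) else 12 * (m + 1) / (d : ℝ)) ≤ c := by
    split_ifs with h
    · exact hc0.le
    · have hL : 0 < Real.log (d / 2) := Real.log_pos (by linarith)
      refine le_trans ?_ b5
      have h1 : (m : ℝ) / d ≤ 1 / 2 / Real.log (d / 2) := by
        rw [div_le_div_iff₀ (by linarith) hL]
        linarith [hmp (by omega)]
      calc 12 * ((m : ℝ) + 1) / d = 12 / d + 12 * (m / d) := by ring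
        _ ≤ 12 / d + 12 * (1 / 2 / Real.log (d / 2)) := by gcongr
        _ = _ := by ring
  have hk1 : (k : ℝ) * δ ≤ δ * (k + 1) := by linarith
  have hkn : 2 * (k : ℝ) < ε * n := by
    have : 2 * (k : ℝ) / ε < n := by linarith
    rw [div_lt_iff₀ hε] at this
    linarith
  have hκn : 1 ≤ κ * n := by
    have h := hN4.trans hNn'
    rwa [div_le_iff₀ hκ0, mul_comm] at h
  refine ringsGood_probability (k := k) (κ := κ) t hε hε1 hδ ?_ ?_ ?_ hk.le hκ1 hκ hn hkn hκn heven
    hp hpd hdn hdpm ?_ ?_ (hne'.trans b2) b3 hlam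
  · linarith
  · linarith
  · linarith
  · linarith
  · have h1 : Real.exp (-((d : ℝ) / 2)) ≤ d * Real.exp (-(d / 2)) :=
      le_mul_of_one_le_left (Real.exp_pos _).le hd'
    linarith

lemma RingsGood.mono {n d : ℕ} {ε ε' δ : ℝ} {p l : ℕ} {x : ℝ} {t : Fin n}
    {ω : Equiv.Perm (Fin n × Fin d) × (Fin n → Finset (Fin n) → Finset (Fin n))} (h : ε ≤ ε')
    (hω : RingsGood ε δ p l x t ω) : RingsGood ε' δ p l x t ω := by
  refine ⟨fun i hi hB => (hω.1 i hi hB).trans ?_, hω.2.1.trans ?_, hω.2.2⟩ <;> gcongr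

end Spraypoint

theorem mainTheorem1 :
    ∀ ε : ℝ, 0 < ε → ∃ δ : ℝ, 0 < δ ∧ ∃ N : ℕ,
      ∀ (n d p : ℕ) (t : Fin n), N ≤ n → Even (n * d) →
        2 * (Real.log n + 5) ≤ (d : ℝ) → (d : ℝ) ≤ δ * n →
        2 ≤ p → p ≤ d →
        ((n : ℝ) / (d : ℝ) ^ 2) ^ (1 / (Spraypoint.numLevels n d p : ℝ)) ≤ (p : ℝ) →
        1 - ε ≤ Spraypoint.uniformProb
          (Spraypoint.pairings n d ×ˢ Spraypoint.selections n p)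
          (fun ω =>
            (∀ i : ℕ, i ≤ Spraypoint.numLevels n d p → (d : ℝ) * (p : ℝ) ^ i ≤ δ * n →
              |((Spraypoint.waypoints ω.1 ω.2 t i).card : ℝ) - (d : ℝ) * (p : ℝ) ^ i|
                ≤ ε * ((d : ℝ) * (p : ℝ) ^ i)) ∧
            ((Spraypoint.outerRing ω.1 ω.2 t (Spraypoint.numLevels n d p)).card : ℝ)
                ≤ (Real.exp (-Spraypoint.lam n d p) + ε) * n ∧
            ∀ v ∈ Spraypoint.outerRing ω.1 ω.2 t (Spraypoint.numLevels n d p),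
              ∃ u ∈ Spraypoint.innerRing ω.1 ω.2 t (Spraypoint.numLevels n d p),
                u ∈ Spraypoint.nbrs ω.1 v) := by
  intro ε hε
  obtain ⟨δ, hδ, N, h⟩ := Spraypoint.exists_ringsGood_probability
    (ε := min ε (1 / 50)) (by positivity) (min_le_right _ _)
  refine ⟨δ, hδ, N, fun n d p t hN heven hlog hdn hp hpd hpl => ?_⟩
  have h1 := h n d p t hN heven hlog hdn hp hpd hpl
  have h2 : 1 - ε ≤ 1 - min ε (1 / 50) := by linarith [min_le_left ε (1 / 50)]
  exact (h2.trans h1).trans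
    (Spraypoint.uniformProb_mono fun ω hω => hω.mono (min_le_left _ _))
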